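/- Let $\Lambda_1\subset\mathbb R^d\setminus\{0\}$ be finite. For $\lambda\in\Lambda_1$ let $q_\lambda\ge 0$, $p_\lambda$ and $c,f$ be real functions on $\mathbb R^d$ and let $\tau_\lambda\ge 0$. Fix $h_0>0$, $\tau_0>0$, $c_0>0$, $\delta\in(0,1]$, $K\ge1$, an integer $m\ge2$ and constants $M_0,\dots,M_m$. Put $|\Lambda_1|^2=\sum_{\lambda\in\Lambda_1}|\lambda|^2$, $\|\Lambda_1\|^2=\sum_{\lambda\in\Lambda_1}|\tau_\lambda\lambda|^2$. For an integer $k\ge 0$ let $\mathfrak B^k$ be the set of bounded continuous functions $\psi$ on $\mathbb R^d$ whose generalized derivatives $D^\alpha\psi$, $|\alpha|\le k$, are bounded functions; set $|D^j\psi|^2=\sum_{|\alpha|=j}|D^\alpha\psi|^2$ and $\|\psi\|_k^2=\operatorname{ess\,sup}\sum_{|\alpha|\le k}|D^\alpha\psi|^2$. Let $$\mathcal L=\tfrac12\sum_{\lambda\in\Lambda_1}\sum_{i,j=1}^d q_\lambda\lambda_i\lambda_jD_iD_j+\sum_{\lambda\in\Lambda_1}\sum_{i=1}^d p_\lambda\lambda_iD_i-c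 .$$ *Notation.* For $h\in(0,h_0]$, $\lambda\in\Lambda_1$ let $T_{h,\lambda}\varphi(x)=\varphi(x+h\lambda)$, $\delta_{h,\lambda}=h^{-1}(T_{h,\lambda}-1)$, $\bar\delta_{h,\lambda}=\tau_\lambda\delta_{h,\lambda}$, $\chi_{h,\lambda}=q_\lambda+hp_\lambda$. Let $\Lambda=\Lambda_1\cup\{\ell^1,\dots,\ell^d\}$ with distinct additional labels $\ell^i\notin\Lambda_1$, and put $T_{h,\ell^i}=1$, $\bar\delta_{h,\ell^i}=\tau_0D_i$. For $\mu=(\mu^1,\mu^2)\in\Lambda^2$ put $T_{h,\mu}=T_{h,\mu^1}T_{h,\mu^2}$, $\bar\delta_{h,\mu}=\bar\delta_{h,\mu^1}\bar\delta_{h,\mu^2}$. Further, for $\mu\in\Lambda$ or $\mu\in\Lambda^2$, $$Q_{h,\mu}\varphi=h^{-1}\sum_{\lambda\in\Lambda_1}(\bar\delta_{h,\mu}q_\lambda)\,\delta_{h,\lambda}\varphi,\qquad L^0_{h,\mu}\varphi=Q_{h,\mu}\varphi+\sum_{\lambda\in\Lambda_1}(\bar\delta_{h,\mu}p_\lambda)\,\delta_{h,\lambda}\varphi,$$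 $$A_h(\varphi)=2\sum_{\lambda\in\Lambda}(\bar\delta_{h,\lambda}\varphi)\,L^0_{h,\lambda}T_{h,\lambda}\varphi,\qquad \mathcal Q_h(\varphi)=\sum_{\lambda\in\Lambda_1}\chi_{h,\lambda}(\delta_{h,\lambda}\varphi)^2 .$$ Let $\mathfrak K$ be the set of bounded linear operators $\mathcal K$ on the space of bounded Borel functions on $\mathbb R^d$ that preserve nonnegativity and satisfy $\mathcal K1\le1$. *Assumptions.* 1. $q_\lambda,p_\lambda,c,f\in\mathfrak B^m$ for all $\lambda\in\Lambda_1$, and $\sum_{\lambda\in\Lambda_1}(|D^kq_\lambda|^2+|D^kp_\lambda|^2)+|D^kc|^2\le M_k^2$ (a.e.) for $k=0,\dots,m$. 2. $\chi_{h,\lambda}\ge0$ on $\mathbb R^d$ for all $h\in(0,h_0]$, $\lambda\in\Lambda_1$. 3. $\sum_{\lambda\in\Lambda_1}\lambda q_\lambda=0$ on $\mathbb R^d$. 4. $c\ge c_0$ on $\mathbb R^d$. 5. For every $h\in(0,h_0]$ there is $\mathcal K_h\in\mathfrak K$ such that for all smooth $\varphi$ that are bounded together with all their derivatives, a.e. on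 $\mathbb R^d$, $$mA_h(\varphi)\le(1-\delta)\sum_{\lambda\in\Lambda}\mathcal Q_h(\bar\delta_{h,\lambda}\varphi)+K\mathcal Q_h(\varphi)+2(1-\delta)c\,\mathcal K_h\Big(\sum_{\lambda\in\Lambda}|\bar\delta_{h,\lambda}\varphi|^2\Big).$$ 6. For every $h\in(0,h_0]$ and $n=1,\dots,m$ there is $\mathcal K_h=\mathcal K_{h,n}\in\mathfrak K$ such that for all such $\varphi$, a.e. on $\mathbb R^d$, $$n\sum_{\nu\in\Lambda}A_h(\bar\delta_{h,\nu}\varphi)+n(n-1)\sum_{\lambda\in\Lambda^2}(\bar\delta_{h,\lambda}\varphi)\,Q_{h,\lambda}T_{h,\lambda}\varphi\le(1-\delta)\sum_{\lambda\in\Lambda^2}\mathcal Q_h(\bar\delta_{h,\lambda}\varphi)+K\sum_{\lambda\in\Lambda}\mathcal Q_h(\bar\delta_{h,\lambda}\varphi)$$ $$\qquad+2(1-\delta)c\,\mathcal K_h\Big(\sum_{\lambda\in\Lambda^2}|\bar\delta_{h,\lambda}\varphi|^2\Big)+K\mathcal K_h\Big(\sum_{\lambda\in\Lambda}|\bar\delta_{h,\lambda}\varphi|^2\Big).$$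 **Theorem.** Under these assumptions there is exactly one $v\in\mathfrak B^2$ such that $\mathcal Lv+f=0$ almost everywhere on $\mathbb R^d$. Moreover $v\in\mathfrak B^m$ and $$\|v\|_m\le N\|f\|_m,$$ where the constant $N$ depends only on $m,\delta,c_0,\tau_0,K,M_0,\dots,M_m,|\Lambda_1|$ and $\|\Lambda_1\|$. -/

import Mathlib

open MeasureTheory
open scoped ContDiff

noncomputable section

namespace DegenScheme

/-- The Euclidean space `ℝ^d`. -/
abbrev E (d : ℕ) := EuclideanSpace ℝ (Fin d)

/-! ### Derivatives -/

/-- Classical partial derivative `D_i φ`. -/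
def pderiv {d : ℕ} (i : Fin d) (φ : E d → ℝ) : E d → ℝ :=
  fun x => fderiv ℝ φ x (EuclideanSpace.single i 1)

/-- Classical `D^α φ = D_1^{α_1} ⋯ D_d^{α_d} φ`, for a multi-index `α`. -/
def mderiv {d : ℕ} (α : Fin d → ℕ) (φ : E d → ℝ) : E d → ℝ :=
  (List.finRange d).foldr (fun i g => (pderiv i)^[α i] g) φ

/-- Bounded Borel functions on `ℝ^d`, the set `B(ℝ^d)`. -/
def BddBorel {d : ℕ} (ψ : E d → ℝ) : Prop :=
  Measurable ψ ∧ ∃ C : ℝ, ∀ x, |ψ x| ≤ C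

/-- The bounded Borel function `w` represents the generalized derivative `D^α ψ`. -/
def IsGenDeriv {d : ℕ} (α : Fin d → ℕ) (ψ w : E d → ℝ) : Prop :=
  BddBorel w ∧ ∀ φ : E d → ℝ, ContDiff ℝ ∞ φ → HasCompactSupport φ →
    ∫ x, ψ x * mderiv α φ x = (-1 : ℝ) ^ (∑ i, α i) * ∫ x, w x * φ x

open Classical in
/-- A bounded Borel representative of the generalized derivative `D^α ψ` (it is determined up to
null sets), and `0` when the generalized derivative is not a bounded function. -/
def genDeriv {d : ℕ} (α : Fin d → ℕ) (ψ : E d → ℝ) : E d → ℝ :=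
  if h : ∃ w, IsGenDeriv α ψ w then h.choose else 0

/-- The multi-index of the single derivative `D_i`. -/
def unitIndex {d : ℕ} (i : Fin d) : Fin d → ℕ := Pi.single i 1

/-- `|D^k ψ|² = ∑_{|α| = k} |D^α ψ|²`, with generalized derivatives. -/
def derivSq {d : ℕ} (k : ℕ) (ψ : E d → ℝ) (x : E d) : ℝ :=
  ∑ α ∈ Finset.piAntidiag (Finset.univ : Finset (Fin d)) k, (genDeriv α ψ x) ^ 2

/-- The space `𝔅^m` of bounded continuous functions on `ℝ^d` whose generalized derivatives of
order at most `m` are bounded functions. -/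
def MemB {d : ℕ} (m : ℕ) (ψ : E d → ℝ) : Prop :=
  Continuous ψ ∧ (∃ C : ℝ, ∀ x, |ψ x| ≤ C) ∧
    ∀ α : Fin d → ℕ, ∑ i, α i ≤ m → ∃ w, IsGenDeriv α ψ w

/-- The norm of `𝔅^m`: `‖ψ‖_m² = sup ∑_{|α| ≤ m} |D^α ψ|²`. Since generalized derivatives are
defined up to null sets, the supremum is the essential one. -/
def normB {d : ℕ} (m : ℕ) (ψ : E d → ℝ) : ℝ :=
  Real.sqrt (essSup (fun x => ∑ k ∈ Finset.range (m + 1), derivSq k ψ x) volume)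

/-- The smooth test functions: bounded together with all their derivatives. -/
def SmoothBdd {d : ℕ} (φ : E d → ℝ) : Prop :=
  ContDiff ℝ ∞ φ ∧ ∀ k : ℕ, ∃ C : ℝ, ∀ x, ‖iteratedFDeriv ℝ k φ x‖ ≤ C

/-! ### The data -/

/-- The finite set `Λ₁ ⊆ ℝ^d`, the coefficients `q_λ`, `p_λ` (only their values for `λ ∈ Λ₁`
matter), the coefficient `c`, and the weights `τ_λ`, `λ ∈ Λ₁`. -/
structure Data (d : ℕ) where
  Λ₁ : Finset (E d)
  q : E d → E d → ℝ
  p : E d → E d → ℝ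
  c : E d → ℝ
  τ : E d → ℝ

variable {d : ℕ}

/-- `|Λ₁|`, where `|Λ₁|² = ∑_{λ ∈ Λ₁} |λ|²`. -/
def Data.size (S : Data d) : ℝ := Real.sqrt (∑ l ∈ S.Λ₁, ‖l‖ ^ 2)

/-- `‖Λ₁‖`, where `‖Λ₁‖² = ∑_{λ ∈ Λ₁} |τ_λ λ|²`. -/
def Data.wsize (S : Data d) : ℝ := Real.sqrt (∑ l ∈ S.Λ₁, ‖S.τ l • l‖ ^ 2)

/-- The differential operator
`𝓛v = ½ ∑_λ ∑_{i,j} q_λ λ_i λ_j D_i D_j v + ∑_λ ∑_i p_λ λ_i D_i v - c v`. -/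
def Data.op (S : Data d) (v : E d → ℝ) (x : E d) : ℝ :=
  (1 / 2) * ∑ l ∈ S.Λ₁, ∑ i, ∑ j,
      S.q l x * l i * l j * genDeriv (unitIndex i + unitIndex j) v x
    + ∑ l ∈ S.Λ₁, ∑ i, S.p l x * l i * genDeriv (unitIndex i) v x
    - S.c x * v x

/-- `v` is a solution, in `𝔅²`, of `𝓛v + f = 0`. -/
def Data.IsSolution (S : Data d) (f v : E d → ℝ) : Prop :=
  MemB 2 v ∧ ∀ᵐ x : E d, S.op v x + f x = 0

/-- The difference operator `δ_{h,λ}`. -/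
def fdiff (h : ℝ) (l : E d) (φ : E d → ℝ) : E d → ℝ :=
  fun x => (φ (x + h • l) - φ x) / h

/-- `χ_{h,λ} = q_λ + h p_λ`. -/
def Data.χ (S : Data d) (h : ℝ) (l x : E d) : ℝ := S.q l x + h * S.p l x

/-- The index set `Λ = Λ₁ ∪ Λ₂`, with `Λ₂ = {ℓ^1, …, ℓ^d}` disjoint from `Λ₁`; the vectors `ℓ^i`
serve only as labels, and `ℓ^i` is `Sum.inr i`. -/
abbrev Data.Λ (S : Data d) := S.Λ₁ ⊕ Fin d

/-- The shifts `T_{h,λ}` for `λ ∈ Λ`: translation by `hλ` for `λ ∈ Λ₁`, identity for `ℓ^i`. -/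
def Data.T (S : Data d) (h : ℝ) : S.Λ → (E d → ℝ) → E d → ℝ
  | Sum.inl l, φ => fun x => φ (x + h • (l : E d))
  | Sum.inr _, φ => φ

/-- `δ̄_{h,λ} φ` on smooth functions: `τ_λ δ_{h,λ} φ` for `λ ∈ Λ₁` and `τ₀ D_i φ` for `ℓ^i`. -/
def Data.dbar (S : Data d) (τ₀ h : ℝ) : S.Λ → (E d → ℝ) → E d → ℝ
  | Sum.inl l, φ => fun x => S.τ l * fdiff h (l : E d) φ x
  | Sum.inr i, φ => fun x => τ₀ * pderiv i φ x

/-- `δ̄_{h,λ} ψ` on coefficients, whose derivatives are taken in the generalized sense. -/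
def Data.dbarCoef (S : Data d) (τ₀ h : ℝ) : S.Λ → (E d → ℝ) → E d → ℝ
  | Sum.inl l, ψ => fun x => S.τ l * fdiff h (l : E d) ψ x
  | Sum.inr i, ψ => fun x => τ₀ * genDeriv (unitIndex i) ψ x

/-- `L⁰_{h,μ} φ = h⁻¹ ∑_λ (δ̄_{h,μ} q_λ) δ_{h,λ} φ + ∑_λ (δ̄_{h,μ} p_λ) δ_{h,λ} φ`, `μ ∈ Λ`. -/
def Data.L0 (S : Data d) (τ₀ h : ℝ) (μ : S.Λ) (φ : E d → ℝ) (x : E d) : ℝ :=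
  h⁻¹ * ∑ l ∈ S.Λ₁, S.dbarCoef τ₀ h μ (S.q l) x * fdiff h l φ x
    + ∑ l ∈ S.Λ₁, S.dbarCoef τ₀ h μ (S.p l) x * fdiff h l φ x

/-- `Q_{h,(μ,ν)} φ = h⁻¹ ∑_λ (δ̄_{h,μ} δ̄_{h,ν} q_λ) δ_{h,λ} φ`, `μ, ν ∈ Λ`. -/
def Data.Q2 (S : Data d) (τ₀ h : ℝ) (μ ν : S.Λ) (φ : E d → ℝ) (x : E d) : ℝ :=
  h⁻¹ * ∑ l ∈ S.Λ₁, S.dbarCoef τ₀ h μ (S.dbarCoef τ₀ h ν (S.q l)) x * fdiff h l φ x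

/-- `A_h(φ) = 2 ∑_{λ ∈ Λ} (δ̄_{h,λ} φ) L⁰_{h,λ} T_{h,λ} φ`. -/
def Data.A (S : Data d) (τ₀ h : ℝ) (φ : E d → ℝ) (x : E d) : ℝ :=
  2 * ∑ μ : S.Λ, S.dbar τ₀ h μ φ x * S.L0 τ₀ h μ (S.T h μ φ) x

/-- `𝒬_h(φ) = ∑_{λ ∈ Λ₁} χ_{h,λ} (δ_{h,λ} φ)²`. -/
def Data.cQ (S : Data d) (h : ℝ) (φ : E d → ℝ) (x : E d) : ℝ :=
  ∑ l ∈ S.Λ₁, S.χ h l x * (fdiff h l φ x) ^ 2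

/-- `∑_{λ ∈ Λ} |δ̄_{h,λ} φ|²`. -/
def Data.grad1 (S : Data d) (τ₀ h : ℝ) (φ : E d → ℝ) (x : E d) : ℝ :=
  ∑ μ : S.Λ, (S.dbar τ₀ h μ φ x) ^ 2

/-- `∑_{λ ∈ Λ²} |δ̄_{h,λ} φ|²`. -/
def Data.grad2 (S : Data d) (τ₀ h : ℝ) (φ : E d → ℝ) (x : E d) : ℝ :=
  ∑ μ : S.Λ, ∑ ν : S.Λ, (S.dbar τ₀ h μ (S.dbar τ₀ h ν φ) x) ^ 2

/-- The class `𝔎`: (bounded) linear operators on `B(ℝ^d)` that preserve nonnegativity and satisfy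
`𝒦1 ≤ 1`. Only the values of `𝒦` on bounded Borel functions matter; boundedness in the
supremum norm follows from the other properties. -/
structure IsClassK (𝒦 : (E d → ℝ) → E d → ℝ) : Prop where
  maps : ∀ f, BddBorel f → BddBorel (𝒦 f)
  add : ∀ f g, BddBorel f → BddBorel g → 𝒦 (f + g) = 𝒦 f + 𝒦 g
  smul : ∀ (a : ℝ) f, BddBorel f → 𝒦 (a • f) = a • 𝒦 f
  nonneg : ∀ f, BddBorel f → (∀ x, 0 ≤ f x) → ∀ x, 0 ≤ 𝒦 f x
  one_le : ∀ x, 𝒦 (fun _ => 1) x ≤ 1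

/-! ### The assumptions -/

/-- Regularity of the data: `q_λ, p_λ, c, f ∈ 𝔅^m`, and the coefficients satisfy
`∑_λ (|D^k q_λ|² + |D^k p_λ|²) + |D^k c|² ≤ M_k²` for `k = 0, …, m`. -/
structure Data.Regular (S : Data d) (m : ℕ) (M : Fin (m + 1) → ℝ) (f : E d → ℝ) : Prop where
  q_mem : ∀ l ∈ S.Λ₁, MemB m (S.q l)
  p_mem : ∀ l ∈ S.Λ₁, MemB m (S.p l)
  c_mem : MemB m S.c
  f_mem : MemB m f
  bound : ∀ k : Fin (m + 1), ∀ᵐ x : E d,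
    ∑ l ∈ S.Λ₁, (derivSq k (S.q l) x + derivSq k (S.p l) x) + derivSq k S.c x ≤ M k ^ 2

/-- The first structural inequality. -/
def Data.Structural1 (S : Data d) (m : ℕ) (h₀ τ₀ δ K : ℝ) : Prop :=
  ∀ h : ℝ, 0 < h → h ≤ h₀ → ∃ 𝒦 : (E d → ℝ) → E d → ℝ, IsClassK 𝒦 ∧
    ∀ φ : E d → ℝ, SmoothBdd φ → ∀ᵐ x : E d,
      m * S.A τ₀ h φ x ≤
        (1 - δ) * ∑ μ : S.Λ, S.cQ h (S.dbar τ₀ h μ φ) x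
        + K * S.cQ h φ x
        + 2 * (1 - δ) * S.c x * 𝒦 (S.grad1 τ₀ h φ) x

/-- The second structural inequality. -/
def Data.Structural2 (S : Data d) (m : ℕ) (h₀ τ₀ δ K : ℝ) : Prop :=
  ∀ h : ℝ, 0 < h → h ≤ h₀ → ∀ n : ℕ, 1 ≤ n → n ≤ m →
    ∃ 𝒦 : (E d → ℝ) → E d → ℝ, IsClassK 𝒦 ∧
    ∀ φ : E d → ℝ, SmoothBdd φ → ∀ᵐ x : E d,
      n * ∑ ν : S.Λ, S.A τ₀ h (S.dbar τ₀ h ν φ) x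
        + n * ((n : ℝ) - 1) * ∑ μ : S.Λ, ∑ ν : S.Λ,
            S.dbar τ₀ h μ (S.dbar τ₀ h ν φ) x * S.Q2 τ₀ h μ ν (S.T h μ (S.T h ν φ)) x
      ≤ (1 - δ) * ∑ μ : S.Λ, ∑ ν : S.Λ, S.cQ h (S.dbar τ₀ h μ (S.dbar τ₀ h ν φ)) x
        + K * ∑ μ : S.Λ, S.cQ h (S.dbar τ₀ h μ φ) x
        + 2 * (1 - δ) * S.c x * 𝒦 (S.grad2 τ₀ h φ) x
        + K * 𝒦 (S.grad1 τ₀ h φ) x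

/-- All the assumptions on the data together. -/
structure Data.Admissible (S : Data d) (m : ℕ) (h₀ τ₀ δ K c₀ : ℝ) (M : Fin (m + 1) → ℝ)
    (f : E d → ℝ) : Prop where
  zero_notMem : (0 : E d) ∉ S.Λ₁
  q_nonneg : ∀ l ∈ S.Λ₁, ∀ x, 0 ≤ S.q l x
  τ_nonneg : ∀ l ∈ S.Λ₁, 0 ≤ S.τ l
  regular : S.Regular m M f
  χ_nonneg : ∀ h : ℝ, 0 < h → h ≤ h₀ → ∀ l ∈ S.Λ₁, ∀ x, 0 ≤ S.χ h l x
  balanced : ∀ x, ∑ l ∈ S.Λ₁, S.q l x • l = 0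
  c_lower : ∀ x, c₀ ≤ S.c x
  structural1 : S.Structural1 m h₀ τ₀ δ K
  structural2 : S.Structural2 m h₀ τ₀ δ K

end DegenScheme

end

noncomputable section

namespace DegenScheme

variable {d : ℕ}

/-! ### The algebra of smooth functions bounded with all derivatives -/

/-! The solution is obtained as a limit of solutions of finite-difference equations, and its
regularity comes from Bernstein's method carried out on those equations, since the structural
inequalities are stated for differences.

Suppose first that the coefficients are smooth. The operator `L_h v = Σ χ_{h,λ} h⁻¹ δ_{h,λ} v - c v`
has nonnegative weights on the shifted points, hence a maximum principle. Let `V_k` be the sum of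
squares of all `δ̄`-derivatives of `v` of order `k`. The identity `L_h(φ²) = 2 φ L_h φ + 𝒬_h(φ) + c
φ²` (`op_sq`) gives `L_h V_k` with the good terms `Σ 𝒬_h` and `c V_k`. Commuting `k` operators `δ̄`
with `L_h` produces three kinds of terms. Those with exactly one operator on `χ`, or exactly two on
`q`, become after summation over all words the forms `A_h` and `Q_{h,λ}` of the structural
inequalities, with the right combinatorial factors (`wsum_leib_one`, `wsum_leib_two`). All the
others contain only lower orders (`rem_bound`); for `q` this uses `Σ λ q_λ = 0`, which turns the
singular quotient `h⁻¹ δ_{h,λ}` into a bounded second-order difference (`sum_leib_quot`). The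
structural inequalities absorb the critical terms into a `1 - δ` fraction of the good ones, up to `K
𝒬_h` one order lower; this is cancelled by adding a geometric combination of `V_0, …, V_{k-1}`
(`op_lowSum_ge`). At a near-maximum of the resulting function `V_k` is bounded by lower orders
(`V_succ_le`), and induction gives `exists_estimate`. Every estimate is for suprema of full sums of
squares, so neither `h` nor the dimension enters the constant.

The true coefficients are mollified. Applying a structural inequality to translates of the test
function decouples the point at which the coefficients are taken from the point at which the
function is taken; the inequality is then linear in the coefficients and can be averaged
(`MollRel.le_zero`). The resulting difference equations are solved among smooth bounded functions by
a Neumann series (`SmoothScheme.exists_solution`).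

Finally mesh and mollification scale tend to zero together. For `m = 2` the uniform bounds on the
discrete solutions do not suffice for consistency with `𝓛`, so they are smoothed at a second,
independent scale (`exists_approx_bound`); the maximum principle for `𝓛` on smooth functions, itself
a limit of the discrete one (`le_of_clOp_ge`), then makes them uniformly Cauchy. Weak compactness
gives the generalized derivatives of the limit, and Lebesgue differentiation gives their bounds and
the equation almost everywhere. Uniqueness is the same maximum principle applied to mollified
solutions. -/

lemma SmoothBdd.const (c : ℝ) : SmoothBdd (fun _ : E d => c) := by
  refine ⟨contDiff_const, fun k => ?_⟩
  cases k with
  | zero => exact ⟨|c|, fun x => by simp⟩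
  | succ k => exact ⟨0, fun x => by simp [iteratedFDeriv_const_of_ne (Nat.succ_ne_zero k)]⟩

lemma SmoothBdd.add {φ ψ : E d → ℝ} (hφ : SmoothBdd φ) (hψ : SmoothBdd ψ) :
    SmoothBdd (φ + ψ) := by
  refine ⟨hφ.1.add hψ.1, fun k => ?_⟩
  obtain ⟨C, hC⟩ := hφ.2 k
  obtain ⟨C', hC'⟩ := hψ.2 k
  refine ⟨C + C', fun x => ?_⟩
  rw [iteratedFDeriv_add (hφ.1.of_le (mod_cast le_top)) (hψ.1.of_le (mod_cast le_top))]
  exact (norm_add_le _ _).trans (add_le_add (hC x) (hC' x))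

lemma SmoothBdd.mul {φ ψ : E d → ℝ} (hφ : SmoothBdd φ) (hψ : SmoothBdd ψ) :
    SmoothBdd (φ * ψ) := by
  refine ⟨hφ.1.mul hψ.1, fun k => ?_⟩
  choose C hC using hφ.2
  choose C' hC' using hψ.2
  refine ⟨∑ i ∈ Finset.range (k + 1), (k.choose i : ℝ) * C i * C' (k - i), fun x => ?_⟩
  refine (norm_iteratedFDeriv_mul_le (N := ∞) hφ.1 hψ.1 x (mod_cast le_top)).trans ?_
  refine Finset.sum_le_sum fun i _ => ?_
  have h0 : 0 ≤ C i := (norm_nonneg _).trans (hC i x)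
  gcongr
  · exact hC i x
  · exact hC' _ x

lemma SmoothBdd.comp_add {φ : E d → ℝ} (hφ : SmoothBdd φ) (y : E d) :
    SmoothBdd (fun x => φ (x + y)) := by
  refine ⟨hφ.1.comp (contDiff_id.add contDiff_const), fun k => ?_⟩
  obtain ⟨C, hC⟩ := hφ.2 k
  exact ⟨C, fun x => by rw [iteratedFDeriv_comp_add_right]; exact hC _⟩

lemma SmoothBdd.pderiv {φ : E d → ℝ} (hφ : SmoothBdd φ) (i : Fin d) :
    SmoothBdd (pderiv i φ) := by
  have h1 : ContDiff ℝ ∞ (fderiv ℝ φ) := hφ.1.fderiv_right (by simp)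
  refine ⟨h1.clm_apply contDiff_const, fun k => ?_⟩
  obtain ⟨C, hC⟩ := hφ.2 (k + 1)
  refine ⟨C, fun x => ?_⟩
  have := norm_iteratedFDeriv_clm_apply_const (𝕜 := ℝ) (f := fderiv ℝ φ)
    (c := (EuclideanSpace.single i 1 : E d)) (x := x) (N := ∞) (n := k) h1.contDiffAt
    (mod_cast le_top)
  refine this.trans ?_
  rw [norm_iteratedFDeriv_fderiv]
  simpa using hC x

/-- The algebra of smooth functions that are bounded together with all their derivatives. -/
def SB (d : ℕ) : Subalgebra ℝ (E d → ℝ) where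
  carrier := {φ | SmoothBdd φ}
  mul_mem' := fun ha hb => ha.mul hb
  add_mem' := fun ha hb => ha.add hb
  algebraMap_mem' := fun r => SmoothBdd.const r

instance : CoeFun (SB d) (fun _ => E d → ℝ) := ⟨Subtype.val⟩

namespace SB

lemma contDiff (φ : SB d) : ContDiff ℝ ∞ φ := φ.2.1
lemma continuous (φ : SB d) : Continuous φ := (SB.contDiff φ).continuous
lemma differentiable (φ : SB d) : Differentiable ℝ φ := (SB.contDiff φ).differentiable (by simp)

lemma exists_bound (φ : SB d) : ∃ C : ℝ, ∀ x, |φ x| ≤ C := by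
  obtain ⟨C, hC⟩ := φ.2.2 0
  exact ⟨C, fun x => by simpa using hC x⟩

@[simp] lemma add_apply (φ ψ : SB d) (x : E d) : (φ + ψ) x = φ x + ψ x := rfl
@[simp] lemma sub_apply (φ ψ : SB d) (x : E d) : (φ - ψ) x = φ x - ψ x := rfl
@[simp] lemma neg_apply (φ : SB d) (x : E d) : (-φ) x = -φ x := rfl
@[simp] lemma mul_apply (φ ψ : SB d) (x : E d) : (φ * ψ) x = φ x * ψ x := rfl
@[simp] lemma pow_apply (φ : SB d) (n : ℕ) (x : E d) : (φ ^ n) x = φ x ^ n := rfl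
@[simp] lemma smul_apply (c : ℝ) (φ : SB d) (x : E d) : (c • φ) x = c * φ x := rfl
@[simp] lemma zero_apply (x : E d) : (0 : SB d) x = 0 := rfl
@[simp] lemma one_apply (x : E d) : (1 : SB d) x = 1 := rfl

/-- Evaluation at a point. -/
def ev (x : E d) : SB d →ₐ[ℝ] ℝ := (Pi.evalAlgHom ℝ (fun _ : E d => ℝ) x).comp (SB d).val

lemma ev_apply (x : E d) (φ : SB d) : ev x φ = φ x := rfl

@[simp] lemma sum_apply {ι : Type*} (s : Finset ι) (F : ι → SB d) (x : E d) :
    (∑ i ∈ s, F i) x = ∑ i ∈ s, F i x := by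
  simpa only [ev_apply] using map_sum (ev x) F s

@[ext] lemma ext {φ ψ : SB d} (h : ∀ x, φ x = ψ x) : φ = ψ := Subtype.ext (funext h)

/-- Translation. -/
def tr (y : E d) : SB d →ₐ[ℝ] SB d where
  toFun φ := ⟨fun x => φ (x + y), φ.2.comp_add y⟩
  map_one' := rfl
  map_mul' _ _ := rfl
  map_zero' := rfl
  map_add' _ _ := rfl
  commutes' _ := rfl

@[simp] lemma tr_apply (y : E d) (φ : SB d) (x : E d) : tr y φ x = φ (x + y) := rfl

/-- Partial derivative. -/
def D (i : Fin d) : SB d →ₗ[ℝ] SB d where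
  toFun φ := ⟨pderiv i φ, φ.2.pderiv i⟩
  map_add' φ ψ := by
    ext x
    change fderiv ℝ (φ.1 + ψ.1) x _ = _
    rw [fderiv_add ((SB.differentiable φ) x) ((SB.differentiable ψ) x)]; rfl
  map_smul' c φ := by
    ext x
    change fderiv ℝ (c • φ.1) x _ = _
    rw [fderiv_const_smul ((SB.differentiable φ) x)]; rfl

lemma D_coe (i : Fin d) (φ : SB d) : (D i φ : E d → ℝ) = pderiv i φ := rfl

lemma D_mul (i : Fin d) (φ ψ : SB d) : D i (φ * ψ) = φ * D i ψ + D i φ * ψ := by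
  ext x
  change fderiv ℝ (φ.1 * ψ.1) x _ = _
  rw [fderiv_mul ((SB.differentiable φ) x) ((SB.differentiable ψ) x)]
  simp [D_coe, pderiv, mul_comm]

lemma D_tr (i : Fin d) (y : E d) (φ : SB d) : D i (tr y φ) = tr y (D i φ) := by
  ext x
  change fderiv ℝ (fun x => φ (x + y)) x _ = fderiv ℝ φ (x + y) _
  rw [fderiv_comp_add_right]

lemma D_comm (i j : Fin d) (φ : SB d) : D i (D j φ) = D j (D i φ) := by
  ext x
  have h2 : Differentiable ℝ (fderiv ℝ φ) :=
    ((SB.contDiff φ).fderiv_right (m := ∞) (by simp)).differentiable (by simp)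
  have key : ∀ i j : Fin d, D i (D j φ) x =
      fderiv ℝ (fderiv ℝ φ) x (EuclideanSpace.single i 1) (EuclideanSpace.single j 1) := by
    intro i j
    change fderiv ℝ (fun z => fderiv ℝ φ z (EuclideanSpace.single j 1)) x _ = _
    rw [fderiv_clm_apply (h2 x) (differentiableAt_const _)]
    simp
  rw [key, key]
  exact ((SB.contDiff φ).contDiffAt.isSymmSndFDerivAt
    (by simpa using (WithTop.coe_le_coe.2 le_top : ((2 : ℕ∞) : WithTop ℕ∞) ≤ ∞))) _ _

lemma tr_comm (y z : E d) (φ : SB d) : tr y (tr z φ) = tr z (tr y φ) := by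
  ext x; simp [add_right_comm]

/-- Directional derivative `l · D`. -/
def dd (l : E d) : SB d →ₗ[ℝ] SB d := ∑ i, l i • D i

lemma dd_apply (l : E d) (φ : SB d) (x : E d) : dd l φ x = ∑ i, l i * D i φ x := by
  simp [dd, LinearMap.sum_apply]

lemma dd_eq_fderiv (l : E d) (φ : SB d) (x : E d) : dd l φ x = fderiv ℝ φ x l := by
  rw [dd_apply]
  conv_rhs => rw [← (EuclideanSpace.basisFun (Fin d) ℝ).sum_repr l, map_sum]
  refine Finset.sum_congr rfl fun i _ => ?_
  simp [D_coe, pderiv]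

lemma hasDerivAt_line (φ : SB d) (x l : E d) (t : ℝ) :
    HasDerivAt (fun t : ℝ => φ (x + t • l)) (dd l φ (x + t • l)) t := by
  rw [dd_eq_fderiv]
  have h1 : HasDerivAt (fun t : ℝ => x + t • l) l t := by
    simpa using ((hasDerivAt_id t).smul_const l).const_add x
  exact ((SB.differentiable φ) _).hasFDerivAt.comp_hasDerivAt t h1

/-- The difference quotient `δ_{h,l}`. -/
def fd (h : ℝ) (l : E d) : SB d →ₗ[ℝ] SB d := h⁻¹ • ((tr (h • l)).toLinearMap - LinearMap.id)

lemma fd_apply (h : ℝ) (l : E d) (φ : SB d) (x : E d) :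
    fd h l φ x = h⁻¹ * (φ (x + h • l) - φ x) := rfl

lemma fd_coe (h : ℝ) (l : E d) (φ : SB d) : (fd h l φ : E d → ℝ) = fdiff h l φ := by
  ext x; rw [fd_apply, fdiff, div_eq_inv_mul]

lemma fd_eq (h : ℝ) (l : E d) (φ : SB d) : fd h l φ = h⁻¹ • (tr (h • l) φ - φ) := rfl

lemma fd_tr (h : ℝ) (l y : E d) (φ : SB d) : fd h l (tr y φ) = tr y (fd h l φ) := by
  simp only [fd_eq, map_smul, map_sub, tr_comm]

lemma fd_comm (h : ℝ) (l k : E d) (φ : SB d) : fd h l (fd h k φ) = fd h k (fd h l φ) := by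
  rw [fd_eq h k φ, map_smul, map_sub, fd_tr, ← fd_eq]

lemma fd_D (h : ℝ) (l : E d) (i : Fin d) (φ : SB d) : fd h l (D i φ) = D i (fd h l φ) := by
  rw [fd_eq, fd_eq, map_smul, map_sub, D_tr]

lemma fd_mul {h : ℝ} (l : E d) (φ ψ : SB d) :
    fd h l (φ * ψ) = φ * fd h l ψ + fd h l φ * tr (h • l) ψ := by
  ext x
  simp only [fd_apply, mul_apply, add_apply, tr_apply]
  ring

lemma dd_D (l : E d) (i : Fin d) (φ : SB d) : dd l (D i φ) = D i (dd l φ) := by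
  simp [dd, LinearMap.sum_apply, map_sum, D_comm]

lemma dd_tr (l y : E d) (φ : SB d) : dd l (tr y φ) = tr y (dd l φ) := by
  simp [dd, LinearMap.sum_apply, map_sum, D_tr]

lemma dd_fd (h : ℝ) (l k : E d) (φ : SB d) : dd l (fd h k φ) = fd h k (dd l φ) := by
  rw [fd_eq, fd_eq, map_smul, map_sub, dd_tr]

end SB

/-! ### Sums over words -/

section Words

variable {ι : Type} [Fintype ι] {N : Type*} [AddCommMonoid N]

/-- The sum of `F` over the words of length `n`. -/
def wsum (n : ℕ) (F : List ι → N) : N := ∑ μ : Fin n → ι, F (List.ofFn μ)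

lemma wsum_zero (F : List ι → N) : wsum 0 F = F [] := by simp [wsum]

lemma wsum_succ (n : ℕ) (F : List ι → N) :
    wsum (n + 1) F = ∑ a, wsum n (fun μ => F (a :: μ)) := by
  unfold wsum
  rw [← (Fin.consEquiv (fun _ : Fin (n + 1) => ι)).sum_comp, Fintype.sum_prod_type]
  simp [Fin.consEquiv, List.ofFn_succ]

lemma wsum_congr {n : ℕ} {F G : List ι → N} (h : ∀ μ, μ.length = n → F μ = G μ) :
    wsum n F = wsum n G :=
  Finset.sum_congr rfl fun μ _ => h _ (by simp)

lemma wsum_add (n : ℕ) (F G : List ι → N) :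
    wsum n (fun μ => F μ + G μ) = wsum n F + wsum n G := Finset.sum_add_distrib

lemma sum_wsum {β : Type*} (s : Finset β) (n : ℕ) (F : β → List ι → N) :
    ∑ b ∈ s, wsum n (F b) = wsum n (fun μ => ∑ b ∈ s, F b μ) := Finset.sum_comm

lemma mul_wsum (n : ℕ) (c : ℝ) (F : List ι → ℝ) :
    c * wsum n F = wsum n (fun μ => c * F μ) := Finset.mul_sum _ _ _

lemma wsum_mono {n : ℕ} {F G : List ι → ℝ} (h : ∀ μ, μ.length = n → F μ ≤ G μ) :
    wsum n F ≤ wsum n G :=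
  Finset.sum_le_sum fun μ _ => h _ (by simp)

lemma wsum_nonneg {n : ℕ} {F : List ι → ℝ} (h : ∀ μ, 0 ≤ F μ) : 0 ≤ wsum n F :=
  Finset.sum_nonneg fun _ _ => h _

end Words

/-! ### Families of difference and differential operators -/

section Leibniz

variable {ι : Type}

/-- The composition of the operators `B a` along a word. -/
def iter (B : ι → SB d →ₗ[ℝ] SB d) : List ι → SB d →ₗ[ℝ] SB d
  | [] => LinearMap.id
  | a :: μ => (iter B μ).comp (B a)

@[simp] lemma iter_nil (B : ι → SB d →ₗ[ℝ] SB d) (φ : SB d) : iter B [] φ = φ := rfl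
@[simp] lemma iter_cons (B : ι → SB d →ₗ[ℝ] SB d) (a : ι) (μ : List ι) (φ : SB d) :
    iter B (a :: μ) φ = iter B μ (B a φ) := rfl

lemma iter_commute {B : ι → SB d →ₗ[ℝ] SB d} {A : SB d → SB d}
    (h : ∀ a φ, A (B a φ) = B a (A φ)) (μ : List ι) (φ : SB d) :
    A (iter B μ φ) = iter B μ (A φ) := by
  induction μ generalizing φ with
  | nil => rfl
  | cons a μ ih => rw [iter_cons, iter_cons, ih, h]

lemma iter_append (B : ι → SB d →ₗ[ℝ] SB d) (μ ν : List ι) (φ : SB d) :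
    iter B (μ ++ ν) φ = iter B ν (iter B μ φ) := by
  induction μ generalizing φ with
  | nil => rfl
  | cons a μ ih => simp [ih]

/-- Commuting translation-invariant operators with the Leibniz rule
`B a (g φ) = g B a φ + (B a g) T φ`, `T` being the translation by `y a`. -/
structure IsLeibniz (B : ι → SB d →ₗ[ℝ] SB d) (y : ι → E d) : Prop where
  comm : ∀ a b φ, B a (B b φ) = B b (B a φ)
  tr : ∀ a z φ, B a (SB.tr z φ) = SB.tr z (B a φ)
  mul : ∀ a g φ, B a (g * φ) = g * B a φ + B a g * SB.tr (y a) φ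

/-- The part of `iter B μ (g φ)` in which `k` of the operators are applied to `g`. -/
def leib (B : ι → SB d →ₗ[ℝ] SB d) (y : ι → E d) :
    List ι → ℕ → SB d →ₗ[ℝ] SB d →ₗ[ℝ] SB d
  | [], 0 => LinearMap.mul ℝ (SB d)
  | [], _ + 1 => 0
  | a :: μ, 0 => (leib B y μ 0).compl₂ (B a)
  | a :: μ, k + 1 => (leib B y μ (k + 1)).compl₂ (B a) +
      (leib B y μ k).compl₁₂ (B a) (SB.tr (y a)).toLinearMap

variable {B : ι → SB d →ₗ[ℝ] SB d} {y : ι → E d}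

@[simp] lemma leib_nil_zero (g φ : SB d) : leib B y [] 0 g φ = g * φ := rfl
@[simp] lemma leib_nil_succ (k : ℕ) (g φ : SB d) : leib B y [] (k + 1) g φ = 0 := rfl
lemma leib_cons_zero (a : ι) (μ : List ι) (g φ : SB d) :
    leib B y (a :: μ) 0 g φ = leib B y μ 0 g (B a φ) := rfl
lemma leib_cons_succ (a : ι) (μ : List ι) (k : ℕ) (g φ : SB d) :
    leib B y (a :: μ) (k + 1) g φ =
      leib B y μ (k + 1) g (B a φ) + leib B y μ k (B a g) (SB.tr (y a) φ) := rfl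

lemma leib_zero (μ : List ι) (g φ : SB d) : leib B y μ 0 g φ = g * iter B μ φ := by
  induction μ generalizing φ with
  | nil => rfl
  | cons a μ ih => rw [leib_cons_zero, ih, iter_cons]

lemma leib_eq_zero (μ : List ι) (k : ℕ) (hk : μ.length < k) (g φ : SB d) :
    leib B y μ k g φ = 0 := by
  induction μ generalizing k g φ with
  | nil =>
    obtain ⟨k, rfl⟩ := Nat.exists_eq_succ_of_ne_zero (Nat.ne_zero_of_lt hk)
    rfl
  | cons a μ ih =>
    obtain ⟨k, rfl⟩ := Nat.exists_eq_succ_of_ne_zero (Nat.ne_zero_of_lt hk)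
    simp only [List.length_cons] at hk
    rw [Nat.succ_eq_add_one, leib_cons_succ, ih _ (by omega), ih _ (by omega), add_zero]

/-- The Leibniz expansion is grouped by the number of operators falling on the coefficient, since
that number decides how a term is estimated. The recursive form of `leib` lets later counting be
done by induction on the word. -/
lemma iter_mul (hB : IsLeibniz B y) (μ : List ι) (g φ : SB d) :
    iter B μ (g * φ) = ∑ k ∈ Finset.range (μ.length + 1), leib B y μ k g φ := by
  induction μ generalizing g φ with
  | nil => simp
  | cons a μ ih =>
    rw [iter_cons, hB.mul, map_add, ih, ih, List.length_cons, Finset.sum_range_succ' _ (_ + 1)]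
    simp only [leib_cons_succ, leib_cons_zero, Finset.sum_add_distrib]
    rw [Finset.sum_range_succ (fun k => leib B y μ (k + 1) g (B a φ)),
      leib_eq_zero μ (μ.length + 1) (by omega), add_zero,
      Finset.sum_range_succ' (fun k => leib B y μ k g (B a φ))]
    abel

lemma iter_tr (hB : IsLeibniz B y) (μ : List ι) (z : E d) (φ : SB d) :
    iter B μ (SB.tr z φ) = SB.tr z (iter B μ φ) :=
  (iter_commute (A := SB.tr z) (fun b φ => (hB.tr b _ φ).symm) μ φ).symm

variable [Fintype ι]

/-- The operators commute with each other and with translations, so in the sum over all words the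
position of the single operator falling on `g` is irrelevant; there are `n + 1` positions. This
produces the factor `n` of the structural inequalities. -/
lemma wsum_leib_one (hB : IsLeibniz B y) (n : ℕ) (g φ w : SB d) :
    wsum (n + 1) (fun μ => leib B y μ 1 g φ * iter B μ w) =
      (n + 1 : ℝ) • wsum n (fun ν => ∑ a, B a g * SB.tr (y a) (iter B ν φ) *
        B a (iter B ν w)) := by
  induction n generalizing φ w with
  | zero => simp [wsum_succ, wsum_zero, leib_cons_succ]
  | succ n ih =>
    rw [wsum_succ]
    simp only [leib_cons_succ, iter_cons, add_mul, wsum_add, Finset.sum_add_distrib, ih]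
    simp only [leib_zero]
    have h1 := wsum_succ n (fun ν => ∑ a, B a g *
      SB.tr (y a) (iter B ν φ) * B a (iter B ν w))
    simp only [iter_cons] at h1
    have h2 : ∑ c, wsum (n + 1) (fun μ => B c g * iter B μ (SB.tr (y c) φ) *
        iter B μ (B c w)) = wsum (n + 1) (fun ν => ∑ a, B a g *
        SB.tr (y a) (iter B ν φ) * B a (iter B ν w)) := by
      rw [sum_wsum]
      refine wsum_congr fun μ _ => Finset.sum_congr rfl fun a _ => ?_
      rw [iter_tr hB, iter_commute (A := B a) (hB.comm a)]
    rw [← Finset.smul_sum, ← h1, h2]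
    push_cast
    module

/-- Same symmetry, with an unordered pair of positions for the two operators on `g`: there are `(n +
2)(n + 1) / 2` of them, and the factor 2 on the left clears the denominator. -/
lemma wsum_leib_two (hB : IsLeibniz B y) (n : ℕ) (g φ w : SB d) :
    (2 : ℝ) • wsum (n + 2) (fun μ => leib B y μ 2 g φ * iter B μ w) =
      ((n + 2 : ℝ) * (n + 1)) • wsum n (fun ν => ∑ a, ∑ b, B a (B b g) *
        SB.tr (y a) (SB.tr (y b) (iter B ν φ)) * B a (B b (iter B ν w))) := by
  induction n generalizing φ w with
  | zero =>
    simp only [wsum_succ, wsum_zero, leib_cons_succ, iter_cons, leib_nil_succ, leib_nil_zero,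
      iter_nil, zero_add, Nat.cast_zero, mul_one]
    congr 1
    refine Finset.sum_comm.trans (Finset.sum_congr rfl fun a _ =>
      Finset.sum_congr rfl fun b _ => ?_)
    ring
  | succ n ih =>
    rw [wsum_succ]
    simp only [leib_cons_succ (k := 1), iter_cons, add_mul, wsum_add, Finset.sum_add_distrib,
      smul_add, Finset.smul_sum, ih]
    simp only [← Finset.smul_sum, wsum_leib_one hB]
    have h1 := wsum_succ n (fun ν => ∑ a, ∑ b, B a (B b g) *
        SB.tr (y a) (SB.tr (y b) (iter B ν φ)) * B a (B b (iter B ν w)))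
    simp only [iter_cons] at h1
    rw [← h1]
    have h2 : ∑ c, wsum (n + 1) (fun ν => ∑ a, B a (B c g) * SB.tr (y a) (iter B ν
        (SB.tr (y c) φ)) * B a (iter B ν (B c w))) = wsum (n + 1) (fun ν => ∑ a, ∑ b, B a (B b g) *
        SB.tr (y a) (SB.tr (y b) (iter B ν φ)) * B a (B b (iter B ν w))) := by
      rw [sum_wsum]
      refine wsum_congr fun μ _ => ?_
      rw [Finset.sum_comm]
      refine Finset.sum_congr rfl fun a _ => Finset.sum_congr rfl fun b _ => ?_
      rw [iter_commute (A := SB.tr (y b)) (fun c φ => (hB.tr c _ φ).symm),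
        iter_commute (A := B b) (hB.comm b)]
    rw [h2, smul_smul, ← add_smul]
    congr 1
    push_cast; ring

/-- At each operator the Leibniz rule splits a term in two, and `(a + b)² ≤ 2a² + 2b²` costs at most
a factor 4 per operator; at the end Cauchy–Schwarz in `l` separates the factors. The extra indices
make the induction close: an operator falling on `g` is stored in `β`, one falling on `φ` in `β'`.
Translations depend on the operators in `β`, hence `φ` depends on `b` and its bound is uniform in
`b` and in the point. No cardinality enters. -/
lemma wsum_leib_sq_le (hB : IsLeibniz B y) : ∀ (n k j : ℕ), k + j = n →
    ∀ {β β' L : Type} [Fintype β] [Fintype β'] [Fintype L] (g : β → L → SB d)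
      (φ : β → β' → L → SB d) (G Φ : ℝ), 0 ≤ Φ →
      (∀ x, ∑ b, ∑ l, wsum k (fun μ => iter B μ (g b l) x ^ 2) ≤ G) →
      (∀ b x, ∑ b', ∑ l, wsum j (fun μ => iter B μ (φ b b' l) x ^ 2) ≤ Φ) →
      ∀ x, ∑ b, ∑ b', wsum n (fun μ => (∑ l, leib B y μ k (g b l) (φ b b' l) x) ^ 2) ≤
        4 ^ n * (G * Φ) := by
  intro n
  induction n with
  | zero =>
    intro k j hkj β β' L _ _ _ g φ G Φ hΦ hG hφ x
    obtain ⟨rfl, rfl⟩ : k = 0 ∧ j = 0 := by omega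
    simp only [wsum_zero, iter_nil, leib_nil_zero, SB.mul_apply, pow_zero, one_mul] at *
    calc ∑ b, ∑ b', (∑ l, g b l x * φ b b' l x) ^ 2
        ≤ ∑ b, ∑ b', (∑ l, g b l x ^ 2) * (∑ l, φ b b' l x ^ 2) := by
          gcongr; exact Finset.sum_mul_sq_le_sq_mul_sq _ _ _
      _ ≤ ∑ b, (∑ l, g b l x ^ 2) * Φ := by
          refine Finset.sum_le_sum fun b _ => ?_
          rw [← Finset.mul_sum]
          exact mul_le_mul_of_nonneg_left (hφ b x) (by positivity)
      _ ≤ G * Φ := by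
          rw [← Finset.sum_mul]
          exact mul_le_mul_of_nonneg_right (hG x) hΦ
  | succ n ih =>
    have first : ∀ (k j : ℕ), k + j = n →
        ∀ {β β' L : Type} [Fintype β] [Fintype β'] [Fintype L] (g : β → L → SB d)
        (φ : β → β' → L → SB d) (G Φ : ℝ), 0 ≤ Φ →
        (∀ x, ∑ b, ∑ l, wsum k (fun μ => iter B μ (g b l) x ^ 2) ≤ G) →
        (∀ b x, ∑ b', ∑ l, wsum (j + 1) (fun μ => iter B μ (φ b b' l) x ^ 2) ≤ Φ) →
        ∀ x, ∑ b, ∑ b', ∑ a, wsum n (fun μ =>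
          (∑ l, leib B y μ k (g b l) (B a (φ b b' l)) x) ^ 2) ≤ 4 ^ n * (G * Φ) := by
      intro k j hkj β β' L _ _ _ g φ G Φ hΦ hG hφ x
      have h2 : ∀ b x, ∑ b' : β' × ι, ∑ l, wsum j (fun μ =>
          iter B μ (B b'.2 (φ b b'.1 l)) x ^ 2) ≤ Φ := by
        intro b x
        refine le_trans (le_of_eq ?_) (hφ b x)
        rw [Fintype.sum_prod_type]
        refine Finset.sum_congr rfl fun b' _ => ?_
        rw [Finset.sum_comm]
        exact Finset.sum_congr rfl fun l _ =>
          (wsum_succ j (fun μ => iter B μ (φ b b' l) x ^ 2)).symm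
      have := ih k j hkj g (fun b (b' : β' × ι) l => B b'.2 (φ b b'.1 l)) G Φ hΦ hG h2 x
      simpa only [Fintype.sum_prod_type] using this
    have second : ∀ (k j : ℕ), k + j = n →
        ∀ {β β' L : Type} [Fintype β] [Fintype β'] [Fintype L] (g : β → L → SB d)
        (φ : β → β' → L → SB d) (G Φ : ℝ), 0 ≤ Φ →
        (∀ x, ∑ b, ∑ l, wsum (k + 1) (fun μ => iter B μ (g b l) x ^ 2) ≤ G) →
        (∀ b x, ∑ b', ∑ l, wsum j (fun μ => iter B μ (φ b b' l) x ^ 2) ≤ Φ) →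
        ∀ x, ∑ b, ∑ b', ∑ a, wsum n (fun μ =>
          (∑ l, leib B y μ k (B a (g b l)) (SB.tr (y a) (φ b b' l)) x) ^ 2) ≤
            4 ^ n * (G * Φ) := by
      intro k j hkj β β' L _ _ _ g φ G Φ hΦ hG hφ x
      have h1 : ∀ x, ∑ b : β × ι, ∑ l, wsum k (fun μ => iter B μ (B b.2 (g b.1 l)) x ^ 2) ≤ G :=
        fun x => by
          refine le_trans (le_of_eq ?_) (hG x)
          rw [Fintype.sum_prod_type]
          refine Finset.sum_congr rfl fun b' _ => ?_
          rw [Finset.sum_comm]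
          exact Finset.sum_congr rfl fun l _ =>
          (wsum_succ k (fun μ => iter B μ (g b' l) x ^ 2)).symm
      have h2 : ∀ (b : β × ι) x, ∑ b', ∑ l, wsum j (fun μ =>
          iter B μ (SB.tr (y b.2) (φ b.1 b' l)) x ^ 2) ≤ Φ := by
        rintro ⟨b, a⟩ x
        simp only [iter_tr hB, SB.tr_apply]
        exact hφ b (x + y a)
      have := ih k j hkj (fun (b : β × ι) l => B b.2 (g b.1 l))
        (fun (b : β × ι) b' l => SB.tr (y b.2) (φ b.1 b' l)) G Φ hΦ h1 h2 x
      simp only [Fintype.sum_prod_type] at this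
      refine le_trans (le_of_eq ?_) this
      exact Finset.sum_congr rfl fun b _ => Finset.sum_comm
    intro k j hkj β β' L _ _ _ g φ G Φ hΦ hG hφ x
    have hG0 : 0 ≤ G * Φ := mul_nonneg ((Finset.sum_nonneg fun b _ => Finset.sum_nonneg fun l _ =>
      wsum_nonneg fun μ => sq_nonneg _).trans (hG x)) hΦ
    simp only [wsum_succ]
    rcases k with _ | k
    · obtain ⟨rfl⟩ : j = n + 1 := by omega
      refine (first 0 n (by omega) g φ G Φ hΦ hG hφ x).trans ?_
      rw [pow_succ]
      nlinarith [pow_pos (show (0 : ℝ) < 4 by norm_num) n, mul_nonneg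
        (pow_pos (show (0 : ℝ) < 4 by norm_num) n).le hG0]
    · have h2 := second k j (by omega) g φ G Φ hΦ hG hφ x
      have h1 : ∑ b, ∑ b', ∑ a, wsum n (fun μ =>
          (∑ l, leib B y μ (k + 1) (g b l) (B a (φ b b' l)) x) ^ 2) ≤ 4 ^ n * (G * Φ) := by
        -- If `j = 0`, the remaining words have length `k`, too short for `k + 1` operators to fall
        -- on `g`.
        rcases j with _ | j
        · refine le_trans (le_of_eq ?_) (mul_nonneg (by positivity) hG0)
          refine Finset.sum_eq_zero fun b _ => Finset.sum_eq_zero fun b' _ =>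
            Finset.sum_eq_zero fun a _ => ?_
          rw [wsum_congr (G := fun _ => 0)]
          · simp [wsum]
          · intro μ hμ
            simp [leib_eq_zero μ (k + 1) (by omega)]
        · exact first (k + 1) j (by omega) g φ G Φ hΦ hG hφ x
      calc ∑ b, ∑ b', ∑ a, wsum n (fun μ =>
            (∑ l, leib B y (a :: μ) (k + 1) (g b l) (φ b b' l) x) ^ 2)
          ≤ ∑ b, ∑ b', ∑ a, wsum n (fun μ =>
            2 * (∑ l, leib B y μ (k + 1) (g b l) (B a (φ b b' l)) x) ^ 2 +
            2 * (∑ l, leib B y μ k (B a (g b l)) (SB.tr (y a) (φ b b' l)) x) ^ 2) := by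
            refine Finset.sum_le_sum fun b _ => Finset.sum_le_sum fun b' _ =>
              Finset.sum_le_sum fun a _ => wsum_mono fun μ _ => ?_
            simp only [leib_cons_succ, SB.add_apply, Finset.sum_add_distrib]
            nlinarith [sq_nonneg ((∑ l, leib B y μ (k + 1) (g b l) (B a (φ b b' l)) x) -
              ∑ l, leib B y μ k (B a (g b l)) (SB.tr (y a) (φ b b' l)) x)]
        _ = 2 * (∑ b, ∑ b', ∑ a, wsum n (fun μ =>
            (∑ l, leib B y μ (k + 1) (g b l) (B a (φ b b' l)) x) ^ 2)) +
            2 * (∑ b, ∑ b', ∑ a, wsum n (fun μ =>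
            (∑ l, leib B y μ k (B a (g b l)) (SB.tr (y a) (φ b b' l)) x) ^ 2)) := by
            simp only [wsum_add, Finset.sum_add_distrib, ← mul_wsum, ← Finset.mul_sum]
        _ ≤ 4 ^ (n + 1) * (G * Φ) := by rw [pow_succ]; linarith

end Leibniz

/-! ### Mean value estimates for difference operators -/

namespace SB

/-- The second-order difference quotient `h⁻¹ (δ_{h,l} - ∂_l)`. -/
def sd (h : ℝ) (l : E d) : SB d →ₗ[ℝ] SB d := h⁻¹ • (fd h l - dd l)

lemma sd_eq (h : ℝ) (l : E d) (φ : SB d) : sd h l φ = h⁻¹ • (fd h l φ - dd l φ) := rfl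

lemma sd_fd (h : ℝ) (l k : E d) (φ : SB d) : sd h l (fd h k φ) = fd h k (sd h l φ) := by
  rw [sd_eq, sd_eq, fd_comm, dd_fd, map_smul, map_sub]

lemma sd_D (h : ℝ) (l : E d) (i : Fin d) (φ : SB d) : sd h l (D i φ) = D i (sd h l φ) := by
  rw [sd_eq, sd_eq, fd_D, dd_D, map_smul, map_sub]

lemma exists_fd_eq {h : ℝ} (hh : 0 < h) (l : E d) (φ : SB d) (x : E d) :
    ∃ t ∈ Set.Ioo 0 h, fd h l φ x = dd l φ (x + t • l) := by
  obtain ⟨t, ht, h1⟩ := exists_hasDerivAt_eq_slope (fun t : ℝ => φ (x + t • l))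
    (fun t => dd l φ (x + t • l)) hh
    (fun t _ => (hasDerivAt_line φ x l t).continuousAt.continuousWithinAt)
    (fun t _ => hasDerivAt_line φ x l t)
  refine ⟨t, ht, ?_⟩
  rw [h1, fd_apply]
  simp [div_eq_inv_mul]

lemma fd_le {h : ℝ} (hh : 0 < h) (l : E d) (φ : SB d) (C : ℝ) (_ : 0 ≤ C)
    (hC : ∀ z, dd l φ z ≤ C) (x : E d) : fd h l φ x ≤ C := by
  obtain ⟨t, -, ht⟩ := exists_fd_eq hh l φ x
  exact ht ▸ hC _

/-- The mean value theorem applied twice gives the value `(t / h) ∂_l² φ` at an intermediate point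
with `0 < t < h`; `C ≥ 0` allows the factor `t / h` to be dropped. -/
lemma sd_le {h : ℝ} (hh : 0 < h) (l : E d) (φ : SB d) (C : ℝ) (h0 : 0 ≤ C)
    (hC : ∀ z, dd l (dd l φ) z ≤ C) (x : E d) : sd h l φ x ≤ C := by
  obtain ⟨t, ht, h1⟩ := exists_fd_eq hh l φ x
  obtain ⟨s, -, h2⟩ := exists_fd_eq ht.1 l (dd l φ) x
  have h3 : dd l φ (x + t • l) - dd l φ x = t * dd l (dd l φ) (x + s • l) := by
    rw [← h2, fd_apply, mul_inv_cancel_left₀ ht.1.ne']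
  rw [sd_eq, smul_apply, sub_apply, h1, h3, inv_mul_le_iff₀ hh]
  exact (mul_le_mul_of_nonneg_left (hC _) ht.1.le).trans (mul_le_mul_of_nonneg_right ht.2.le h0)

/-- A one-sided bound of a linear operator by another one, applied to all linear combinations,
gives a bound for sums of squares. -/
lemma sum_sq_le_of_le {β : Type*} [Fintype β] (O O' : SB d →ₗ[ℝ] SB d)
    (hO : ∀ (ψ : SB d) (C : ℝ), 0 ≤ C → (∀ z, O' ψ z ≤ C) → ∀ x, O ψ x ≤ C)
    (φ : β → SB d) (C : ℝ) (hC : ∀ z, ∑ b, O' (φ b) z ^ 2 ≤ C) (x : E d) :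
    ∑ b, O (φ b) x ^ 2 ≤ C := by
  have hC0 : 0 ≤ C := (Finset.sum_nonneg fun _ _ => sq_nonneg _).trans (hC 0)
  -- Duality: the one-sided bound is applied to the single function `Σ a_b φ_b` with `a_b` frozen as
  -- the values at `x`, and `a_b c_b ≤ (a_b² + c_b²) / 2` bounds its right-hand side. This avoids
  -- any factor depending on the size of the family.
  have key := hO (∑ b, (O (φ b) x) • φ b) ((∑ b, O (φ b) x ^ 2 + C) / 2)
    (by positivity) (fun z => by
      simp only [map_sum, map_smul, sum_apply, smul_apply]
      have : ∑ b, O (φ b) x * O' (φ b) z ≤ ∑ b, (O (φ b) x ^ 2 + O' (φ b) z ^ 2) / 2 :=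
        Finset.sum_le_sum fun b _ => by nlinarith [sq_nonneg (O (φ b) x - O' (φ b) z)]
      rw [← Finset.sum_div, Finset.sum_add_distrib] at this
      linarith [hC z]) x
  simp only [map_sum, map_smul, sum_apply, smul_apply, ← sq] at key
  linarith

lemma sum_sq_dd_le {β : Type*} [Fintype β] (l : E d) (φ : β → SB d) (z : E d) :
    ∑ b, dd l (φ b) z ^ 2 ≤ ‖l‖ ^ 2 * ∑ b, ∑ i, D i (φ b) z ^ 2 := by
  rw [Finset.mul_sum]
  refine Finset.sum_le_sum fun b _ => ?_
  rw [dd_apply, EuclideanSpace.real_norm_sq_eq]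
  exact Finset.sum_mul_sq_le_sq_mul_sq _ _ _

lemma sum_sq_fd_le {β : Type*} [Fintype β] {h : ℝ} (hh : 0 < h) (l : E d) (φ : β → SB d) (C : ℝ)
    (hC : ∀ z, ∑ b, ∑ i, D i (φ b) z ^ 2 ≤ C) (x : E d) :
    ∑ b, fd h l (φ b) x ^ 2 ≤ ‖l‖ ^ 2 * C :=
  sum_sq_le_of_le _ _ (fd_le hh l) φ _ (fun z => (sum_sq_dd_le l φ z).trans
    (mul_le_mul_of_nonneg_left (hC z) (sq_nonneg _))) x

lemma sum_sq_sd_le {β : Type*} [Fintype β] {h : ℝ} (hh : 0 < h) (l : E d) (φ : β → SB d) (C : ℝ)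
    (hC : ∀ z, ∑ b, ∑ i, ∑ j, D j (D i (φ b)) z ^ 2 ≤ C) (x : E d) :
    ∑ b, sd h l (φ b) x ^ 2 ≤ ‖l‖ ^ 4 * C := by
  refine sum_sq_le_of_le _ ((dd l).comp (dd l)) (sd_le hh l) φ _ (fun z => ?_) x
  calc ∑ b, dd l (dd l (φ b)) z ^ 2 ≤ ‖l‖ ^ 2 * ∑ b, ∑ i, D i (dd l (φ b)) z ^ 2 :=
        sum_sq_dd_le l _ z
    _ = ‖l‖ ^ 2 * ∑ p : β × Fin d, dd l (D p.2 (φ p.1)) z ^ 2 := by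
        simp only [Fintype.sum_prod_type, dd_D]
    _ ≤ ‖l‖ ^ 2 * (‖l‖ ^ 2 * ∑ p : β × Fin d, ∑ j, D j (D p.2 (φ p.1)) z ^ 2) := by
        gcongr; exact sum_sq_dd_le l _ z
    _ ≤ ‖l‖ ^ 2 * (‖l‖ ^ 2 * C) := by
        simp only [Fintype.sum_prod_type]; gcongr; exact hC z
    _ = ‖l‖ ^ 4 * C := by ring

end SB

/-! ### The operators `δ̄` and `T` -/

section Bop

variable (L : Finset (E d)) (τ : E d → ℝ) (τ₀ h : ℝ)

/-- The operators `δ̄_{h,a}`, `a ∈ Λ`. -/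
def Bop : L ⊕ Fin d → SB d →ₗ[ℝ] SB d
  | Sum.inl l => τ (l : E d) • SB.fd h (l : E d)
  | Sum.inr i => τ₀ • SB.D i

/-- The translation vectors of the operators `T_{h,a}`, `a ∈ Λ`. -/
def shiftVec : L ⊕ Fin d → E d
  | Sum.inl l => h • (l : E d)
  | Sum.inr _ => 0

lemma SB.tr_zero (φ : SB d) : SB.tr 0 φ = φ := by ext x; simp

variable {L τ τ₀ h}

lemma Bop_inl (l : L) (φ : SB d) : Bop L τ τ₀ h (Sum.inl l) φ = τ l • SB.fd h l φ := rfl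
lemma Bop_inr (i : Fin d) (φ : SB d) : Bop L τ τ₀ h (Sum.inr i) φ = τ₀ • SB.D i φ := rfl

lemma Bop_commute {A : SB d →ₗ[ℝ] SB d} (h1 : ∀ l φ, A (SB.fd h l φ) = SB.fd h l (A φ))
    (h2 : ∀ i φ, A (SB.D i φ) = SB.D i (A φ)) (a : L ⊕ Fin d) (φ : SB d) :
    A (Bop L τ τ₀ h a φ) = Bop L τ τ₀ h a (A φ) := by
  rcases a with l | i
  · rw [Bop_inl, Bop_inl, map_smul, h1]
  · rw [Bop_inr, Bop_inr, map_smul, h2]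

lemma Bop_D (i : Fin d) (a : L ⊕ Fin d) (φ : SB d) :
    SB.D i (Bop L τ τ₀ h a φ) = Bop L τ τ₀ h a (SB.D i φ) :=
  Bop_commute (fun l φ => (SB.fd_D h l i φ).symm) (fun j φ => SB.D_comm i j φ) a φ

lemma Bop_fd (l : E d) (a : L ⊕ Fin d) (φ : SB d) :
    SB.fd h l (Bop L τ τ₀ h a φ) = Bop L τ τ₀ h a (SB.fd h l φ) :=
  Bop_commute (fun k φ => SB.fd_comm h l k φ) (fun j φ => SB.fd_D h l j φ) a φ

lemma Bop_sd (l : E d) (a : L ⊕ Fin d) (φ : SB d) :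
    SB.sd h l (Bop L τ τ₀ h a φ) = Bop L τ τ₀ h a (SB.sd h l φ) :=
  Bop_commute (fun k φ => SB.sd_fd h l k φ) (fun j φ => SB.sd_D h l j φ) a φ

lemma isLeibniz_Bop : IsLeibniz (Bop L τ τ₀ h) (shiftVec L h) where
  comm a b φ := by
    refine Bop_commute (A := Bop L τ τ₀ h a) (fun l φ => (Bop_fd l a φ).symm)
      (fun i φ => (Bop_D i a φ).symm) b φ
  tr a z φ := by
    refine (Bop_commute (A := (SB.tr z).toLinearMap) (fun l φ => ?_) (fun i φ => ?_) a φ).symm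
    · exact (SB.fd_tr h l z φ).symm
    · exact (SB.D_tr i z φ).symm
  mul a g φ := by
    rcases a with l | i
    · rw [Bop_inl, Bop_inl, Bop_inl, SB.fd_mul, shiftVec, smul_add, mul_smul_comm, smul_mul_assoc]
    · rw [Bop_inr, Bop_inr, Bop_inr, SB.D_mul, shiftVec, SB.tr_zero, smul_add, mul_smul_comm,
        smul_mul_assoc]

/-- The mean value estimate costs `‖τ_l l‖²` for each difference and `τ₀²` for the whole gradient,
so the vectors enter only through `‖Λ₁‖²`. -/
lemma sum_sq_Bop_le (hh : 0 < h) {β : Type} [Fintype β] (φ : β → SB d) (C : ℝ)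
    (hC : ∀ z, ∑ b, ∑ i, SB.D i (φ b) z ^ 2 ≤ C) (x : E d) :
    ∑ b, ∑ a, Bop L τ τ₀ h a (φ b) x ^ 2 ≤ (τ₀ ^ 2 + ∑ l ∈ L, ‖τ l • l‖ ^ 2) * C := by
  have h1 : ∀ b, ∑ a, Bop L τ τ₀ h a (φ b) x ^ 2 =
      ∑ l ∈ L, τ l ^ 2 * SB.fd h l (φ b) x ^ 2 + τ₀ ^ 2 * ∑ i, SB.D i (φ b) x ^ 2 := by
    intro b
    rw [Fintype.sum_sum_type, ← Finset.sum_coe_sort L, Finset.mul_sum]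
    simp only [Bop_inl, Bop_inr, SB.smul_apply, mul_pow]
  simp only [h1]
  rw [Finset.sum_add_distrib, Finset.sum_comm, add_mul, add_comm, Finset.sum_mul, ← Finset.mul_sum]
  refine add_le_add (mul_le_mul_of_nonneg_left (hC x) (sq_nonneg _))
    (Finset.sum_le_sum fun l _ => ?_)
  rw [← Finset.mul_sum, norm_smul, mul_pow, mul_assoc, Real.norm_eq_abs, sq_abs]
  exact mul_le_mul_of_nonneg_left (SB.sum_sq_fd_le hh l φ C hC x) (sq_nonneg _)

/-- Since the bound for one `δ̄` holds for families, the derivatives still to be taken can be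
absorbed into the index of the family; thus each exchange of a partial derivative for a `δ̄` costs
one and the same factor. -/
lemma sum_sq_iter_Bop_le (hh : 0 < h) (k : ℕ) : ∀ {β : Type} [Fintype β] (φ : β → SB d) (C : ℝ),
    (∀ z, ∑ b, wsum k (fun μ => iter SB.D μ (φ b) z ^ 2) ≤ C) → ∀ x,
    ∑ b, wsum k (fun μ => iter (Bop L τ τ₀ h) μ (φ b) x ^ 2) ≤
      (τ₀ ^ 2 + ∑ l ∈ L, ‖τ l • l‖ ^ 2) ^ k * C := by
  induction k with
  | zero =>
    intro β _ φ C hC x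
    simpa [wsum_zero] using hC x
  | succ k ih =>
    intro β _ φ C hC x
    have h1 : ∀ z, ∑ p : β × (L ⊕ Fin d), wsum k (fun μ =>
        iter SB.D μ (Bop L τ τ₀ h p.2 (φ p.1)) z ^ 2) ≤
        (τ₀ ^ 2 + ∑ l ∈ L, ‖τ l • l‖ ^ 2) * C := by
      intro z
      have h2 := sum_sq_Bop_le (L := L) (τ := τ) (τ₀ := τ₀) hh
        (fun p : β × (Fin k → Fin d) => iter SB.D (List.ofFn p.2) (φ p.1)) C (fun z => by
          refine le_trans (le_of_eq ?_) (hC z)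
          rw [Fintype.sum_prod_type]
          refine Finset.sum_congr rfl fun b _ => ?_
          rw [wsum_succ, sum_wsum, wsum]
          simp only [iter_cons, iter_commute (A := SB.D _) (SB.D_comm _)]) z
      refine le_trans (le_of_eq ?_) h2
      rw [Fintype.sum_prod_type, Fintype.sum_prod_type]
      refine Finset.sum_congr rfl fun b _ => ?_
      rw [sum_wsum, wsum]
      simp only [← iter_commute (A := Bop L τ τ₀ h _) (fun i φ => (Bop_D i _ φ).symm)]
    have := ih _ _ h1 x
    rw [Fintype.sum_prod_type] at this
    simp only [wsum_succ]
    rw [pow_succ, mul_assoc]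
    exact this

/-- This is what the labels `ℓ^i` are for: with `τ₀ D_i` among the operators `δ̄`, control of these
gives back the true gradient. -/
lemma sum_sq_D_le_Bop (hτ : τ₀ ≠ 0) (φ : SB d) (x : E d) :
    ∑ i, SB.D i φ x ^ 2 ≤ (τ₀ ^ 2)⁻¹ * ∑ a, Bop L τ τ₀ h a φ x ^ 2 := by
  rw [Fintype.sum_sum_type, le_inv_mul_iff₀ (by positivity), Finset.mul_sum]
  refine le_add_of_nonneg_of_le (Finset.sum_nonneg fun _ _ => sq_nonneg _) (le_of_eq ?_)
  simp only [Bop_inr, SB.smul_apply, mul_pow]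

lemma wsum_iter_succ {ι : Type} [Fintype ι] {B : ι → SB d →ₗ[ℝ] SB d}
    (hB : ∀ a b φ, B a (B b φ) = B b (B a φ)) {N : Type*} [AddCommMonoid N] (n : ℕ)
    (F : SB d → N) (v : SB d) :
    wsum (n + 1) (fun μ => F (iter B μ v)) = wsum n (fun μ => ∑ a, F (B a (iter B μ v))) := by
  rw [wsum_succ, sum_wsum]
  simp only [iter_cons, iter_commute (A := B _) (hB _)]

lemma wsum_sq_iter_D_le (hτ : τ₀ ≠ 0) (k : ℕ) (v : SB d) (x : E d) :
    wsum k (fun μ => iter SB.D μ v x ^ 2) ≤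
      ((τ₀ ^ 2)⁻¹) ^ k * wsum k (fun μ => iter (Bop L τ τ₀ h) μ v x ^ 2) := by
  induction k generalizing v with
  | zero => simp [wsum_zero]
  | succ k ih =>
    rw [wsum_succ]
    refine (Finset.sum_le_sum fun a _ => ih _).trans ?_
    rw [← Finset.mul_sum, sum_wsum, pow_succ ((τ₀ ^ 2)⁻¹), mul_assoc]
    refine mul_le_mul_of_nonneg_left ?_ (by positivity)
    rw [wsum_iter_succ isLeibniz_Bop.comm k (fun φ => φ x ^ 2), mul_wsum]
    refine wsum_mono fun μ _ => ?_
    refine le_trans (le_of_eq (Finset.sum_congr rfl fun i _ => ?_))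
      (sum_sq_D_le_Bop (L := L) (τ := τ) (h := h) hτ _ x)
    rw [iter_commute (A := SB.D i) (Bop_D i)]

end Bop

/-! ### Difference schemes with smooth coefficients -/

/-- A difference scheme with smooth coefficients. -/
structure SmoothScheme (d : ℕ) where
  L : Finset (E d)
  τ : E d → ℝ
  τ₀ : ℝ
  h : ℝ
  q : L → SB d
  p : L → SB d
  c : SB d

namespace SmoothScheme

variable (G : SmoothScheme d)

/-- The operators `δ̄_{h,a}`. -/
abbrev B : G.L ⊕ Fin d → SB d →ₗ[ℝ] SB d := Bop G.L G.τ G.τ₀ G.h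

/-- The translation vectors of the operators `T_{h,a}`. -/
abbrev y : G.L ⊕ Fin d → E d := shiftVec G.L G.h

/-- `χ_{h,l} = q_l + h p_l`. -/
def χ (l : G.L) : SB d := G.q l + G.h • G.p l

/-- `h⁻¹ δ_{h,l} v`. -/
def quot (v : SB d) (l : G.L) : SB d := G.h⁻¹ • SB.fd G.h (l : E d) v

/-- The difference operator `L_h`. -/
def op (v : SB d) : SB d := ∑ l, G.χ l * G.quot v l - G.c * v

/-- The form `A_h`. -/
def A (φ : SB d) : SB d :=
  (2 : ℝ) • ∑ l, ∑ a, G.B a (G.χ l) * SB.tr (G.y a) (G.quot φ l) * G.B a φ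

/-- The form `∑ (δ̄_{h,λ} φ) Q_{h,λ} T_{h,λ} φ` over `λ ∈ Λ²`. -/
def A2 (φ : SB d) : SB d :=
  ∑ l, ∑ a, ∑ b, G.B a (G.B b (G.q l)) * SB.tr (G.y a) (SB.tr (G.y b) (G.quot φ l)) *
    G.B a (G.B b φ)

/-- The form `𝒬_h`. -/
def cQ (φ : SB d) : SB d := ∑ l, G.χ l * SB.fd G.h (l : E d) φ ^ 2

/-- The sum of the squares of all `δ̄`-derivatives of order `k`. -/
def V (v : SB d) (k : ℕ) : SB d := wsum k (fun μ => iter G.B μ v ^ 2)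

/-- The sum of `𝒬_h` over all `δ̄`-derivatives of order `k`. -/
def Qs (v : SB d) (k : ℕ) : SB d := wsum k (fun μ => G.cQ (iter G.B μ v))

/-- The hypotheses on a scheme with smooth coefficients. In the structural inequalities the
operators of class `𝔎` are replaced by suprema. -/
structure Admissible (m : ℕ) (δ K c₀ r2 s2 Mb : ℝ) : Prop where
  h_pos : 0 < G.h
  τ₀_pos : 0 < G.τ₀
  χ_nonneg : ∀ l x, 0 ≤ G.χ l x
  balanced : ∀ i, ∑ l : G.L, (l : E d) i • G.q l = 0
  c_lower : ∀ x, c₀ ≤ G.c x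
  size : ∑ l ∈ G.L, ‖l‖ ^ 2 = r2
  wsize : ∑ l ∈ G.L, ‖G.τ l • l‖ ^ 2 = s2
  q_bound : ∀ k ≤ m, ∀ x, ∑ l, wsum k (fun μ => iter SB.D μ (G.q l) x ^ 2) ≤ Mb
  p_bound : ∀ k ≤ m, ∀ x, ∑ l, wsum k (fun μ => iter SB.D μ (G.p l) x ^ 2) ≤ Mb
  c_bound : ∀ k ≤ m, ∀ x, wsum k (fun μ => iter SB.D μ G.c x ^ 2) ≤ Mb
  structural1 : ∀ (φ : SB d) (W : ℝ), (∀ z, ∑ a, G.B a φ z ^ 2 ≤ W) → ∀ x,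
    m * G.A φ x ≤ (1 - δ) * ∑ a, G.cQ (G.B a φ) x + K * G.cQ φ x + 2 * (1 - δ) * G.c x * W
  structural2 : ∀ n : ℕ, 1 ≤ n → n ≤ m → ∀ {β : Type} [Fintype β] (φ : β → SB d) (W W' : ℝ),
    (∀ z, ∑ ν, ∑ a, ∑ b, G.B a (G.B b (φ ν)) z ^ 2 ≤ W) →
    (∀ z, ∑ ν, ∑ a, G.B a (φ ν) z ^ 2 ≤ W') → ∀ x,
    ∑ ν, (n * ∑ a, G.A (G.B a (φ ν)) x + n * ((n : ℝ) - 1) * G.A2 (φ ν) x) ≤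
      (1 - δ) * ∑ ν, ∑ a, ∑ b, G.cQ (G.B a (G.B b (φ ν))) x +
      K * ∑ ν, ∑ a, G.cQ (G.B a (φ ν)) x + 2 * (1 - δ) * G.c x * W + K * W'

variable {G}

lemma quot_commute {B : SB d →ₗ[ℝ] SB d} (hB : ∀ l φ, B (SB.fd G.h l φ) = SB.fd G.h l (B φ))
    (v : SB d) (l : G.L) : B (G.quot v l) = G.quot (B v) l := by
  rw [quot, quot, map_smul, hB]

lemma iter_fd (μ : List (G.L ⊕ Fin d)) (l : E d) (v : SB d) :
    iter G.B μ (SB.fd G.h l v) = SB.fd G.h l (iter G.B μ v) :=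
  (iter_commute (A := SB.fd G.h l) (Bop_fd l) μ v).symm

lemma iter_sd (μ : List (G.L ⊕ Fin d)) (l : E d) (v : SB d) :
    iter G.B μ (SB.sd G.h l v) = SB.sd G.h l (iter G.B μ v) :=
  (iter_commute (A := SB.sd G.h l) (Bop_sd l) μ v).symm

lemma iter_quot (μ : List (G.L ⊕ Fin d)) (v : SB d) (l : G.L) :
    iter G.B μ (G.quot v l) = G.quot (iter G.B μ v) l :=
  quot_commute (fun l φ => iter_fd μ l φ) v l

/-- The discrete carré du champ: `b² - a² = 2a(b - a) + (b - a)²` at each shifted point. The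
zero-order term contributes `-c φ²` on the left and `-2c φ²` on the right, hence the surplus `c φ²`.
-/
lemma op_sq (φ : SB d) :
    G.op (φ ^ 2) = (2 : ℝ) • (φ * G.op φ) + G.cQ φ + G.c * φ ^ 2 := by
  ext x
  simp only [op, cQ, quot, SB.sub_apply, SB.add_apply, SB.mul_apply, SB.sum_apply, SB.smul_apply,
    SB.pow_apply, SB.fd_apply]
  have : ∀ l : G.L, G.χ l x * (G.h⁻¹ * (G.h⁻¹ * (φ (x + G.h • (l : E d)) ^ 2 - φ x ^ 2))) =
      2 * φ x * (G.χ l x * (G.h⁻¹ * (G.h⁻¹ * (φ (x + G.h • (l : E d)) - φ x)))) +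
      G.χ l x * (G.h⁻¹ * (φ (x + G.h • (l : E d)) - φ x)) ^ 2 := by
    intro l; ring
  rw [Finset.sum_congr rfl fun l _ => this l, Finset.sum_add_distrib, ← Finset.mul_sum]
  ring

lemma op_add (φ ψ : SB d) : G.op (φ + ψ) = G.op φ + G.op ψ := by
  simp only [op, quot, map_add, smul_add, mul_add, Finset.sum_add_distrib]; ring

lemma op_smul (a : ℝ) (φ : SB d) : G.op (a • φ) = a • G.op φ := by
  simp only [op, quot, map_smul, mul_smul_comm, smul_sub, Finset.smul_sum, smul_comm a]

/-- `L_h` as a linear map. -/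
def opL (G : SmoothScheme d) : SB d →ₗ[ℝ] SB d where
  toFun := G.op
  map_add' := op_add
  map_smul' := op_smul

lemma op_wsum {ι : Type} [Fintype ι] (n : ℕ) (F : List ι → SB d) :
    G.op (wsum n F) = wsum n (fun μ => G.op (F μ)) :=
  map_sum G.opL _ _

lemma wsum_apply {ι : Type} [Fintype ι] (n : ℕ) (F : List ι → SB d) (x : E d) :
    wsum n F x = wsum n (fun μ => F μ x) := SB.sum_apply _ _ _

lemma V_apply (v : SB d) (k : ℕ) (x : E d) :
    G.V v k x = wsum k (fun μ => iter G.B μ v x ^ 2) := wsum_apply _ _ _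

lemma V_nonneg (v : SB d) (k : ℕ) (x : E d) : 0 ≤ G.V v k x := by
  rw [V_apply]; exact wsum_nonneg fun _ => sq_nonneg _

lemma op_V (v : SB d) (k : ℕ) (x : E d) :
    G.op (G.V v k) x = wsum k (fun μ => 2 * (iter G.B μ v x * G.op (iter G.B μ v) x)) +
      G.Qs v k x + G.c x * G.V v k x := by
  rw [V, op_wsum]
  simp only [op_sq, wsum_add, SB.add_apply, Qs]
  congr 1
  · rw [wsum_apply]; rfl
  · rw [wsum_apply, wsum_apply, mul_wsum]; rfl

/-- The terms of `δ̄_μ (L_h v + f)` which contain only `δ̄`-derivatives of `v` of order less than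
the length of `μ`. -/
def rem (G : SmoothScheme d) (f v : SB d) (μ : List (G.L ⊕ Fin d)) : SB d :=
  iter G.B μ f +
    ∑ j ∈ Finset.range μ.length, ∑ l, leib G.B G.y μ (j + 3) (G.q l) (SB.sd G.h (l : E d) v) +
    ∑ j ∈ Finset.range (μ.length + 1), ∑ l,
      leib G.B G.y μ (j + 2) (G.p l) (SB.fd G.h (l : E d) v) -
    ∑ j ∈ Finset.range (μ.length + 2), leib G.B G.y μ (j + 1) G.c v

lemma iter_mul' {ι : Type} {B : ι → SB d →ₗ[ℝ] SB d} {y : ι → E d} (hB : IsLeibniz B y)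
    (μ : List ι) (g φ : SB d) (n : ℕ) (hn : μ.length ≤ n) :
    iter B μ (g * φ) = ∑ k ∈ Finset.range (n + 1), leib B y μ k g φ := by
  rw [iter_mul hB]
  refine Finset.sum_subset (Finset.range_subset_range.2 (by omega)) fun k _ hk => ?_
  exact leib_eq_zero μ k (by simpa using hk) g φ

variable {m : ℕ} {δ K c₀ r2 s2 Mb : ℝ}

/-- `leib` is linear in the coefficient and `Σ l_i q_l = 0`, so subtracting `h⁻¹ ∂_l v` from each
quotient changes nothing. What remains, unlike `h⁻¹ δ_{h,l} v`, is controlled by second derivatives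
uniformly in `h`. -/
lemma sum_leib_quot (hG : G.Admissible m δ K c₀ r2 s2 Mb) (v : SB d) (μ : List (G.L ⊕ Fin d))
    (j : ℕ) : ∑ l, leib G.B G.y μ j (G.q l) (G.quot v l) =
      ∑ l, leib G.B G.y μ j (G.q l) (SB.sd G.h (l : E d) v) := by
  have h1 : ∀ l : G.L, G.quot v l = SB.sd G.h (l : E d) v +
      G.h⁻¹ • ∑ i, (l : E d) i • SB.D i v := by
    intro l
    rw [SB.sd_eq, quot, SB.dd, LinearMap.sum_apply]
    simp only [LinearMap.smul_apply, smul_sub, sub_add_cancel]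
  simp only [h1, map_add, map_smul, map_sum, Finset.sum_add_distrib]
  rw [add_eq_left, ← Finset.smul_sum, Finset.sum_comm]
  have h2 : ∀ i, ∑ l : G.L, (l : E d) i • leib G.B G.y μ j (G.q l) (SB.D i v) = 0 := by
    intro i
    have h3 := congrArg (fun g => leib G.B G.y μ j g (SB.D i v)) (hG.balanced i)
    simpa [map_sum, LinearMap.sum_apply] using h3
  rw [Finset.sum_eq_zero fun i _ => h2 i, smul_zero]

/-- The commutator of `L_h` with a word of operators, with its critical terms displayed: one
operator on `χ` or two on `q`. For these, order counting does not suffice and the structural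
inequalities are needed. -/
lemma op_iter (hG : G.Admissible m δ K c₀ r2 s2 Mb) {f v : SB d} (hv : G.op v + f = 0)
    (μ : List (G.L ⊕ Fin d)) :
    G.op (iter G.B μ v) = -(∑ l, leib G.B G.y μ 1 (G.χ l) (G.quot v l)) -
      ∑ l, leib G.B G.y μ 2 (G.q l) (G.quot v l) - G.rem f v μ := by
  have hh := hG.h_pos.ne'
  have h0 : ∀ (w : SB d) (l : G.L), G.χ l * G.quot w l =
      G.q l * G.quot w l + G.p l * SB.fd G.h (l : E d) w := by
    intro w l
    rw [χ, add_mul, quot, smul_mul_smul_comm, mul_inv_cancel₀ hh, one_smul]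
  have h1 : ∀ l : G.L, leib G.B G.y μ 1 (G.χ l) (G.quot v l) =
      leib G.B G.y μ 1 (G.q l) (G.quot v l) +
      leib G.B G.y μ 1 (G.p l) (SB.fd G.h (l : E d) v) := by
    intro l
    simp only [χ, quot, map_add, LinearMap.add_apply, map_smul, LinearMap.smul_apply]
    rw [smul_add, smul_smul G.h⁻¹ G.h, inv_mul_cancel₀ hh, one_smul]
  -- All Leibniz expansions are padded with vanishing terms up to index `μ.length + 2`, so that
  -- three initial terms can be split off even when the word is short.
  have e1 : ∀ g φ : SB d, iter G.B μ (g * φ) = g * iter G.B μ φ +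
      ∑ j ∈ Finset.range (μ.length + 2), leib G.B G.y μ (j + 1) g φ := by
    intro g φ
    rw [iter_mul' isLeibniz_Bop μ g φ (μ.length + 2) (by omega), Finset.sum_range_succ',
      leib_zero, add_comm]
  have e2 : ∀ g φ : SB d, iter G.B μ (g * φ) = g * iter G.B μ φ + (leib G.B G.y μ 1 g φ +
      ∑ j ∈ Finset.range (μ.length + 1), leib G.B G.y μ (j + 2) g φ) := by
    intro g φ
    rw [e1, Finset.sum_range_succ', add_comm (leib G.B G.y μ 1 g φ)]
  have e3 : ∀ g φ : SB d, iter G.B μ (g * φ) = g * iter G.B μ φ + (leib G.B G.y μ 1 g φ +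
      (leib G.B G.y μ 2 g φ + ∑ j ∈ Finset.range μ.length, leib G.B G.y μ (j + 3) g φ)) := by
    intro g φ
    rw [e2, Finset.sum_range_succ', add_comm (leib G.B G.y μ 2 g φ)]
  have h2 := congrArg (iter G.B μ) hv
  simp only [op, h0, map_add, map_sub, map_sum, map_zero, Finset.sum_add_distrib] at h2
  rw [Finset.sum_congr rfl fun l _ => e3 (G.q l) (G.quot v l),
    Finset.sum_congr rfl fun l _ => e2 (G.p l) (SB.fd G.h (l : E d) v), e1 G.c v] at h2
  simp only [Finset.sum_add_distrib] at h2
  rw [Finset.sum_comm (t := Finset.range μ.length),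
    Finset.sum_comm (t := Finset.range (μ.length + 1))] at h2
  simp only [sum_leib_quot hG v μ (_ + 3)] at h2
  simp only [op, h0, h1, rem, Finset.sum_add_distrib, iter_quot, iter_fd] at h2 ⊢
  rw [← sub_eq_zero, ← h2]
  abel

end SmoothScheme

/-! ### Estimates of the lower-order terms of the commutator. -/

namespace SmoothScheme

variable {G : SmoothScheme d} {m : ℕ} {δ K c₀ r2 s2 Mb : ℝ}

lemma wsum_iter_iter_sq (k j : ℕ) (v : SB d) (x : E d) :
    wsum k (fun μ => wsum j (fun ν => iter G.B ν (iter G.B μ v) x ^ 2)) = G.V v (k + j) x := by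
  induction k generalizing v with
  | zero => simp [wsum_zero, V_apply]
  | succ k ih =>
    simp only [wsum_succ, iter_cons, ih, V_apply]
    rw [show k + 1 + j = k + j + 1 by ring, wsum_succ]
    rfl

lemma sum_wsum_sq_fd_le (hG : G.Admissible m δ K c₀ r2 s2 Mb) (v : SB d) (k : ℕ) (Y : ℝ)
    (hY : ∀ z, G.V v (k + 1) z ≤ Y) (x : E d) :
    ∑ l : G.L, wsum k (fun μ => iter G.B μ (SB.fd G.h (l : E d) v) x ^ 2) ≤
      r2 * ((G.τ₀ ^ 2)⁻¹ * Y) := by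
  rw [← hG.size, Finset.sum_mul, ← Finset.sum_coe_sort G.L]
  refine Finset.sum_le_sum fun l _ => ?_
  simp only [iter_fd]
  refine SB.sum_sq_fd_le hG.h_pos _ _ _ (fun z => ?_) x
  refine (Finset.sum_le_sum fun μ _ => sum_sq_D_le_Bop (L := G.L) (τ := G.τ) (h := G.h)
    hG.τ₀_pos.ne' _ z).trans ?_
  rw [← Finset.mul_sum]
  refine mul_le_mul_of_nonneg_left (le_trans (le_of_eq ?_) (hY z)) (by positivity)
  rw [V_apply, wsum_iter_succ isLeibniz_Bop.comm k (fun φ => φ z ^ 2)]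
  rfl

lemma sum_wsum_sq_sd_le (hG : G.Admissible m δ K c₀ r2 s2 Mb) (v : SB d) (k : ℕ) (Y : ℝ)
    (hY0 : 0 ≤ Y) (hY : ∀ z, G.V v (k + 2) z ≤ Y) (x : E d) :
    ∑ l : G.L, wsum k (fun μ => iter G.B μ (SB.sd G.h (l : E d) v) x ^ 2) ≤
      r2 ^ 2 * (((G.τ₀ ^ 2)⁻¹) ^ 2 * Y) := by
  have h4 : ∑ l ∈ G.L, ‖l‖ ^ 4 ≤ r2 ^ 2 := by
    rw [← hG.size]
    calc ∑ l ∈ G.L, ‖l‖ ^ 4 = ∑ l ∈ G.L, (‖l‖ ^ 2) ^ 2 :=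
          Finset.sum_congr rfl fun l _ => by ring
      _ ≤ (∑ l ∈ G.L, ‖l‖ ^ 2) ^ 2 :=
          Finset.sum_sq_le_sq_sum_of_nonneg fun _ _ => sq_nonneg _
  refine le_trans ?_ (mul_le_mul_of_nonneg_right h4 (by positivity))
  rw [Finset.sum_mul, ← Finset.sum_coe_sort G.L]
  refine Finset.sum_le_sum fun l _ => ?_
  simp only [iter_sd]
  refine SB.sum_sq_sd_le hG.h_pos _ _ _ (fun z => ?_) x
  calc ∑ μ : Fin k → G.L ⊕ Fin d, ∑ i, ∑ j, SB.D j (SB.D i (iter G.B (List.ofFn μ) v)) z ^ 2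
      = ∑ μ : Fin k → G.L ⊕ Fin d,
          wsum 2 (fun ν => iter SB.D ν (iter G.B (List.ofFn μ) v) z ^ 2) := by
        simp only [wsum_succ, wsum_zero, iter_cons, iter_nil]
    _ ≤ ∑ μ : Fin k → G.L ⊕ Fin d, ((G.τ₀ ^ 2)⁻¹) ^ 2 *
          wsum 2 (fun ν => iter G.B ν (iter G.B (List.ofFn μ) v) z ^ 2) :=
        Finset.sum_le_sum fun μ _ => wsum_sq_iter_D_le hG.τ₀_pos.ne' 2 _ z
    _ ≤ ((G.τ₀ ^ 2)⁻¹) ^ 2 * Y := by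
        rw [← Finset.mul_sum]
        refine mul_le_mul_of_nonneg_left (le_trans (le_of_eq ?_) (hY z)) (by positivity)
        exact wsum_iter_iter_sq k 2 v z

/-- The bounds on the factors are required only for `j ≤ k`, because otherwise there are not enough
operators and the term vanishes. -/
lemma wsum_leib_le {β : Type} [Fintype β] (k j : ℕ) (g φ : β → SB d) (C Φ : ℝ) (hC : 0 ≤ C)
    (hΦ : 0 ≤ Φ)
    (h1 : j ≤ k → ∀ x, ∑ l, wsum j (fun μ => iter G.B μ (g l) x ^ 2) ≤ C)
    (h2 : j ≤ k → ∀ x, ∑ l, wsum (k - j) (fun μ => iter G.B μ (φ l) x ^ 2) ≤ Φ) (x : E d) :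
    wsum k (fun μ => (∑ l, leib G.B G.y μ j (g l) (φ l)) x ^ 2) ≤ 4 ^ k * (C * Φ) := by
  rcases le_or_gt j k with hjk | hjk
  · have := wsum_leib_sq_le (isLeibniz_Bop (L := G.L) (τ := G.τ) (τ₀ := G.τ₀) (h := G.h)) k j
      (k - j) (by omega) (fun _ : Unit => g) (fun _ (_ : Unit) => φ) C Φ hΦ
      (by simpa using h1 hjk) (by simpa using h2 hjk) x
    simpa using this
  · rw [wsum_congr (G := fun _ => 0)]
    · simp only [wsum, Finset.sum_const_zero]; positivity
    · intro μ hμ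
      simp [leib_eq_zero μ j (by omega)]

lemma wsum_sum_sq_le {ι : Type} [Fintype ι] (k N : ℕ) (F : ℕ → List ι → SB d) (C : ℝ)
    (x : E d) (h : ∀ j < N, wsum k (fun μ => F j μ x ^ 2) ≤ C) :
    wsum k (fun μ => (∑ j ∈ Finset.range N, F j μ) x ^ 2) ≤ N ^ 2 * C := by
  calc wsum k (fun μ => (∑ j ∈ Finset.range N, F j μ) x ^ 2)
      ≤ wsum k (fun μ => N * ∑ j ∈ Finset.range N, F j μ x ^ 2) := by
        refine wsum_mono fun μ _ => ?_
        rw [SB.sum_apply]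
        simpa using sq_sum_le_card_mul_sum_sq (s := Finset.range N) (f := fun j => F j μ x)
    _ = N * ∑ j ∈ Finset.range N, wsum k (fun μ => F j μ x ^ 2) := by
        rw [← mul_wsum, sum_wsum]
    _ ≤ N * ∑ j ∈ Finset.range N, C := by
        gcongr with j hj; exact h j (Finset.mem_range.1 hj)
    _ = N ^ 2 * C := by simp; ring

/-- The constant in the estimate of the lower-order terms. -/
def remConst (m : ℕ) (τ₀ r2 s2 Mb : ℝ) : ℝ :=
  4 * (1 + τ₀ ^ 2 + s2) ^ m * (1 + ((m : ℝ) + 2) ^ 2 * (4 ^ m * (Mb *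
    (r2 ^ 2 * ((τ₀ ^ 2)⁻¹) ^ 2 + r2 * (τ₀ ^ 2)⁻¹ + 1))))

lemma Admissible.Mb_nonneg (hG : G.Admissible m δ K c₀ r2 s2 Mb) : 0 ≤ Mb :=
  (wsum_nonneg fun _ => sq_nonneg _).trans (hG.c_bound 0 (Nat.zero_le _) 0)

lemma Admissible.r2_nonneg (hG : G.Admissible m δ K c₀ r2 s2 Mb) : 0 ≤ r2 :=
  hG.size ▸ Finset.sum_nonneg fun _ _ => sq_nonneg _

lemma Admissible.s2_nonneg (hG : G.Admissible m δ K c₀ r2 s2 Mb) : 0 ≤ s2 :=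
  hG.wsize ▸ Finset.sum_nonneg fun _ _ => sq_nonneg _

lemma iter_bound (hG : G.Admissible m δ K c₀ r2 s2 Mb) {β : Type} [Fintype β] (φ : β → SB d)
    (C : ℝ) (k : ℕ) (hk : k ≤ m) (hC0 : 0 ≤ C)
    (hC : ∀ z, ∑ b, wsum k (fun μ => iter SB.D μ (φ b) z ^ 2) ≤ C) (x : E d) :
    ∑ b, wsum k (fun μ => iter G.B μ (φ b) x ^ 2) ≤ (1 + G.τ₀ ^ 2 + s2) ^ m * C := by
  refine (sum_sq_iter_Bop_le hG.h_pos k φ C hC x).trans ?_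
  rw [hG.wsize]
  have h1 := hG.s2_nonneg
  refine mul_le_mul_of_nonneg_right ?_ hC0
  calc (G.τ₀ ^ 2 + s2) ^ k ≤ (1 + G.τ₀ ^ 2 + s2) ^ k := by gcongr; linarith [sq_nonneg G.τ₀]
    _ ≤ (1 + G.τ₀ ^ 2 + s2) ^ m := pow_le_pow_right₀ (by linarith [sq_nonneg G.τ₀]) hk

/-- Order counting. At least three operators fall on `q` against the second-order `sd`, at least two
on `p` against the first-order `fd`, at least one on `c` against `v` itself; in each case at most `k
- 1` derivatives of `v` are left, so only `V_j` with `j < k` are needed. -/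
lemma rem_bound (hG : G.Admissible m δ K c₀ r2 s2 Mb) (f v : SB d) (Y : ℝ) (k : ℕ) (hkm : k ≤ m)
    (hf : ∀ x, wsum k (fun μ => iter SB.D μ f x ^ 2) ≤ Y) (hY : ∀ j < k, ∀ x, G.V v j x ≤ Y)
    (x : E d) :
    wsum k (fun μ => G.rem f v μ x ^ 2) ≤ remConst m G.τ₀ r2 s2 Mb * Y := by
  have hY0 : 0 ≤ Y := (wsum_nonneg fun _ => sq_nonneg _).trans (hf 0)
  have hM := hG.Mb_nonneg
  have hr := hG.r2_nonneg
  have hs := hG.s2_nonneg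
  have hτ := hG.τ₀_pos
  set κ := (1 + G.τ₀ ^ 2 + s2) ^ m with hκ
  set t := (G.τ₀ ^ 2)⁻¹ with ht
  have hκ0 : 0 ≤ κ := by positivity
  have ht0 : 0 ≤ t := by positivity
  have bf : wsum k (fun μ => iter G.B μ f x ^ 2) ≤ κ * Y := by
    simpa using iter_bound hG (fun _ : Unit => f) Y k hkm hY0 (by simpa using hf) x
  have bq : wsum k (fun μ => (∑ j ∈ Finset.range k, ∑ l,
      leib G.B G.y μ (j + 3) (G.q l) (SB.sd G.h (l : E d) v)) x ^ 2) ≤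
      k ^ 2 * (4 ^ k * (κ * Mb * (r2 ^ 2 * (t ^ 2 * Y)))) := by
    refine wsum_sum_sq_le k k _ _ x fun j hj => ?_
    refine wsum_leib_le k (j + 3) G.q (fun l => SB.sd G.h (l : E d) v) _ _ (by positivity)
      (by positivity)
      (fun h => iter_bound hG _ _ _ (by omega) hM (hG.q_bound _ (by omega))) (fun h => ?_) x
    exact sum_wsum_sq_sd_le hG v _ Y hY0 (hY _ (by omega))
  have bp : wsum k (fun μ => (∑ j ∈ Finset.range (k + 1), ∑ l,
      leib G.B G.y μ (j + 2) (G.p l) (SB.fd G.h (l : E d) v)) x ^ 2) ≤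
      ((k + 1 : ℕ) : ℝ) ^ 2 * (4 ^ k * (κ * Mb * (r2 * (t * Y)))) := by
    refine wsum_sum_sq_le k (k + 1) _ _ x fun j hj => ?_
    refine wsum_leib_le k (j + 2) G.p (fun l => SB.fd G.h (l : E d) v) _ _ (by positivity)
      (by positivity)
      (fun h => iter_bound hG _ _ _ (by omega) hM (hG.p_bound _ (by omega))) (fun h => ?_) x
    exact sum_wsum_sq_fd_le hG v _ Y (hY _ (by omega))
  have bc : wsum k (fun μ => (∑ j ∈ Finset.range (k + 2),
      leib G.B G.y μ (j + 1) G.c v) x ^ 2) ≤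
      ((k + 2 : ℕ) : ℝ) ^ 2 * (4 ^ k * (κ * Mb * Y)) := by
    refine wsum_sum_sq_le k (k + 2) _ _ x fun j hj => ?_
    have := wsum_leib_le (G := G) k (j + 1) (fun _ : Unit => G.c) (fun _ : Unit => v) (κ * Mb) Y
      (by positivity) hY0
      (fun h => iter_bound hG _ _ _ (by omega) hM (by simpa using hG.c_bound _ (by omega)))
      (fun h => by
        have := hY (k - (j + 1)) (by omega)
        simpa [V_apply] using this) x
    simpa using this
  have hkm' : (k : ℝ) ≤ m := by exact_mod_cast hkm
  have h4 : (4 : ℝ) ^ k ≤ 4 ^ m := pow_le_pow_right₀ (by norm_num) hkm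
  have up : ∀ (n : ℕ) (X : ℝ), 0 ≤ X → n ≤ k + 2 →
      (n : ℝ) ^ 2 * (4 ^ k * X) ≤ ((m : ℝ) + 2) ^ 2 * (4 ^ m * X) := by
    intro n X hX hn
    have : (n : ℝ) ≤ m + 2 := by exact_mod_cast (by omega : n ≤ m + 2)
    gcongr
  have bq' := bq.trans (up k _ (by positivity) (by omega))
  have bp' := bp.trans (up (k + 1) _ (by positivity) (by omega))
  have bc' := bc.trans (up (k + 2) _ (by positivity) (by omega))
  calc wsum k (fun μ => G.rem f v μ x ^ 2)
      ≤ wsum k (fun μ => 4 * (iter G.B μ f x ^ 2 + (∑ j ∈ Finset.range k, ∑ l,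
      leib G.B G.y μ (j + 3) (G.q l) (SB.sd G.h (l : E d) v)) x ^ 2 +
      (∑ j ∈ Finset.range (k + 1), ∑ l,
      leib G.B G.y μ (j + 2) (G.p l) (SB.fd G.h (l : E d) v)) x ^ 2 +
      (∑ j ∈ Finset.range (k + 2), leib G.B G.y μ (j + 1) G.c v) x ^ 2)) := by
        refine wsum_mono fun μ hμ => ?_
        subst hμ
        rw [rem, SB.sub_apply, SB.add_apply, SB.add_apply]
        generalize iter G.B μ f x = a
        generalize (∑ j ∈ Finset.range μ.length, ∑ l,
          leib G.B G.y μ (j + 3) (G.q l) (SB.sd G.h (l : E d) v)) x = b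
        generalize (∑ j ∈ Finset.range (μ.length + 1), ∑ l,
          leib G.B G.y μ (j + 2) (G.p l) (SB.fd G.h (l : E d) v)) x = c
        generalize (∑ j ∈ Finset.range (μ.length + 2), leib G.B G.y μ (j + 1) G.c v) x = e
        nlinarith [sq_nonneg (a - b), sq_nonneg (a - c), sq_nonneg (a + e), sq_nonneg (b - c),
          sq_nonneg (b + e), sq_nonneg (c + e)]
    _ ≤ 4 * (κ * Y + ((m : ℝ) + 2) ^ 2 * (4 ^ m * (κ * Mb * (r2 ^ 2 * (t ^ 2 * Y)))) +
        ((m : ℝ) + 2) ^ 2 * (4 ^ m * (κ * Mb * (r2 * (t * Y)))) +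
        ((m : ℝ) + 2) ^ 2 * (4 ^ m * (κ * Mb * Y))) := by
        rw [← mul_wsum, wsum_add, wsum_add, wsum_add]
        linarith
    _ = remConst m G.τ₀ r2 s2 Mb * Y := by
        rw [remConst, ← hκ, ← ht]; ring

/-! ### Critical terms of the commutator and the Bernstein inequality. -/

lemma two_wsum_main_one (v : SB d) (k : ℕ) :
    (2 : ℝ) • wsum (k + 1) (fun μ => (∑ l, leib G.B G.y μ 1 (G.χ l) (G.quot v l)) *
      iter G.B μ v) = (k + 1 : ℝ) • wsum k (fun μ => G.A (iter G.B μ v)) := by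
  simp only [Finset.sum_mul, A]
  rw [← sum_wsum]
  simp only [wsum_leib_one isLeibniz_Bop, iter_quot]
  rw [← Finset.smul_sum, sum_wsum, smul_comm]
  congr 1
  exact Finset.smul_sum

lemma two_wsum_main_two (v : SB d) (k : ℕ) :
    (2 : ℝ) • wsum (k + 2) (fun μ => (∑ l, leib G.B G.y μ 2 (G.q l) (G.quot v l)) *
      iter G.B μ v) = ((k + 2 : ℝ) * (k + 1)) • wsum k (fun μ => G.A2 (iter G.B μ v)) := by
  simp only [Finset.sum_mul, A2]
  rw [← sum_wsum, Finset.smul_sum]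
  simp only [wsum_leib_two isLeibniz_Bop, iter_quot]
  rw [← Finset.smul_sum, sum_wsum]

lemma cQ_nonneg (hG : G.Admissible m δ K c₀ r2 s2 Mb) (φ : SB d) (x : E d) : 0 ≤ G.cQ φ x := by
  rw [cQ, SB.sum_apply]
  exact Finset.sum_nonneg fun l _ => mul_nonneg (hG.χ_nonneg l x) (sq_nonneg _)

lemma Qs_apply (v : SB d) (k : ℕ) (x : E d) :
    G.Qs v k x = wsum k (fun μ => G.cQ (iter G.B μ v) x) := wsum_apply _ _ _

lemma Qs_nonneg (hG : G.Admissible m δ K c₀ r2 s2 Mb) (v : SB d) (k : ℕ) (x : E d) :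
    0 ≤ G.Qs v k x := by
  rw [Qs_apply]; exact wsum_nonneg fun μ => cQ_nonneg hG _ x

lemma V_succ (v : SB d) (k : ℕ) (x : E d) :
    G.V v (k + 1) x = wsum k (fun μ => ∑ a, G.B a (iter G.B μ v) x ^ 2) := by
  rw [V_apply, wsum_iter_succ isLeibniz_Bop.comm k (fun φ => φ x ^ 2)]

lemma Qs_succ (v : SB d) (k : ℕ) (x : E d) :
    G.Qs v (k + 1) x = wsum k (fun μ => ∑ a, G.cQ (G.B a (iter G.B μ v)) x) := by
  rw [Qs_apply, wsum_iter_succ isLeibniz_Bop.comm k (fun φ => G.cQ φ x)]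

lemma wsum_iter_succ_succ (n : ℕ) (F : SB d → ℝ) (v : SB d) :
    wsum (n + 2) (fun μ => F (iter G.B μ v)) =
      wsum n (fun μ => ∑ a, ∑ b, F (G.B a (G.B b (iter G.B μ v)))) := by
  rw [wsum_iter_succ isLeibniz_Bop.comm (n + 1) F,
    wsum_iter_succ isLeibniz_Bop.comm n (fun φ => ∑ a, F (G.B a φ))]
  exact wsum_congr fun μ _ => Finset.sum_comm

lemma V_succ_succ (v : SB d) (k : ℕ) (x : E d) :
    G.V v (k + 2) x = wsum k (fun μ => ∑ a, ∑ b, G.B a (G.B b (iter G.B μ v)) x ^ 2) := by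
  rw [V_apply]
  exact wsum_iter_succ_succ k (fun φ => φ x ^ 2) v

lemma Qs_succ_succ (v : SB d) (k : ℕ) (x : E d) :
    G.Qs v (k + 2) x = wsum k (fun μ => ∑ a, ∑ b, G.cQ (G.B a (G.B b (iter G.B μ v))) x) := by
  rw [Qs_apply]
  exact wsum_iter_succ_succ k (fun φ => G.cQ φ x) v

/-- The structural inequalities in the form in which they enter the estimate. -/
lemma structural_words (hG : G.Admissible m δ K c₀ r2 s2 Mb) (hK : 0 ≤ K) (hδ : δ ≤ 1)
    (hc₀ : 0 ≤ c₀) (v : SB d) (k : ℕ) (hk : k + 1 ≤ m) (W W' : ℝ)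
    (hW : ∀ z, G.V v (k + 1) z ≤ W) (hW' : ∀ z, G.V v k z ≤ W') (x : E d) :
    2 * wsum (k + 1) (fun μ => (∑ l, leib G.B G.y μ 1 (G.χ l) (G.quot v l)) x * iter G.B μ v x) +
      2 * wsum (k + 1) (fun μ => (∑ l, leib G.B G.y μ 2 (G.q l) (G.quot v l)) x * iter G.B μ v x)
      ≤ (1 - δ) * G.Qs v (k + 1) x + K * G.Qs v k x + 2 * (1 - δ) * G.c x * W + K * W' := by
  have e1 := congrArg (fun φ : SB d => φ x) (two_wsum_main_one (G := G) v k)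
  simp only [SB.smul_apply, wsum_apply, SB.mul_apply] at e1
  rw [e1]
  have hW0 : 0 ≤ W := (V_nonneg v _ 0).trans (hW 0)
  have hW0' : 0 ≤ W' := (V_nonneg v _ 0).trans (hW' 0)
  have hc : 0 ≤ G.c x := hc₀.trans (hG.c_lower x)
  rcases k with _ | k
  -- At order one no second operator is available, so only the first structural inequality is used.
  · have e2 : wsum (0 + 1) (fun μ => (∑ l, leib G.B G.y μ 2 (G.q l) (G.quot v l)) x *
        iter G.B μ v x) = 0 := by
      rw [wsum_congr (G := fun _ => 0)]
      · simp [wsum]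
      · intro μ hμ
        simp [leib_eq_zero μ 2 (by omega)]
    rw [e2, Qs_succ, Qs_apply]
    simp only [V_succ, wsum_zero, iter_nil, Nat.cast_zero, zero_add, one_mul, mul_zero,
      add_zero] at hW ⊢
    have h1 := hG.structural1 v W hW x
    have h2 : 0 ≤ (1 - δ) * ∑ a, G.cQ (G.B a v) x + K * G.cQ v x + 2 * (1 - δ) * G.c x * W := by
      have hδ' : 0 ≤ 1 - δ := sub_nonneg.2 hδ
      exact add_nonneg (add_nonneg (mul_nonneg hδ' (Finset.sum_nonneg fun a _ => cQ_nonneg hG _ x))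
        (mul_nonneg hK (cQ_nonneg hG v x)))
        (mul_nonneg (mul_nonneg (mul_nonneg zero_le_two hδ') hc) hW0)
    have hm : (1 : ℝ) ≤ m := by exact_mod_cast hk
    have h3 : 0 ≤ K * W' := mul_nonneg hK hW0'
    -- The inequality bounds `m A` whereas `A` is wanted. The right-hand side is nonnegative, so
    -- only the case `A ≥ 0` matters, and then `A ≤ m A`.
    rcases le_total (G.A v x) 0 with h | h
    · linarith
    · nlinarith
  · have e2 := congrArg (fun φ : SB d => φ x) (two_wsum_main_two (G := G) v k)
    simp only [SB.smul_apply, wsum_apply, SB.mul_apply] at e2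
    have w1 : ∀ z, ∑ μ : Fin k → G.L ⊕ Fin d, ∑ a, ∑ b,
        G.B a (G.B b (iter G.B (List.ofFn μ) v)) z ^ 2 ≤ W := by
      intro z
      exact (V_succ_succ v k z).symm.trans_le (hW z)
    have w2 : ∀ z, ∑ μ : Fin k → G.L ⊕ Fin d, ∑ a,
        G.B a (iter G.B (List.ofFn μ) v) z ^ 2 ≤ W' := by
      intro z
      exact (V_succ v k z).symm.trans_le (hW' z)
    -- The inequality for order `n = k + 2` is applied to the family of all `δ̄`-derivatives of
    -- order `k` at once. Only in this way does the bound involve the supremum of the sum `V_{k+2}`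
    -- and not a sum of suprema.
    have h1 := hG.structural2 (k + 2) (by omega) hk
      (fun μ : Fin k → G.L ⊕ Fin d => iter G.B (List.ofFn μ) v) W W' w1 w2 x
    have e3 : G.Qs v (k + 1 + 1) x = _ := Qs_succ_succ v k x
    have e4 := wsum_iter_succ (isLeibniz_Bop (L := G.L) (τ := G.τ) (τ₀ := G.τ₀) (h := G.h)).comm k
      (fun φ => G.A φ x) v
    rw [e2, e3, Qs_succ v k, e4]
    rw [Finset.sum_add_distrib, ← Finset.mul_sum, ← Finset.mul_sum] at h1
    push_cast at h1 ⊢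
    refine le_trans (le_of_eq ?_) h1
    simp only [wsum]
    ring

/-- Of the good term `Q_{k+1}` a fraction `1 - δ` is spent on the critical terms. The product of the
remainder with the derivatives is split by Young's inequality with a free parameter `θ`: when all
`V_j` involved are already bounded `θ = 1` will do, while at the top order `θ V_{k+1}` has to be
absorbed. -/
lemma op_V_ge (hG : G.Admissible m δ K c₀ r2 s2 Mb) (hK : 0 ≤ K) (hδ : δ ≤ 1)
    (hc₀ : 0 ≤ c₀) {f v : SB d} (hv : G.op v + f = 0) (k : ℕ) (hk : k + 1 ≤ m) (W W' Y θ : ℝ)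
    (hθ : 0 < θ)
    (hW : ∀ z, G.V v (k + 1) z ≤ W) (hW' : ∀ z, G.V v k z ≤ W')
    (hf : ∀ x, wsum (k + 1) (fun μ => iter SB.D μ f x ^ 2) ≤ Y)
    (hY : ∀ j < k + 1, ∀ x, G.V v j x ≤ Y) (x : E d) :
    δ * G.Qs v (k + 1) x - K * G.Qs v k x + G.c x * G.V v (k + 1) x - 2 * (1 - δ) * G.c x * W -
      K * W' - θ * G.V v (k + 1) x - θ⁻¹ * (remConst m G.τ₀ r2 s2 Mb * Y) ≤
      G.op (G.V v (k + 1)) x := by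
  have h1 := structural_words hG hK hδ hc₀ v k hk W W' hW hW' x
  have h2 := rem_bound hG f v Y (k + 1) hk hf hY x
  have h3 : 2 * wsum (k + 1) (fun μ => G.rem f v μ x * iter G.B μ v x) ≤
      θ * G.V v (k + 1) x + θ⁻¹ * (remConst m G.τ₀ r2 s2 Mb * Y) := by
    refine le_trans ?_ (add_le_add_right (mul_le_mul_of_nonneg_left h2 (inv_nonneg.2 hθ.le)) _)
    rw [V_apply, mul_wsum, mul_wsum, mul_wsum, ← wsum_add]
    refine wsum_mono fun μ _ => ?_
    have : 0 ≤ θ⁻¹ * (θ * iter G.B μ v x - G.rem f v μ x) ^ 2 := by positivity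
    have e : θ⁻¹ * (θ * iter G.B μ v x - G.rem f v μ x) ^ 2 = θ * iter G.B μ v x ^ 2 +
      θ⁻¹ * G.rem f v μ x ^ 2 - 2 * (G.rem f v μ x * iter G.B μ v x) := by
      field_simp; ring
    linarith
  rw [op_V]
  have h4 : wsum (k + 1) (fun μ => 2 * (iter G.B μ v x * G.op (iter G.B μ v) x)) =
      -(2 * wsum (k + 1) (fun μ => (∑ l, leib G.B G.y μ 1 (G.χ l) (G.quot v l)) x *
        iter G.B μ v x) +
      2 * wsum (k + 1) (fun μ => (∑ l, leib G.B G.y μ 2 (G.q l) (G.quot v l)) x *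
        iter G.B μ v x)) - 2 * wsum (k + 1) (fun μ => G.rem f v μ x * iter G.B μ v x) := by
    rw [← mul_add, ← wsum_add, ← mul_neg, ← mul_sub, mul_comm, ← neg_one_mul, mul_wsum,
      sub_eq_add_neg, ← neg_one_mul (wsum _ _), mul_wsum, ← wsum_add, mul_comm, mul_wsum]
    refine wsum_congr fun μ _ => ?_
    rw [op_iter hG hv, SB.sub_apply, SB.sub_apply, SB.neg_apply]
    ring
  rw [h4]
  linarith

end SmoothScheme

/-! ### Discrete maximum principle and induction on the order of derivatives. -/

lemma SB.exists_near_max (U : SB d) {η : ℝ} (hη : 0 < η) : ∃ x₀, ∀ z, U z ≤ U x₀ + η := by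
  obtain ⟨C, hC⟩ := SB.exists_bound U
  have hb : BddAbove (Set.range fun z => U z) := ⟨C, by
    rintro _ ⟨z, rfl⟩; exact (le_abs_self _).trans (hC z)⟩
  obtain ⟨_, ⟨x₀, rfl⟩, hx⟩ := exists_lt_of_lt_csSup (Set.range_nonempty fun z => U z)
    (sub_lt_self _ hη)
  exact ⟨x₀, fun z => by linarith [le_csSup hb ⟨z, rfl⟩]⟩

lemma le_of_forall_eta {a b C : ℝ} (h : ∀ η : ℝ, 0 < η → a ≤ b + η * C) : a ≤ b := by
  refine le_of_forall_pos_le_add fun ε hε => (h (ε / (|C| + 1)) (by positivity)).trans ?_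
  gcongr
  rw [div_mul_eq_mul_div, div_le_iff₀ (by positivity)]
  nlinarith [le_abs_self C]

namespace SmoothScheme

variable {G : SmoothScheme d} {m : ℕ} {δ K c₀ r2 s2 Mb : ℝ}

/-- On the whole space a supremum need not be attained, so points within `η` of it are used. The
error constant `X` depends on `h`, which is harmless: it is multiplied by `η`, and `η → 0` before
any other limit. -/
lemma exists_op_le (hχ : ∀ l x, 0 ≤ G.χ l x) : ∃ X : ℝ, ∀ (U : SB d) (η : ℝ) (x₀ : E d),
    0 ≤ η → (∀ z, U z ≤ U x₀ + η) → G.op U x₀ ≤ η * X - G.c x₀ * U x₀ := by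
  obtain ⟨X, hX⟩ := SB.exists_bound (∑ l, G.χ l)
  refine ⟨(G.h⁻¹) ^ 2 * X, fun U η x₀ hη hU => ?_⟩
  simp only [op, quot, SB.sub_apply, SB.sum_apply, SB.mul_apply, SB.smul_apply, SB.fd_apply]
  gcongr
  calc ∑ l, G.χ l x₀ * (G.h⁻¹ * (G.h⁻¹ * (U (x₀ + G.h • (l : E d)) - U x₀)))
      = (G.h⁻¹) ^ 2 * ∑ l, G.χ l x₀ * (U (x₀ + G.h • (l : E d)) - U x₀) := by
        rw [Finset.mul_sum]; exact Finset.sum_congr rfl fun l _ => by ring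
    _ ≤ (G.h⁻¹) ^ 2 * ∑ l, G.χ l x₀ * η := by
        gcongr with l
        · exact hχ l x₀
        · linarith [hU (x₀ + G.h • (l : E d))]
    _ ≤ (G.h⁻¹) ^ 2 * (X * η) := by
        rw [← Finset.sum_mul]
        gcongr
        simpa using (le_abs_self _).trans (hX x₀)
    _ = η * ((G.h⁻¹) ^ 2 * X) := by ring

/-- The discrete maximum principle. -/
lemma le_of_op_ge (hχ : ∀ l x, 0 ≤ G.χ l x) (hc₀ : 0 < c₀) (hc : ∀ x, c₀ ≤ G.c x) (U : SB d)
    (C : ℝ) (hC : 0 ≤ C) (hU : ∀ x, -C ≤ G.op U x) (x : E d) : U x ≤ C / c₀ := by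
  obtain ⟨X, hX⟩ := exists_op_le hχ
  rw [le_div_iff₀ hc₀]
  refine le_of_forall_eta (C := X + c₀) fun η hη => ?_
  obtain ⟨x₀, hx₀⟩ := SB.exists_near_max U hη
  have h1 := hX U η x₀ hη.le hx₀
  have h2 := hU x₀
  have h3 := hx₀ x
  rcases le_or_gt (U x₀) 0 with h | h
  · have h4 : (U x) * c₀ ≤ η * c₀ := by gcongr; linarith
    -- For the zero function this says `0 ≤ η X`, which is needed when the near-maximum is
    -- nonpositive.
    have h5 := hX 0 η x₀ hη.le (fun z => by simp [hη.le])
    simp only [SB.zero_apply, mul_zero, sub_zero] at h5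
    have h6 : G.op 0 x₀ = 0 := by simp [op, quot]
    nlinarith
  · have : c₀ * U x₀ ≤ G.c x₀ * U x₀ := mul_le_mul_of_nonneg_right (hc x₀) h.le
    nlinarith

/-- The auxiliary function `∑_{j < n} a^{n-j} V_j`. -/
def lowSum (G : SmoothScheme d) (a : ℝ) (v : SB d) : ℕ → SB d
  | 0 => 0
  | n + 1 => a • (lowSum G a v n + G.V v n)

/-- The number `∑_{j < n} a^{n-j}`. -/
def lowConst (a : ℝ) : ℕ → ℝ
  | 0 => 0
  | n + 1 => a * (lowConst a n + 1)

lemma lowConst_nonneg {a : ℝ} (ha : 0 ≤ a) (n : ℕ) : 0 ≤ lowConst a n := by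
  induction n with
  | zero => exact le_rfl
  | succ n ih => exact mul_nonneg ha (by linarith)

lemma lowSum_nonneg {a : ℝ} (ha : 0 ≤ a) (v : SB d) (n : ℕ) (x : E d) :
    0 ≤ lowSum G a v n x := by
  induction n with
  | zero => exact le_rfl
  | succ n ih => exact mul_nonneg ha (add_nonneg ih (V_nonneg v n x))

lemma lowSum_le {a : ℝ} (ha : 0 ≤ a) (v : SB d) (n : ℕ) (Y : ℝ)
    (hY : ∀ j < n, ∀ x, G.V v j x ≤ Y) (x : E d) : lowSum G a v n x ≤ lowConst a n * Y := by
  induction n with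
  | zero => simp [lowSum, lowConst]
  | succ n ih =>
    rw [lowSum, lowConst, SB.smul_apply, SB.add_apply, mul_assoc, add_mul, one_mul]
    gcongr
    · exact ih fun j hj => hY j (by omega)
    · exact hY n (by omega) x

/-- The constant in the lower bound of `L_h V_j`. -/
def opConst (m : ℕ) (K τ₀ r2 s2 Mb : ℝ) : ℝ := 2 * (Mb + 1) + K + 3 + remConst m τ₀ r2 s2 Mb

lemma Admissible.c_le (hG : G.Admissible m δ K c₀ r2 s2 Mb) (x : E d) : G.c x ≤ Mb + 1 := by
  have := hG.c_bound 0 (Nat.zero_le _) x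
  rw [wsum_zero, iter_nil] at this
  nlinarith [sq_nonneg (G.c x - 1)]

lemma Admissible.remConst_nonneg (hG : G.Admissible m δ K c₀ r2 s2 Mb) :
    0 ≤ remConst m G.τ₀ r2 s2 Mb := by
  have := hG.Mb_nonneg
  have := hG.r2_nonneg
  have := hG.s2_nonneg
  have := hG.τ₀_pos
  unfold remConst
  positivity

lemma op_V_zero {f v : SB d} (hv : G.op v + f = 0) (x : E d) :
    G.op (G.V v 0) x = -(2 * (v x * f x)) + G.Qs v 0 x + G.c x * v x ^ 2 := by
  have h : G.op v x = - f x := by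
    have := congrArg (fun φ : SB d => φ x) hv
    simp only [SB.add_apply, SB.zero_apply] at this
    linarith
  rw [op_V, wsum_zero, iter_nil, h, V_apply, wsum_zero, iter_nil]
  ring

/-- The weight `a = K / δ` makes the terms telescope: if the lower part contributes at least `K
Q_{n-1}`, this cancels the `-K Q_{n-1}` in `L_h V_n`, leaving `δ Q_n`, and multiplication by `a`
gives `K Q_n` for the next step. All `V_j` that occur are bounded by `Y`, so everything else is at
worst a multiple of `Y`. -/
lemma op_lowSum_ge (hG : G.Admissible m δ K c₀ r2 s2 Mb) (hK : 0 ≤ K) (hδ0 : 0 < δ) (hδ : δ ≤ 1)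
    (hc₀ : 0 ≤ c₀) {f v : SB d} (hv : G.op v + f = 0) (Y : ℝ)
    (hf : ∀ j ≤ m, ∀ x, wsum j (fun μ => iter SB.D μ f x ^ 2) ≤ Y) (n : ℕ) (hn : n ≤ m)
    (hY : ∀ j ≤ n, ∀ x, G.V v j x ≤ Y) (x : E d) :
    K * G.Qs v n x - opConst m K G.τ₀ r2 s2 Mb * lowConst (K / δ) (n + 1) * Y ≤
      G.op (lowSum G (K / δ) v (n + 1)) x := by
  have hY0 : 0 ≤ Y := (wsum_nonneg fun _ => sq_nonneg _).trans (hf 0 (Nat.zero_le _) 0)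
  have hρ := hG.remConst_nonneg
  have hM := hG.Mb_nonneg
  have ha : 0 ≤ K / δ := by positivity
  have haδ : K / δ * δ = K := by field_simp
  have hcx := hG.c_le x
  have hcx0 := hc₀.trans (hG.c_lower x)
  induction n with
  | zero =>
    rw [lowSum, lowSum, zero_add, zero_add, op_smul, SB.smul_apply, op_V_zero hv, lowConst,
      lowConst]
    have h1 := hY 0 le_rfl x
    have h2 := hf 0 (Nat.zero_le _) x
    rw [V_apply, wsum_zero, iter_nil] at h1
    rw [wsum_zero, iter_nil] at h2
    have h3 := Qs_nonneg hG v 0 x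
    have h4 : δ * G.Qs v 0 x - opConst m K G.τ₀ r2 s2 Mb * Y ≤
        -(2 * (v x * f x)) + G.Qs v 0 x + G.c x * v x ^ 2 := by
      have : δ * G.Qs v 0 x ≤ G.Qs v 0 x := mul_le_of_le_one_left h3 hδ
      have : 2 * Y ≤ opConst m K G.τ₀ r2 s2 Mb * Y := by
        unfold opConst; gcongr; linarith
      have : 0 ≤ G.c x * v x ^ 2 := by positivity
      nlinarith [sq_nonneg (v x - f x)]
    calc _ = K / δ * (δ * G.Qs v 0 x - opConst m K G.τ₀ r2 s2 Mb * Y) := by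
          have : K * G.Qs v 0 x = K / δ * (δ * G.Qs v 0 x) := by rw [← mul_assoc, haδ]
          rw [this]; ring
      _ ≤ _ := mul_le_mul_of_nonneg_left h4 ha
  | succ n ih =>
    have h1 := ih (by omega) fun j hj => hY j (by omega)
    have h2 := op_V_ge hG hK hδ hc₀ hv n hn Y Y Y 1 one_pos (hY (n + 1) le_rfl)
      (hY n (by omega)) (hf (n + 1) hn) (fun j hj => hY j (by omega)) x
    rw [inv_one, one_mul, one_mul] at h2
    have h3 := hY (n + 1) le_rfl x
    have h4 : 0 ≤ G.c x * G.V v (n + 1) x := mul_nonneg hcx0 (V_nonneg v _ x)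
    have h5 : 2 * (1 - δ) * G.c x * Y ≤ 2 * (Mb + 1) * Y := by
      have : (1 - δ) * G.c x ≤ 1 * (Mb + 1) := by gcongr; linarith
      nlinarith
    have h6 : δ * G.Qs v (n + 1) x - K * G.Qs v n x - opConst m K G.τ₀ r2 s2 Mb * Y ≤
        G.op (G.V v (n + 1)) x := by
      unfold opConst
      nlinarith
    rw [lowSum, op_smul, op_add, SB.smul_apply, SB.add_apply]
    calc K * G.Qs v (n + 1) x - opConst m K G.τ₀ r2 s2 Mb * lowConst (K / δ) (n + 1 + 1) * Y
        = K / δ * (K * G.Qs v n x - opConst m K G.τ₀ r2 s2 Mb * lowConst (K / δ) (n + 1) * Y +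
          (δ * G.Qs v (n + 1) x - K * G.Qs v n x - opConst m K G.τ₀ r2 s2 Mb * Y)) := by
          rw [show lowConst (K / δ) (n + 1 + 1) = K / δ * (lowConst (K / δ) (n + 1) + 1) from rfl]
          have : K * G.Qs v (n + 1) x = K / δ * (δ * G.Qs v (n + 1) x) := by
            rw [← mul_assoc, haδ]
          rw [this]; ring
      _ ≤ _ := mul_le_mul_of_nonneg_left (add_le_add h1 h6) ha

/-- The constant in the inductive step. -/
def stepConst (m : ℕ) (δ K c₀ τ₀ r2 s2 Mb : ℝ) (n : ℕ) : ℝ :=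
  (2 * (Mb + 1) + opConst m K τ₀ r2 s2 Mb + δ * c₀) * lowConst (K / δ) n + K +
    (δ * c₀)⁻¹ * remConst m τ₀ r2 s2 Mb

/-- At a near-maximum `x` of `V_{n+1} + S`, with `S` the weighted sum of lower orders, `L_h (V_{n+1}
+ S)` is at most `-c (V_{n+1} + S)` up to `η`, while `S` supplies the `K Q_n` missing in the lower
bound for `L_h V_{n+1}`. Since `0 ≤ S ≤ b Y`, the global bound for `V_{n+1}` is its value at `x`
plus `b Y + η`, so the nonlocal term costs `2 (1 - δ) c V_{n+1}(x)` and leaves `2 δ c V_{n+1}(x)`.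
-/
lemma V_succ_le (hG : G.Admissible m δ K c₀ r2 s2 Mb) (hK : 0 ≤ K) (hδ0 : 0 < δ) (hδ : δ ≤ 1)
    (hc₀ : 0 < c₀) {f v : SB d} (hv : G.op v + f = 0) (Y : ℝ)
    (hf : ∀ j ≤ m, ∀ x, wsum j (fun μ => iter SB.D μ f x ^ 2) ≤ Y) (n : ℕ) (hn : n + 1 ≤ m)
    (hY : ∀ j ≤ n, ∀ x, G.V v j x ≤ Y) (z : E d) :
    δ * c₀ * G.V v (n + 1) z ≤ stepConst m δ K c₀ G.τ₀ r2 s2 Mb (n + 1) * Y := by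
  have hY0 : 0 ≤ Y := (wsum_nonneg fun _ => sq_nonneg _).trans (hf 0 (Nat.zero_le _) 0)
  have ha : 0 ≤ K / δ := by positivity
  have hθ : 0 < δ * c₀ := by positivity
  have hM := hG.Mb_nonneg
  obtain ⟨X, hX⟩ := exists_op_le hG.χ_nonneg
  refine le_of_forall_eta (C := X + 2 * (Mb + 1) + δ * c₀) fun η hη => ?_
  set b := lowConst (K / δ) (n + 1) with hb
  have hb0 : 0 ≤ b := lowConst_nonneg ha _
  set S := lowSum G (K / δ) v (n + 1) with hS
  have hS0 : ∀ x, 0 ≤ S x := lowSum_nonneg ha v _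
  have hSb : ∀ x, S x ≤ b * Y := lowSum_le ha v (n + 1) Y fun j hj => hY j (by omega)
  obtain ⟨x, hx⟩ := SB.exists_near_max (G.V v (n + 1) + S) hη
  have hW : ∀ z, G.V v (n + 1) z ≤ G.V v (n + 1) x + b * Y + η := by
    intro z
    have := hx z
    simp only [SB.add_apply] at this
    linarith [hS0 z, hSb x]
  have h1 := hX _ η x hη.le hx
  -- With `θ = δ c₀` Young's inequality uses up at most half of the available `2 δ c V_{n+1}(x)`.
  have h2 := op_V_ge hG hK hδ hc₀.le hv n hn _ Y Y (δ * c₀) hθ hW (hY n le_rfl) (hf (n + 1) hn)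
    (fun j hj => hY j (by omega)) x
  have h3 := op_lowSum_ge hG hK hδ0 hδ hc₀.le hv Y hf n (by omega) hY x
  rw [op_add, SB.add_apply, SB.add_apply] at h1
  have hc0 : 0 ≤ G.c x := hc₀.le.trans (hG.c_lower x)
  have h4 : 0 ≤ δ * G.Qs v (n + 1) x := mul_nonneg hδ0.le (Qs_nonneg hG v _ x)
  have h5 : 0 ≤ G.c x * S x := mul_nonneg hc0 (hS0 x)
  have hV := V_nonneg (G := G) v (n + 1) x
  have h6 : δ * c₀ * G.V v (n + 1) x ≤ δ * G.c x * G.V v (n + 1) x := by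
    gcongr; exact hG.c_lower x
  have h7 : 2 * (1 - δ) * G.c x * (b * Y + η) ≤ 2 * (Mb + 1) * (b * Y + η) := by
    have : (1 - δ) * G.c x ≤ 1 * (Mb + 1) := by
      gcongr
      · linarith
      · exact hG.c_le x
    have : 0 ≤ b * Y + η := by positivity
    nlinarith
  have h8 := hW z
  have h9 : δ * c₀ * G.V v (n + 1) z ≤ δ * c₀ * (G.V v (n + 1) x + b * Y + η) := by gcongr
  rw [stepConst, ← hb]
  linarith

lemma V_zero_le (hG : G.Admissible m δ K c₀ r2 s2 Mb) (hc₀ : 0 < c₀) {f v : SB d}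
    (hv : G.op v + f = 0) (Y : ℝ) (hf : ∀ x, f x ^ 2 ≤ Y) (z : E d) :
    G.V v 0 z ≤ (c₀⁻¹) ^ 2 * Y := by
  rw [inv_pow, le_inv_mul_iff₀ (by positivity)]
  obtain ⟨X, hX⟩ := exists_op_le hG.χ_nonneg
  refine le_of_forall_eta (C := c₀ * X + c₀ ^ 2) fun η hη => ?_
  obtain ⟨x, hx⟩ := SB.exists_near_max (G.V v 0) hη
  have h1 := hX _ η x hη.le hx
  rw [op_V_zero hv] at h1
  have h2 := Qs_nonneg hG v 0 x
  have h3 := hx z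
  have hVx : G.V v 0 x = v x ^ 2 := by rw [V_apply, wsum_zero, iter_nil]
  rw [hVx] at h1 h3
  have h4 : c₀ * v x ^ 2 ≤ G.c x * v x ^ 2 := by gcongr; exact hG.c_lower x
  have h5 : 2 * c₀ * v x ^ 2 ≤ 2 * (v x * f x) + η * X := by linarith
  have h6 := hf x
  have h7 : c₀ ^ 2 * v x ^ 2 ≤ Y + η * (c₀ * X) := by
    nlinarith [sq_nonneg (c₀ * v x - f x)]
  nlinarith [sq_nonneg c₀]

/-- The a priori estimate for difference schemes, with a constant that depends neither on the
dimension nor on the step. -/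
theorem exists_estimate (m : ℕ) (δ K c₀ τ₀ r2 s2 Mb : ℝ) (hδ0 : 0 < δ) (hδ : δ ≤ 1) (hK : 0 ≤ K)
    (hc₀ : 0 < c₀) : ∃ N : ℝ, 0 ≤ N ∧ ∀ (d : ℕ) (G : SmoothScheme d) (f v : SB d) (F : ℝ),
      G.τ₀ = τ₀ → G.Admissible m δ K c₀ r2 s2 Mb → G.op v + f = 0 →
      (∀ j ≤ m, ∀ x, wsum j (fun μ => iter SB.D μ f x ^ 2) ≤ F) →
      ∀ j ≤ m, ∀ x, wsum j (fun μ => iter SB.D μ v x ^ 2) ≤ N * F := by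
  have key : ∀ n ≤ m, ∃ N : ℝ, 1 ≤ N ∧ ∀ (d : ℕ) (G : SmoothScheme d) (f v : SB d) (F : ℝ),
      G.τ₀ = τ₀ → G.Admissible m δ K c₀ r2 s2 Mb → G.op v + f = 0 →
      (∀ j ≤ m, ∀ x, wsum j (fun μ => iter SB.D μ f x ^ 2) ≤ F) →
      ∀ j ≤ n, ∀ x, G.V v j x ≤ N * F := by
    intro n hn
    induction n with
    | zero =>
      refine ⟨1 + (c₀⁻¹) ^ 2, by nlinarith [sq_nonneg c₀⁻¹], fun d G f v F _ hG hv hf j hj x => ?_⟩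
      obtain rfl : j = 0 := by omega
      have hf0 : ∀ x, f x ^ 2 ≤ F := fun x => by simpa [wsum_zero] using hf 0 (Nat.zero_le _) x
      have := V_zero_le hG hc₀ hv F hf0 x
      nlinarith [hf0 x, sq_nonneg (f x)]
    | succ n ih =>
      obtain ⟨N, hN1, hN⟩ := ih (by omega)
      refine ⟨N + |(δ * c₀)⁻¹ * stepConst m δ K c₀ τ₀ r2 s2 Mb (n + 1)| * N,
        by nlinarith [abs_nonneg ((δ * c₀)⁻¹ * stepConst m δ K c₀ τ₀ r2 s2 Mb (n + 1))],
        fun d G f v F hτ hG hv hf j hj x => ?_⟩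
      have hF : 0 ≤ F := (wsum_nonneg fun _ => sq_nonneg _).trans (hf 0 (Nat.zero_le _) 0)
      have hY := hN d G f v F hτ hG hv hf
      -- The constants are kept at least 1 so that `N * F` bounds both the derivatives of `f` and
      -- the lower-order `V_j`.
      have hNF : F ≤ N * F := le_mul_of_one_le_left hF hN1
      rw [add_mul]
      rcases Nat.lt_or_ge j (n + 1) with h | h
      · exact (hY j (by omega) x).trans (le_add_of_nonneg_right (by positivity))
      · obtain rfl : j = n + 1 := by omega
        have h1 := V_succ_le hG hK hδ0 hδ hc₀ hv (N * F) (fun j hj x => (hf j hj x).trans hNF) n hn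
          hY x
        rw [← le_inv_mul_iff₀ (by positivity), hτ, ← mul_assoc] at h1
        have h2 : 0 ≤ N * F := by positivity
        refine h1.trans ((mul_le_mul_of_nonneg_right (le_abs_self _) h2).trans ?_)
        rw [← mul_assoc]
        linarith
  obtain ⟨N, hN1, hN⟩ := key m le_rfl
  -- Returning from `δ̄`-derivatives to partial derivatives costs `τ₀⁻²` per order.
  refine ⟨(1 + (τ₀ ^ 2)⁻¹) ^ m * N, by positivity, fun d G f v F hτ hG hv hf j hj x => ?_⟩
  have hF : 0 ≤ F := (wsum_nonneg fun _ => sq_nonneg _).trans (hf 0 (Nat.zero_le _) 0)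
  refine (wsum_sq_iter_D_le (L := G.L) (τ := G.τ) (h := G.h) hG.τ₀_pos.ne' j v x).trans ?_
  rw [mul_assoc, hτ]
  have h1 : ((τ₀ ^ 2)⁻¹) ^ j ≤ (1 + (τ₀ ^ 2)⁻¹) ^ m := by
    have h0 : 0 ≤ (τ₀ ^ 2)⁻¹ := by positivity
    calc ((τ₀ ^ 2)⁻¹) ^ j ≤ (1 + (τ₀ ^ 2)⁻¹) ^ j := by gcongr; linarith
      _ ≤ (1 + (τ₀ ^ 2)⁻¹) ^ m := pow_le_pow_right₀ (by linarith) hj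
  have h2 := hN d G f v F hτ hG hv hf j hj x
  rw [V_apply, B, hτ] at h2
  exact mul_le_mul h1 h2 (wsum_nonneg fun _ => sq_nonneg _) (by positivity)

end SmoothScheme

/-! ### Solvability of difference equations with smooth coefficients -/

section Fixed

variable {ι : Type*} [Fintype ι] (a : ι → SB d) (y : ι → E d) (g : SB d)

/-- The terms of the Neumann series for `v = ∑ aᵢ v(· + yᵢ) + g`. -/
def neumann : ℕ → SB d
  | 0 => g
  | n + 1 => ∑ i, a i * SB.tr (y i) (neumann n)

variable {a y}

/-- Strong induction on the order of differentiation. When all derivatives fall on the previous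
iterate the nonnegative weights contribute a factor `ρ`; in the other Leibniz terms the iterate
carries fewer derivatives and already decays like `σ ^ n`. The rate `σ = (1 + ρ) / 2`, strictly
between `ρ` and 1, leaves room for them at every order. -/
lemma neumann_bound {ρ : ℝ} (hρ0 : 0 ≤ ρ) (hρ : ρ < 1) (ha : ∀ i x, 0 ≤ a i x)
    (hs : ∀ x, ∑ i, a i x ≤ ρ) (k : ℕ) :
    ∃ C : ℝ, 0 ≤ C ∧ ∀ n x, ‖iteratedFDeriv ℝ k (neumann a y g n) x‖ ≤ C * ((1 + ρ) / 2) ^ n := by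
  set σ := (1 + ρ) / 2 with hσ
  have hσ0 : 0 ≤ σ := by positivity
  have hσρ : 0 < σ - ρ := by rw [hσ]; linarith
  induction k using Nat.strong_induction_on with
  | _ k ih =>
    choose C hC0 hC using ih
    choose A hA using fun i => (a i).2.2
    have hA0 : ∀ i j, 0 ≤ A i j := fun i j => (norm_nonneg _).trans (hA i j 0)
    obtain ⟨b, hb⟩ := g.2.2 k
    have hb0 : 0 ≤ b := (norm_nonneg _).trans (hb 0)
    set M := ∑ i, ∑ j : Fin k, (k.choose (j + 1) : ℝ) * A i (j + 1) *
      C (k - (j + 1)) (by omega) with hM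
    have hM0 : 0 ≤ M := Finset.sum_nonneg fun i _ => Finset.sum_nonneg fun j _ =>
      mul_nonneg (mul_nonneg (Nat.cast_nonneg _) (hA0 _ _)) (hC0 _ _)
    -- The constant is chosen to dominate the initial term and to satisfy `ρ T + M ≤ σ T`.
    refine ⟨b + M / (σ - ρ), by positivity, fun n => ?_⟩
    induction n with
    | zero =>
      intro x
      have : 0 ≤ M / (σ - ρ) := by positivity
      rw [pow_zero, mul_one]
      exact (hb x).trans (by linarith)
    | succ n ihn =>
      intro x
      set T := b + M / (σ - ρ) with hT
      have hT0 : 0 ≤ T := by positivity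
      have e1 : ((neumann a y g (n + 1) : SB d) : E d → ℝ) =
          fun z => ∑ i, (a i * SB.tr (y i) (neumann a y g n)) z := by
        ext z; rw [neumann, SB.sum_apply]
      have hsm : ∀ φ : SB d, ContDiff ℝ k φ := fun φ =>
        (SB.contDiff φ).of_le (mod_cast le_top)
      rw [e1, iteratedFDeriv_fun_sum_apply (fun i _ => (hsm _).contDiffAt)]
      have term : ∀ i, ‖iteratedFDeriv ℝ k (a i * SB.tr (y i) (neumann a y g n) : SB d) x‖ ≤
          a i x * (T * σ ^ n) + (∑ j : Fin k, (k.choose (j + 1) : ℝ) * A i (j + 1) *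
            C (k - (j + 1)) (by omega)) * σ ^ n := by
        intro i
        refine (norm_iteratedFDeriv_mul_le (N := ∞) (SB.contDiff (a i))
          (SB.contDiff (SB.tr (y i) (neumann a y g n))) x (mod_cast le_top)).trans ?_
        have e2 : ∀ j, iteratedFDeriv ℝ j (SB.tr (y i) (neumann a y g n)) x =
            iteratedFDeriv ℝ j (neumann a y g n) (x + y i) := fun j =>
          iteratedFDeriv_comp_add_right (f := (neumann a y g n : E d → ℝ)) j (y i) x
        rw [Finset.sum_range_succ', add_comm, Finset.sum_mul, Finset.sum_range]
        simp only [e2]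
        refine add_le_add ?_ (Finset.sum_le_sum fun j _ => ?_)
        · rw [norm_iteratedFDeriv_zero, Real.norm_eq_abs, abs_of_nonneg (ha i x),
            Nat.choose_zero_right,
            Nat.cast_one, one_mul, Nat.sub_zero]
          exact mul_le_mul_of_nonneg_left (ihn _) (ha i x)
        · rw [mul_assoc (_ * _) (C _ _)]
          exact mul_le_mul (mul_le_mul_of_nonneg_left (hA i (j + 1) x) (Nat.cast_nonneg _))
            (hC (k - (j + 1)) (by omega) n (x + y i)) (norm_nonneg _)
            (mul_nonneg (Nat.cast_nonneg _) (hA0 _ _))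
      calc ‖∑ i, iteratedFDeriv ℝ k (a i * SB.tr (y i) (neumann a y g n) : SB d) x‖
          ≤ ∑ i, (a i x * (T * σ ^ n) + (∑ j : Fin k, (k.choose (j + 1) : ℝ) * A i (j + 1) *
            C (k - (j + 1)) (by omega)) * σ ^ n) :=
            (norm_sum_le _ _).trans (Finset.sum_le_sum fun i _ => term i)
        _ = (∑ i, a i x) * (T * σ ^ n) + M * σ ^ n := by
            rw [Finset.sum_add_distrib, ← Finset.sum_mul, ← Finset.sum_mul]
        _ ≤ ρ * (T * σ ^ n) + ((σ - ρ) * T) * σ ^ n := by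
            gcongr
            · exact hs x
            · rw [hT, mul_add, mul_div_cancel₀ _ hσρ.ne']
              exact le_add_of_nonneg_left (by positivity)
        _ = T * σ ^ (n + 1) := by ring

lemma exists_fixed {ρ : ℝ} (hρ0 : 0 ≤ ρ) (hρ : ρ < 1) (ha : ∀ i x, 0 ≤ a i x)
    (hs : ∀ x, ∑ i, a i x ≤ ρ) : ∃ v : SB d, v = ∑ i, a i * SB.tr (y i) v + g := by
  choose C hC0 hC using neumann_bound (y := y) g hρ0 hρ ha hs
  have hsum : ∀ k, Summable fun n => C k * ((1 + ρ) / 2) ^ n := fun k =>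
    (summable_geometric_of_lt_one (by positivity) (by linarith)).mul_left _
  have hs0 : ∀ x, Summable fun n => neumann a y g n x := fun x =>
    Summable.of_norm_bounded (hsum 0) fun n => by simpa using hC 0 n x
  have h1 : ContDiff ℝ ∞ (fun x => ∑' n, neumann a y g n x) :=
    contDiff_tsum (N := ⊤) (fun n => SB.contDiff _) (fun k _ => hsum k) fun k n x _ => hC k n x
  have h2 : ∀ k : ℕ, ∀ x, ‖iteratedFDeriv ℝ k (fun x => ∑' n, neumann a y g n x) x‖ ≤
      ∑' n, C k * ((1 + ρ) / 2) ^ n := by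
    intro k x
    rw [iteratedFDeriv_tsum (N := ⊤) (fun n => SB.contDiff _) (fun k _ => hsum k)
      (fun k n x _ => hC k n x) le_top]
    exact tsum_of_norm_bounded (hsum k).hasSum fun n => hC k n x
  refine ⟨⟨_, h1, fun k => ⟨_, h2 k⟩⟩, ?_⟩
  ext x
  simp only [SB.add_apply, SB.sum_apply, SB.mul_apply, SB.tr_apply]
  rw [(hs0 x).tsum_eq_zero_add, add_comm]
  congr 1
  simp only [neumann, SB.sum_apply, SB.mul_apply, SB.tr_apply]
  rw [Summable.tsum_finsetSum fun i _ => (hs0 _).mul_left _]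
  exact Finset.sum_congr rfl fun i _ => tsum_mul_left

end Fixed

/-- The equation is rewritten as `v = v + s (L_h v + f)`. For `s` small the weight of the central
point (`none`) is nonnegative too, and all weights add up to `1 - s c ≤ 1 - s c₀ < 1`, so a
contracting averaging equation results. -/
lemma SmoothScheme.exists_solution {G : SmoothScheme d} {c₀ : ℝ} (hh : 0 < G.h) (hc₀ : 0 < c₀)
    (hχ : ∀ l x, 0 ≤ G.χ l x) (hc : ∀ x, c₀ ≤ G.c x) (f : SB d) : ∃ v : SB d, G.op v + f = 0 := by
  obtain ⟨X, hX⟩ := SB.exists_bound (∑ l, (G.h⁻¹) ^ 2 • G.χ l + G.c)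
  have hX0 : 0 < |X| + 1 + c₀ := by positivity
  set s := (|X| + 1 + c₀)⁻¹ with hs
  have hs0 : 0 < s := by positivity
  have hsc : s * c₀ ≤ 1 := by
    rw [hs, inv_mul_le_iff₀ hX0]; linarith [abs_nonneg X]
  obtain ⟨v, hv⟩ := exists_fixed (ρ := 1 - s * c₀)
    (a := fun i : Option G.L => i.elim (1 - s • (∑ l, (G.h⁻¹) ^ 2 • G.χ l + G.c))
      (fun l => (s * (G.h⁻¹) ^ 2) • G.χ l))
    (y := fun i : Option G.L => i.elim 0 (fun l => G.h • (l : E d))) (s • f)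
    (by linarith) (by nlinarith) (by
      rintro (_ | l) x
      · have h1 := (abs_le.1 (hX x)).2
        have h2 : s * (∑ l, (G.h⁻¹) ^ 2 • G.χ l + G.c : SB d) x ≤ 1 := by
          rw [hs, inv_mul_le_iff₀ hX0]; linarith [le_abs_self X]
        simp only [Option.elim, SB.sub_apply, SB.one_apply, SB.smul_apply]
        linarith
      · exact mul_nonneg (by positivity) (hχ l x)) (by
      intro x
      rw [Fintype.sum_option]
      simp only [Option.elim, SB.sub_apply, SB.one_apply, SB.smul_apply, SB.add_apply, SB.sum_apply,
        mul_assoc, ← Finset.mul_sum]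
      nlinarith [hc x])
  refine ⟨v, ?_⟩
  ext x
  have h1 := congrArg (fun φ : SB d => φ x) hv
  rw [Fintype.sum_option] at h1
  simp only [Option.elim, SB.sub_apply, SB.one_apply, SB.smul_apply, SB.add_apply, SB.sum_apply,
    SB.mul_apply, SB.tr_apply, add_zero] at h1
  simp only [op, quot, SB.sub_apply, SB.sum_apply, SB.mul_apply, SB.smul_apply, SB.fd_apply,
    SB.add_apply, SB.zero_apply]
  have h2 : s * (∑ l, G.χ l x * (G.h⁻¹ * (G.h⁻¹ * (v (x + G.h • (l : E d)) - v x))) -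
      G.c x * v x + f x) = 0 := by
    have e : ∑ l, G.χ l x * (G.h⁻¹ * (G.h⁻¹ * (v (x + G.h • (l : E d)) - v x))) =
        ∑ l : G.L, G.h⁻¹ ^ 2 * G.χ l x * v (x + G.h • (l : E d)) -
        (∑ l : G.L, G.h⁻¹ ^ 2 * G.χ l x) * v x := by
      rw [Finset.sum_mul, ← Finset.sum_sub_distrib]
      exact Finset.sum_congr rfl fun l _ => by ring
    rw [e]
    simp only [mul_assoc, ← Finset.mul_sum] at h1 ⊢
    linarith
  exact (mul_eq_zero.1 h2).resolve_left hs0.ne'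

/-! ### Words and multi-indices -/

/-- Iterated partial derivatives of a function along a word. -/
def fiter : List (Fin d) → (E d → ℝ) → E d → ℝ
  | [], φ => φ
  | i :: w, φ => fiter w (pderiv i φ)

lemma fiter_append (u w : List (Fin d)) (φ : E d → ℝ) :
    fiter (u ++ w) φ = fiter w (fiter u φ) := by
  induction u generalizing φ with
  | nil => rfl
  | cons i u ih => exact ih _

lemma fiter_replicate (n : ℕ) (i : Fin d) (φ : E d → ℝ) :
    fiter (List.replicate n i) φ = (pderiv i)^[n] φ := by
  induction n generalizing φ with
  | zero => rfl
  | succ n ih => rw [List.replicate_succ, Function.iterate_succ_apply, fiter, ih]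

lemma fiter_coe (w : List (Fin d)) (φ : SB d) : fiter w φ = iter SB.D w φ := by
  induction w generalizing φ with
  | nil => rfl
  | cons i w ih => exact ih (SB.D i φ)

/-- The word listing the indices in `l` with the multiplicities given by `α`. -/
def wordAux (α : Fin d → ℕ) (l : List (Fin d)) : List (Fin d) :=
  l.foldr (fun i w => w ++ List.replicate (α i) i) []

/-- The standard word of a multi-index. -/
def word (α : Fin d → ℕ) : List (Fin d) := wordAux α (List.finRange d)

lemma mderiv_eq_fiter (α : Fin d → ℕ) (φ : E d → ℝ) : mderiv α φ = fiter (word α) φ := by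
  unfold mderiv word
  induction List.finRange d with
  | nil => rfl
  | cons i l ih =>
    rw [List.foldr_cons, ih]
    exact ((fiter_append _ _ _).trans (fiter_replicate _ _ _)).symm

lemma count_wordAux (α : Fin d → ℕ) (l : List (Fin d)) (hl : l.Nodup) (j : Fin d) :
    (wordAux α l).count j = if j ∈ l then α j else 0 := by
  induction l with
  | nil => rfl
  | cons i l ih =>
    rw [List.nodup_cons] at hl
    rw [wordAux, List.foldr_cons, List.count_append, List.count_replicate]
    change (wordAux α l).count j + _ = _
    rw [ih hl.2]
    by_cases h : i = j
    · subst h; simp [hl.1]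
    · simp [h, Ne.symm h]

lemma count_word (α : Fin d → ℕ) (j : Fin d) : (word α).count j = α j := by
  rw [word, count_wordAux α _ (List.nodup_finRange d)]
  simp

lemma length_word (α : Fin d → ℕ) : (word α).length = ∑ i, α i := by
  rw [← Multiset.coe_card, ← Multiset.sum_count_eq_card (s := Finset.univ)
    (fun _ _ => Finset.mem_univ _)]
  simp [count_word]

lemma perm_word {α : Fin d → ℕ} {w : List (Fin d)} (h : ∀ j, w.count j = α j) :
    List.Perm w (word α) :=
  List.perm_iff_count.2 fun j => by rw [h, count_word]

lemma iter_perm {ι : Type} {B : ι → SB d →ₗ[ℝ] SB d} (hB : ∀ a b φ, B a (B b φ) = B b (B a φ))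
    {u w : List ι} (h : List.Perm u w) (φ : SB d) : iter B u φ = iter B w φ := by
  induction h generalizing φ with
  | nil => rfl
  | cons a _ ih => exact ih _
  | swap a b l => rw [iter_cons, iter_cons, iter_cons, iter_cons, hB]
  | trans _ _ ih1 ih2 => rw [ih1, ih2]

lemma mderiv_coe (α : Fin d → ℕ) (φ : SB d) : mderiv α φ = iter SB.D (word α) φ := by
  rw [mderiv_eq_fiter, fiter_coe]

lemma mderiv_eq_of_count {α : Fin d → ℕ} {w : List (Fin d)} (h : ∀ j, w.count j = α j)
    (φ : SB d) : mderiv α φ = iter SB.D w φ := by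
  rw [mderiv_coe, iter_perm SB.D_comm (perm_word h)]

lemma mderiv_unitIndex (i : Fin d) (φ : SB d) : mderiv (unitIndex i) φ = SB.D i φ := by
  rw [mderiv_eq_of_count (w := [i])]
  · rfl
  · intro j
    by_cases h : i = j
    · subst h; simp [unitIndex]
    · simp [unitIndex, h, Ne.symm h]

lemma mderiv_add (α β : Fin d → ℕ) (φ : SB d) :
    mderiv (α + β) φ = iter SB.D (word α) (iter SB.D (word β) φ) := by
  rw [mderiv_eq_of_count (w := word β ++ word α), iter_append]
  intro j
  simp [count_word, add_comm]

lemma sum_unitIndex (i : Fin d) : ∑ j, unitIndex i j = 1 := by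
  simp [unitIndex]

/-! ### Test functions -/

/-- The Fréchet derivative is the sum of the partial derivatives times the coordinate functionals,
so bounds on iterated partial derivatives pass to `iteratedFDeriv` by induction on the order. -/
lemma smoothBdd_of_fiter {φ : E d → ℝ} (h1 : ContDiff ℝ ∞ φ)
    (h2 : ∀ w, ∃ C : ℝ, ∀ x, |fiter w φ x| ≤ C) : SmoothBdd φ := by
  refine ⟨h1, fun k => ?_⟩
  induction k generalizing φ with
  | zero =>
    obtain ⟨C, hC⟩ := h2 []
    exact ⟨C, fun x => by simpa [fiter] using hC x⟩
  | succ k ih =>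
    have h3 : ∀ i, ContDiff ℝ ∞ (pderiv i φ) := fun i =>
      (h1.fderiv_right (m := ∞) (by simp)).clm_apply contDiff_const
    choose C hC using fun i => ih (h3 i) fun w => h2 (i :: w)
    let P : Fin d → E d →L[ℝ] ℝ := fun i => EuclideanSpace.proj i
    let Lc : Fin d → ℝ →L[ℝ] (E d →L[ℝ] ℝ) := fun i => ContinuousLinearMap.toSpanSingleton ℝ (P i)
    have e : fderiv ℝ φ = fun x => ∑ i, (Lc i ∘ pderiv i φ) x := by
      ext x y
      conv_lhs => rw [← (EuclideanSpace.basisFun (Fin d) ℝ).sum_repr y, map_sum]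
      simp [Lc, P, pderiv, mul_comm]
    refine ⟨∑ i, ‖Lc i‖ * C i, fun x => ?_⟩
    rw [← norm_iteratedFDeriv_fderiv, e, iteratedFDeriv_fun_sum_apply (fun i _ =>
      (((Lc i).contDiff.comp (h3 i)).of_le (mod_cast le_top)).contDiffAt)]
    refine (norm_sum_le _ _).trans (Finset.sum_le_sum fun i _ => ?_)
    refine ((Lc i).norm_iteratedFDeriv_comp_left (h3 i).contDiffAt (mod_cast le_top)).trans ?_
    exact mul_le_mul_of_nonneg_left (hC i x) (norm_nonneg _)

/-- Smooth functions with compact support. -/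
def IsTest (g : E d → ℝ) : Prop := ContDiff ℝ ∞ g ∧ HasCompactSupport g

lemma IsTest.pderiv {g : E d → ℝ} (hg : IsTest g) (i : Fin d) : IsTest (pderiv i g) :=
  ⟨(hg.1.fderiv_right (m := ∞) (by simp)).clm_apply contDiff_const,
    hg.2.fderiv_apply ℝ _⟩

lemma IsTest.fiter {g : E d → ℝ} (hg : IsTest g) (w : List (Fin d)) : IsTest (fiter w g) := by
  induction w generalizing g with
  | nil => exact hg
  | cons i w ih => exact ih (hg.pderiv i)

lemma IsTest.exists_bound {g : E d → ℝ} (hg : IsTest g) : ∃ C : ℝ, ∀ x, |g x| ≤ C :=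
  hg.2.exists_bound_of_continuous hg.1.continuous

lemma IsTest.smoothBdd {g : E d → ℝ} (hg : IsTest g) : SmoothBdd g :=
  smoothBdd_of_fiter hg.1 fun w => (hg.fiter w).exists_bound

lemma IsTest.integrable {g : E d → ℝ} (hg : IsTest g) : Integrable g :=
  hg.1.continuous.integrable_of_hasCompactSupport hg.2

lemma IsTest.reflect {g : E d → ℝ} (hg : IsTest g) (x : E d) : IsTest (fun t => g (x - t)) := by
  refine ⟨hg.1.comp (contDiff_const.sub contDiff_id), ?_⟩
  exact hg.2.comp_homeomorph (Homeomorph.subLeft x)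

lemma IsTest.comp_add {g : E d → ℝ} (hg : IsTest g) (y : E d) : IsTest (fun t => g (t + y)) :=
  ⟨hg.1.comp (contDiff_id.add contDiff_const), hg.2.comp_homeomorph (Homeomorph.addRight y)⟩

lemma fiter_comp_add (w : List (Fin d)) (g : E d → ℝ) (y : E d) :
    fiter w (fun t => g (t + y)) = fun t => fiter w g (t + y) := by
  induction w generalizing g with
  | nil => rfl
  | cons i w ih =>
    have e : pderiv i (fun t => g (t + y)) = fun t => pderiv i g (t + y) := by
      ext t; simp only [pderiv, fderiv_comp_add_right]
    rw [fiter, e, ih]; rfl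

lemma fiter_smul {g : E d → ℝ} (hg : IsTest g) (w : List (Fin d)) (c : ℝ) :
    fiter w (fun t => c * g t) = fun t => c * fiter w g t := by
  have h1 := fiter_coe w (c • (⟨g, hg.smoothBdd⟩ : SB d))
  rw [map_smul] at h1
  have h2 := fiter_coe w (⟨g, hg.smoothBdd⟩ : SB d)
  ext t
  have h3 := congrFun h1 t
  rw [SB.smul_apply, ← h2] at h3
  exact h3

lemma fiter_reflect {g : E d → ℝ} (hg : IsTest g) (w : List (Fin d)) (x : E d) :
    fiter w (fun t => g (x - t)) = fun t => (-1) ^ w.length * fiter w g (x - t) := by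
  induction w generalizing g with
  | nil => ext t; simp [fiter]
  | cons i w ih =>
    have e : pderiv i (fun t => g (x - t)) = fun t => (-1 : ℝ) * pderiv i g (x - t) := by
      ext t
      have h1 : HasFDerivAt (fun t => g (x - t))
          (fderiv ℝ g (x - t) ∘L (-ContinuousLinearMap.id ℝ (E d))) t :=
        ((hg.1.differentiable (by simp)) (x - t)).hasFDerivAt.comp t
          ((hasFDerivAt_id t).const_sub x)
      simp [pderiv, h1.fderiv]
    rw [fiter, e, fiter_smul ((hg.pderiv i).reflect x), ih (hg.pderiv i)]
    ext t
    rw [List.length_cons, pow_succ, fiter]; ring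

/-! ### Mollification -/

/-- The convolution of `ψ` with the kernel `g`. -/
def moll (g ψ : E d → ℝ) (x : E d) : ℝ := ∫ t, ψ t * g (x - t)

lemma moll_eq_convolution (g ψ : E d → ℝ) :
    moll g ψ = convolution ψ g (ContinuousLinearMap.mul ℝ ℝ) volume := rfl

lemma pderiv_moll {g ψ : E d → ℝ} (hg : IsTest g) (hψ : LocallyIntegrable ψ) (i : Fin d) :
    pderiv i (moll g ψ) = moll (pderiv i g) ψ := by
  ext x
  have h1 := hg.2.hasFDerivAt_convolution_right (ContinuousLinearMap.mul ℝ ℝ) hψ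
    (hg.1.of_le (mod_cast le_top)) x
  rw [pderiv, moll_eq_convolution, h1.fderiv,
    convolution_precompR_apply _ hψ (hg.2.fderiv ℝ) (hg.1.continuous_fderiv (by simp))]
  rfl

lemma contDiff_moll {g ψ : E d → ℝ} (hg : IsTest g) (hψ : LocallyIntegrable ψ) :
    ContDiff ℝ ∞ (moll g ψ) :=
  hg.2.contDiff_convolution_right (n := ⊤) (ContinuousLinearMap.mul ℝ ℝ) hψ hg.1

lemma fiter_moll {g ψ : E d → ℝ} (hg : IsTest g) (hψ : LocallyIntegrable ψ) (w : List (Fin d)) :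
    fiter w (moll g ψ) = moll (fiter w g) ψ := by
  induction w generalizing g with
  | nil => rfl
  | cons i w ih => rw [fiter, pderiv_moll hg hψ, ih (hg.pderiv i)]; rfl

lemma BddBorel.locallyIntegrable {ψ : E d → ℝ} (hψ : BddBorel ψ) : LocallyIntegrable ψ := by
  obtain ⟨hm, C, hC⟩ := hψ
  exact (locallyIntegrable_const C).mono hm.aestronglyMeasurable
    (Filter.Eventually.of_forall fun x => (hC x).trans (le_abs_self C))

lemma BddBorel.mul_integrable {ψ g : E d → ℝ} (hψ : BddBorel ψ) (hg : Integrable g) :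
    Integrable (fun t => ψ t * g t) := by
  obtain ⟨hm, C, hC⟩ := hψ
  exact hg.bdd_mul hm.aestronglyMeasurable (Filter.Eventually.of_forall hC)

lemma integrable_moll {ψ g : E d → ℝ} (hψ : BddBorel ψ) (hg : IsTest g) (x : E d) :
    Integrable (fun t => ψ t * g (x - t)) :=
  hψ.mul_integrable (hg.reflect x).integrable

lemma integral_abs_reflect (g : E d → ℝ) (x : E d) : ∫ t, |g (x - t)| = ∫ t, |g t| :=
  integral_sub_left_eq_self (fun t => |g t|) volume x

lemma abs_moll_le {ψ g : E d → ℝ} (hg : IsTest g) (C : ℝ) (hC : ∀ᵐ x, |ψ x| ≤ C) (x : E d) :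
    |moll g ψ x| ≤ C * ∫ t, |g t| := by
  rw [← integral_abs_reflect g x, ← integral_const_mul]
  rw [← Real.norm_eq_abs]
  refine norm_integral_le_of_norm_le (f := fun t => ψ t * g (x - t))
    ((hg.reflect x).integrable.abs.const_mul C) ?_
  filter_upwards [hC] with t ht
  rw [norm_mul, Real.norm_eq_abs, Real.norm_eq_abs]
  exact mul_le_mul_of_nonneg_right ht (abs_nonneg _)

lemma smoothBdd_moll {g ψ : E d → ℝ} (hg : IsTest g) (hψ : BddBorel ψ) : SmoothBdd (moll g ψ) := by
  refine smoothBdd_of_fiter (contDiff_moll hg hψ.locallyIntegrable) fun w => ?_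
  obtain ⟨C, hC⟩ := hψ.2
  rw [fiter_moll hg hψ.locallyIntegrable]
  exact ⟨_, abs_moll_le (hg.fiter w) C (Filter.Eventually.of_forall hC)⟩

/-- The defining identity is tested with the reflected kernel `t ↦ g (x - t)`, whose derivatives
carry the sign that cancels `(-1)^|α|`. No boundedness of `w` is assumed, so that the statement
applies to weak limits whose boundedness is not yet known. -/
lemma moll_weak {g ψ w : E d → ℝ} (hg : IsTest g) (hψ : LocallyIntegrable ψ) {α : Fin d → ℕ}
    (h : ∀ φ : E d → ℝ, ContDiff ℝ ∞ φ → HasCompactSupport φ →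
      ∫ x, ψ x * mderiv α φ x = (-1 : ℝ) ^ (∑ i, α i) * ∫ x, w x * φ x) :
    mderiv α (moll g ψ) = moll g w := by
  ext x
  have h1 := h _ (hg.reflect x).1 (hg.reflect x).2
  rw [mderiv_eq_fiter, fiter_moll hg hψ, moll, moll]
  rw [mderiv_eq_fiter, fiter_reflect hg, length_word] at h1
  have e : ∀ t, ψ t * ((-1 : ℝ) ^ (∑ i, α i) * fiter (word α) g (x - t)) =
      (-1 : ℝ) ^ (∑ i, α i) * (ψ t * fiter (word α) g (x - t)) := fun t => by ring
  simp only [e] at h1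
  rw [integral_const_mul] at h1
  exact mul_left_cancel₀ (pow_ne_zero _ (by norm_num)) h1

lemma mderiv_moll {g ψ w : E d → ℝ} (hg : IsTest g) (hψ : BddBorel ψ) {α : Fin d → ℕ}
    (h : IsGenDeriv α ψ w) : mderiv α (moll g ψ) = moll g w :=
  moll_weak hg hψ.locallyIntegrable h.2

/-! ### Bounded Borel functions and generalized derivatives -/

namespace BddBorel

variable {φ ψ : E d → ℝ}

lemma const (c : ℝ) : BddBorel (fun _ : E d => c) := ⟨measurable_const, |c|, fun _ => le_rfl⟩

lemma add (hφ : BddBorel φ) (hψ : BddBorel ψ) : BddBorel (fun x => φ x + ψ x) := by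
  obtain ⟨h1, C, hC⟩ := hφ
  obtain ⟨h2, C', hC'⟩ := hψ
  exact ⟨h1.add h2, C + C', fun x => (abs_add_le _ _).trans (add_le_add (hC x) (hC' x))⟩

lemma mul (hφ : BddBorel φ) (hψ : BddBorel ψ) : BddBorel (fun x => φ x * ψ x) := by
  obtain ⟨h1, C, hC⟩ := hφ
  obtain ⟨h2, C', hC'⟩ := hψ
  refine ⟨h1.mul h2, C * C', fun x => ?_⟩
  rw [abs_mul]
  exact mul_le_mul (hC x) (hC' x) (abs_nonneg _) ((abs_nonneg _).trans (hC x))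

lemma const_mul (hφ : BddBorel φ) (c : ℝ) : BddBorel (fun x => c * φ x) := (const c).mul hφ

lemma sub (hφ : BddBorel φ) (hψ : BddBorel ψ) : BddBorel (fun x => φ x - ψ x) := by
  simpa [sub_eq_add_neg] using hφ.add (hψ.const_mul (-1))

lemma sum {ι : Type*} {s : Finset ι} {F : ι → E d → ℝ} (h : ∀ i ∈ s, BddBorel (F i)) :
    BddBorel (fun x => ∑ i ∈ s, F i x) := by
  classical
  induction s using Finset.induction_on with
  | empty => simpa using const 0
  | insert a s ha ih =>
    simp only [Finset.sum_insert ha]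
    exact (h a (Finset.mem_insert_self a s)).add
      (ih fun i hi => h i (Finset.mem_insert_of_mem hi))

lemma comp_add (hφ : BddBorel φ) (y : E d) : BddBorel (fun x => φ (x + y)) := by
  obtain ⟨h1, C, hC⟩ := hφ
  exact ⟨h1.comp (measurable_add_const y), C, fun x => hC _⟩

lemma fdiff (hφ : BddBorel φ) (h : ℝ) (l : E d) : BddBorel (fdiff h l φ) := by
  have := ((hφ.comp_add (h • l)).sub hφ).const_mul h⁻¹
  refine (congrArg BddBorel ?_).mp this
  ext x
  rw [DegenScheme.fdiff, div_eq_inv_mul]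

end BddBorel

lemma SB.bddBorel (φ : SB d) : BddBorel φ := ⟨(SB.continuous φ).measurable, SB.exists_bound φ⟩

lemma MemB.bddBorel {m : ℕ} {ψ : E d → ℝ} (h : MemB m ψ) : BddBorel ψ := ⟨h.1.measurable, h.2.1⟩

lemma isGenDeriv_genDeriv {α : Fin d → ℕ} {ψ : E d → ℝ} (h : ∃ w, IsGenDeriv α ψ w) :
    IsGenDeriv α ψ (genDeriv α ψ) := by
  rw [genDeriv, dif_pos h]
  exact h.choose_spec

lemma MemB.genDeriv {m : ℕ} {ψ : E d → ℝ} (h : MemB m ψ) {α : Fin d → ℕ} (hα : ∑ i, α i ≤ m) :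
    IsGenDeriv α ψ (genDeriv α ψ) := isGenDeriv_genDeriv (h.2.2 α hα)

lemma IsTest.mderiv {φ : E d → ℝ} (h : IsTest φ) (α : Fin d → ℕ) : IsTest (mderiv α φ) := by
  rw [mderiv_eq_fiter]; exact h.fiter _

lemma IsGenDeriv.integral_eq {α : Fin d → ℕ} {ψ w : E d → ℝ} (h : IsGenDeriv α ψ w)
    {φ : E d → ℝ} (hφ : IsTest φ) :
    ∫ x, ψ x * mderiv α φ x = (-1 : ℝ) ^ (∑ i, α i) * ∫ x, w x * φ x := h.2 φ hφ.1 hφ.2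

lemma mderiv_comp_add (α : Fin d → ℕ) (φ : E d → ℝ) (y : E d) :
    mderiv α (fun t => φ (t + y)) = fun t => mderiv α φ (t + y) := by
  rw [mderiv_eq_fiter, mderiv_eq_fiter, fiter_comp_add]

lemma IsGenDeriv.comp_add {α : Fin d → ℕ} {ψ w : E d → ℝ} (h : IsGenDeriv α ψ w) (y : E d) :
    IsGenDeriv α (fun x => ψ (x + y)) (fun x => w (x + y)) := by
  refine ⟨h.1.comp_add y, fun φ hφ hφ' => ?_⟩
  have hφy : IsTest (fun t => φ (t + -y)) := IsTest.comp_add ⟨hφ, hφ'⟩ (-y)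
  have h1 := h.integral_eq hφy
  rw [mderiv_comp_add] at h1
  rw [← integral_add_right_eq_self (fun x => ψ x * _) y,
    ← integral_add_right_eq_self (fun x => w x * _) y] at h1
  simpa only [add_neg_cancel_right] using h1

lemma IsGenDeriv.const_mul {α : Fin d → ℕ} {ψ w : E d → ℝ} (h : IsGenDeriv α ψ w) (c : ℝ) :
    IsGenDeriv α (fun x => c * ψ x) (fun x => c * w x) := by
  refine ⟨h.1.const_mul c, fun φ hφ hφ' => ?_⟩
  simp only [mul_assoc, integral_const_mul]
  rw [h.integral_eq ⟨hφ, hφ'⟩]; ring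

lemma IsGenDeriv.sub {α : Fin d → ℕ} {ψ w ψ' w' : E d → ℝ} (h : IsGenDeriv α ψ w)
    (h' : IsGenDeriv α ψ' w') (hψ : BddBorel ψ) (hψ' : BddBorel ψ') :
    IsGenDeriv α (fun x => ψ x - ψ' x) (fun x => w x - w' x) := by
  refine ⟨h.1.sub h'.1, fun φ hφ hφ' => ?_⟩
  have ht : IsTest φ := ⟨hφ, hφ'⟩
  simp only [sub_mul]
  rw [integral_sub (hψ.mul_integrable (ht.mderiv α).integrable)
    (hψ'.mul_integrable (ht.mderiv α).integrable),
    integral_sub (h.1.mul_integrable ht.integrable) (h'.1.mul_integrable ht.integrable),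
    h.integral_eq ht, h'.integral_eq ht]
  ring

lemma IsGenDeriv.fdiff {α : Fin d → ℕ} {ψ w : E d → ℝ} (h : IsGenDeriv α ψ w) (hψ : BddBorel ψ)
    (s : ℝ) (l : E d) : IsGenDeriv α (fdiff s l ψ) (fdiff s l w) := by
  have := ((h.comp_add (s • l)).sub h (hψ.comp_add _) hψ).const_mul s⁻¹
  simp only [← div_eq_inv_mul] at this
  exact this

/-- Obtained by testing `D^α ψ` against `D_i φ`. It gives meaning to two successive operators `δ̄`
on a coefficient, since the inner derivative is only a bounded Borel function. -/
lemma IsGenDeriv.of_add {α : Fin d → ℕ} {i : Fin d} {ψ w w' : E d → ℝ} (h : IsGenDeriv α ψ w)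
    (h' : IsGenDeriv (α + unitIndex i) ψ w') : IsGenDeriv (unitIndex i) w w' := by
  refine ⟨h'.1, fun φ hφ hφ' => ?_⟩
  have ht : IsTest φ := ⟨hφ, hφ'⟩
  let Φ : SB d := ⟨φ, ht.smoothBdd⟩
  have h1 := h.integral_eq (ht.mderiv (unitIndex i))
  have h2 := h'.integral_eq ht
  have e1 : mderiv (unitIndex i) φ = SB.D i Φ := mderiv_unitIndex i Φ
  have e2 : mderiv α (mderiv (unitIndex i) φ) = mderiv (α + unitIndex i) φ := by
    rw [e1, mderiv_coe]
    refine Eq.trans ?_ (mderiv_add α (unitIndex i) Φ).symm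
    rw [← mderiv_coe, ← mderiv_coe]
    congr 1
    rw [← mderiv_unitIndex, mderiv_coe]
  rw [e2, h2] at h1
  simp only [Pi.add_apply, Finset.sum_add_distrib, pow_add] at h1
  rw [mul_assoc] at h1
  exact (mul_left_cancel₀ (pow_ne_zero _ (by norm_num)) h1).symm

/-! ### Mollification with nonnegative kernels -/

/-- A smooth nonnegative kernel with integral `1`, supported in the ball of radius `ε`. -/
structure IsKernel (ε : ℝ) (g : E d → ℝ) : Prop where
  test : IsTest g
  nonneg : ∀ x, 0 ≤ g x
  integral : ∫ x, g x = 1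
  support : ∀ x, ε ≤ ‖x‖ → g x = 0

section Kernel

variable {ε : ℝ} {g : E d → ℝ}

lemma moll_add (hg : IsTest g) {φ ψ : E d → ℝ} (hφ : BddBorel φ) (hψ : BddBorel ψ) (x : E d) :
    moll g (fun z => φ z + ψ z) x = moll g φ x + moll g ψ x := by
  simp only [moll, add_mul]
  exact integral_add (integrable_moll hφ hg x) (integrable_moll hψ hg x)

lemma moll_sub (hg : IsTest g) {φ ψ : E d → ℝ} (hφ : BddBorel φ) (hψ : BddBorel ψ) (x : E d) :
    moll g (fun z => φ z - ψ z) x = moll g φ x - moll g ψ x := by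
  simp only [moll, sub_mul]
  exact integral_sub (integrable_moll hφ hg x) (integrable_moll hψ hg x)

lemma moll_const_mul (g : E d → ℝ) (c : ℝ) (ψ : E d → ℝ) (x : E d) :
    moll g (fun z => c * ψ z) x = c * moll g ψ x := by
  simp only [moll, mul_assoc, integral_const_mul]

lemma moll_mul_const (g : E d → ℝ) (c : ℝ) (ψ : E d → ℝ) (x : E d) :
    moll g (fun z => ψ z * c) x = moll g ψ x * c := by
  simp only [mul_comm _ c, moll_const_mul]

lemma moll_sum {ι : Type*} (s : Finset ι) (hg : IsTest g) {F : ι → E d → ℝ}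
    (h : ∀ i ∈ s, BddBorel (F i)) (x : E d) :
    moll g (fun z => ∑ i ∈ s, F i z) x = ∑ i ∈ s, moll g (F i) x := by
  simp only [moll, Finset.sum_mul]
  exact integral_finsetSum s fun i hi => integrable_moll (h i hi) hg x

lemma integral_reflect (g : E d → ℝ) (x : E d) : ∫ t, g (x - t) = ∫ t, g t :=
  integral_sub_left_eq_self g volume x

lemma moll_const (hg : IsKernel ε g) (c : ℝ) (x : E d) : moll g (fun _ => c) x = c := by
  rw [moll, integral_const_mul, integral_reflect, hg.integral, mul_one]

lemma moll_mono (hg : IsKernel ε g) {φ ψ : E d → ℝ} (hφ : BddBorel φ) (hψ : BddBorel ψ)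
    (h : ∀ᵐ z, φ z ≤ ψ z) (x : E d) : moll g φ x ≤ moll g ψ x := by
  refine integral_mono_ae (integrable_moll hφ hg.test x) (integrable_moll hψ hg.test x) ?_
  filter_upwards [h] with z hz
  exact mul_le_mul_of_nonneg_right hz (hg.nonneg _)

lemma moll_congr {φ ψ : E d → ℝ} (h : ∀ᵐ z, φ z = ψ z) (x : E d) : moll g φ x = moll g ψ x := by
  refine integral_congr_ae ?_
  filter_upwards [h] with z hz
  rw [hz]

lemma moll_comp_add (g ψ : E d → ℝ) (y x : E d) :
    moll g (fun z => ψ (z + y)) x = moll g ψ (x + y) := by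
  rw [moll, moll, ← integral_add_right_eq_self (fun t => ψ t * g (x + y - t)) y]
  simp only [add_sub_add_right_eq_sub]

lemma moll_fdiff (hg : IsTest g) {ψ : E d → ℝ} (hψ : BddBorel ψ) (h : ℝ) (l : E d) (x : E d) :
    moll g (fdiff h l ψ) x = fdiff h l (moll g ψ) x := by
  have e : fdiff h l ψ = fun z => h⁻¹ * (ψ (z + h • l) - ψ z) := by
    ext z; rw [fdiff, div_eq_inv_mul]
  rw [e, moll_const_mul, moll_sub hg (hψ.comp_add _) hψ, moll_comp_add, fdiff, div_eq_inv_mul]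

/-- The square sum of mollified functions is bounded by the essential bound of the square sum. -/
lemma sum_sq_moll_le {ι : Type*} (s : Finset ι) (hg : IsKernel ε g) {F : ι → E d → ℝ}
    (h : ∀ i ∈ s, BddBorel (F i)) (C : ℝ) (hC : ∀ᵐ z, ∑ i ∈ s, F i z ^ 2 ≤ C) (x : E d) :
    ∑ i ∈ s, moll g (F i) x ^ 2 ≤ C := by
  -- The linear combination with coefficients frozen at `x` is mollified; the elementary inequality
  -- `2ab ≤ a² + b²` then gives the bound without loss in the number of functions.
  have h1 : moll g (fun z => ∑ i ∈ s, moll g (F i) x * F i z) x ≤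
      moll g (fun _ => (∑ i ∈ s, moll g (F i) x ^ 2 + C) / 2) x := by
    refine moll_mono hg (BddBorel.sum fun i hi => (h i hi).const_mul _) (BddBorel.const _) ?_ x
    filter_upwards [hC] with z hz
    have : ∑ i ∈ s, moll g (F i) x * F i z ≤ ∑ i ∈ s, (moll g (F i) x ^ 2 + F i z ^ 2) / 2 :=
      Finset.sum_le_sum fun i _ => by nlinarith [sq_nonneg (moll g (F i) x - F i z)]
    rw [← Finset.sum_div, Finset.sum_add_distrib] at this
    linarith
  rw [moll_const hg, moll_sum s hg.test fun i hi => (h i hi).const_mul _] at h1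
  simp only [moll_const_mul, ← sq] at h1
  linarith

open Classical in
/-- Mollification with values in the algebra of smooth functions. -/
def mollSB (g ψ : E d → ℝ) : SB d :=
  if h : SmoothBdd (moll g ψ) then ⟨moll g ψ, h⟩ else 0

lemma mollSB_coe (hg : IsTest g) {ψ : E d → ℝ} (hψ : BddBorel ψ) :
    (mollSB g ψ : E d → ℝ) = moll g ψ := by
  rw [mollSB, dif_pos (smoothBdd_moll hg hψ)]

/-- Bounded Borel functions with bounded generalized first derivatives. -/
def HasGrad (ψ : E d → ℝ) : Prop := BddBorel ψ ∧ ∀ i, ∃ w, IsGenDeriv (unitIndex i) ψ w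

lemma D_mollSB (hg : IsTest g) {ψ w : E d → ℝ} (hψ : BddBorel ψ) {i : Fin d}
    (h : IsGenDeriv (unitIndex i) ψ w) : (SB.D i (mollSB g ψ) : E d → ℝ) = moll g w := by
  rw [← mderiv_unitIndex, mollSB_coe hg hψ, mderiv_moll hg hψ h]

variable (S : Data d) (τ₀ h : ℝ)

lemma bddBorel_dbarCoef {ψ : E d → ℝ} (hψ : HasGrad ψ) (a : S.Λ) :
    BddBorel (S.dbarCoef τ₀ h a ψ) := by
  rcases a with l | i
  · exact (hψ.1.fdiff h l).const_mul _
  · exact (isGenDeriv_genDeriv (hψ.2 i)).1.const_mul _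

lemma Bop_mollSB (hg : IsTest g) {ψ : E d → ℝ} (hψ : HasGrad ψ) (a : S.Λ) :
    (Bop S.Λ₁ S.τ τ₀ h a (mollSB g ψ) : E d → ℝ) = moll g (S.dbarCoef τ₀ h a ψ) := by
  ext x
  rcases a with l | i
  · rw [Bop_inl, SB.smul_apply, SB.fd_coe, mollSB_coe hg hψ.1, ← moll_fdiff hg hψ.1,
      ← moll_const_mul]; rfl
  · rw [Bop_inr, SB.smul_apply, D_mollSB hg hψ.1 (isGenDeriv_genDeriv (hψ.2 i)),
      ← moll_const_mul]; rfl

lemma MemB.hasGrad {m : ℕ} {ψ : E d → ℝ} (hψ : MemB m ψ) (hm : 1 ≤ m) : HasGrad ψ :=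
  ⟨hψ.bddBorel, fun i => hψ.2.2 _ (by rw [sum_unitIndex]; exact hm)⟩

lemma MemB.hasGrad_genDeriv {m : ℕ} {ψ : E d → ℝ} (hψ : MemB m ψ) (hm : 2 ≤ m) (i : Fin d) :
    HasGrad (DegenScheme.genDeriv (unitIndex i) ψ) := by
  have h1 := hψ.genDeriv (α := unitIndex i) (by rw [sum_unitIndex]; omega)
  refine ⟨h1.1, fun j => ?_⟩
  obtain ⟨w, hw⟩ := hψ.2.2 (unitIndex i + unitIndex j)
    (by simp only [Pi.add_apply, Finset.sum_add_distrib, sum_unitIndex]; omega)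
  exact ⟨w, h1.of_add hw⟩

lemma hasGrad_dbarCoef {m : ℕ} {ψ : E d → ℝ} (hψ : MemB m ψ) (hm : 2 ≤ m) (a : S.Λ) :
    HasGrad (S.dbarCoef τ₀ h a ψ) := by
  refine ⟨bddBorel_dbarCoef S τ₀ h (hψ.hasGrad (by omega)) a, fun j => ?_⟩
  rcases a with l | i
  · obtain ⟨w, hw⟩ := (hψ.hasGrad (by omega)).2 j
    exact ⟨_, (hw.fdiff hψ.bddBorel h l).const_mul _⟩
  · obtain ⟨w, hw⟩ := (hψ.hasGrad_genDeriv hm i).2 j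
    exact ⟨_, hw.const_mul _⟩

lemma Bop_mollSB_eq (hg : IsTest g) {ψ : E d → ℝ} (hψ : HasGrad ψ) (a : S.Λ) :
    Bop S.Λ₁ S.τ τ₀ h a (mollSB g ψ) = mollSB g (S.dbarCoef τ₀ h a ψ) := by
  ext x
  rw [Bop_mollSB S τ₀ h hg hψ, mollSB_coe hg (bddBorel_dbarCoef S τ₀ h hψ a)]

end Kernel

/-! ### Mollification of inequalities -/

/-- `H'` is obtained from `H` by mollifying the coefficients, i.e. the first variable. -/
structure MollRel (g : E d → ℝ) (H : E d → E d → ℝ) (H' : E d → ℝ) : Prop where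
  meas : ∀ x, BddBorel (fun z => H z x)
  cont : ∀ z, Continuous (H z)
  eq : ∀ x, moll g (fun z => H z x) x = H' x

namespace MollRel

variable {ε : ℝ} {g : E d → ℝ}

lemma coef {k : E d → ℝ} (hk : BddBorel k) : MollRel g (fun z _ => k z) (moll g k) :=
  ⟨fun _ => hk, fun _ => continuous_const, fun _ => rfl⟩

lemma mul_fun {H : E d → E d → ℝ} {H' F : E d → ℝ} (hH : MollRel g H H') (hF : Continuous F) :
    MollRel g (fun z x => H z x * F x) (fun x => H' x * F x) where
  meas x := by simpa only [mul_comm] using (hH.meas x).const_mul (F x)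
  cont z := (hH.cont z).mul hF
  eq x := by rw [moll_mul_const, hH.eq]

lemma const_mul {H : E d → E d → ℝ} {H' : E d → ℝ} (hH : MollRel g H H') (c : ℝ) :
    MollRel g (fun z x => c * H z x) (fun x => c * H' x) where
  meas x := (hH.meas x).const_mul c
  cont z := continuous_const.mul (hH.cont z)
  eq x := by rw [moll_const_mul, hH.eq]

lemma add (hg : IsTest g) {H₁ H₂ : E d → E d → ℝ} {H₁' H₂' : E d → ℝ} (h₁ : MollRel g H₁ H₁')
    (h₂ : MollRel g H₂ H₂') : MollRel g (fun z x => H₁ z x + H₂ z x) (fun x => H₁' x + H₂' x) where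
  meas x := (h₁.meas x).add (h₂.meas x)
  cont z := (h₁.cont z).add (h₂.cont z)
  eq x := by rw [moll_add hg (h₁.meas x) (h₂.meas x), h₁.eq, h₂.eq]

lemma sub (hg : IsTest g) {H₁ H₂ : E d → E d → ℝ} {H₁' H₂' : E d → ℝ} (h₁ : MollRel g H₁ H₁')
    (h₂ : MollRel g H₂ H₂') : MollRel g (fun z x => H₁ z x - H₂ z x) (fun x => H₁' x - H₂' x) where
  meas x := (h₁.meas x).sub (h₂.meas x)
  cont z := (h₁.cont z).sub (h₂.cont z)
  eq x := by rw [moll_sub hg (h₁.meas x) (h₂.meas x), h₁.eq, h₂.eq]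

lemma sum (hg : IsTest g) {ι : Type*} {s : Finset ι} {H : ι → E d → E d → ℝ} {H' : ι → E d → ℝ}
    (h : ∀ i ∈ s, MollRel g (H i) (H' i)) :
    MollRel g (fun z x => ∑ i ∈ s, H i z x) (fun x => ∑ i ∈ s, H' i x) where
  meas x := BddBorel.sum fun i hi => (h i hi).meas x
  cont z := continuous_finsetSum s fun i hi => (h i hi).cont z
  eq x := by
    rw [moll_sum s hg fun i hi => (h i hi).meas x]
    exact Finset.sum_congr rfl fun i hi => (h i hi).eq x

/-- For each shift `y` the inequality fails only on a null set of `z` depending on `y`. A countable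
dense set of shifts has a common null set, and continuity in the second variable extends the
inequality to all shifts. One may then take `y = x - z`, which fixes the second variable at `x`, and
integrate against `g (x - z)`. -/
lemma le_zero (hg : IsKernel ε g) {H : E d → E d → ℝ} {H' : E d → ℝ} (hH : MollRel g H H')
    (h : ∀ y, ∀ᵐ z, H z (z + y) ≤ 0) (x : E d) : H' x ≤ 0 := by
  have h1 : ∀ᵐ z, ∀ n : ℕ, H z (z + TopologicalSpace.denseSeq (E d) n) ≤ 0 :=
    ae_all_iff.2 fun n => h _
  rw [← hH.eq x, ← moll_const hg 0 x]
  refine moll_mono hg (hH.meas x) (BddBorel.const 0) ?_ x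
  filter_upwards [h1] with z hz
  have h2 : IsClosed {y | H z (z + y) ≤ 0} :=
    isClosed_le ((hH.cont z).comp (continuous_const.add continuous_id)) continuous_const
  have h3 : Set.range (TopologicalSpace.denseSeq (E d)) ⊆ {y | H z (z + y) ≤ 0} := by
    rintro _ ⟨n, rfl⟩; exact hz n
  have h4 := h2.closure_subset_iff.2 h3
  rw [(TopologicalSpace.denseRange_denseSeq (E d)).closure_range] at h4
  have := h4 (Set.mem_univ (x - z))
  simpa using this

end MollRel

/-! ### Multi-index sums and word sums -/

lemma exists_ofFn_eq {ι : Type} {k : ℕ} (w : List ι) (hw : w.length = k) :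
    ∃ μ : Fin k → ι, List.ofFn μ = w := by
  subst hw
  exact ⟨w.get, List.ofFn_get w⟩

/-- The multi-index of a word. -/
def wordCount {k : ℕ} (μ : Fin k → Fin d) : Fin d → ℕ := fun j => (List.ofFn μ).count j

lemma wordCount_mem {k : ℕ} (μ : Fin k → Fin d) :
    wordCount μ ∈ Finset.piAntidiag (Finset.univ : Finset (Fin d)) k := by
  rw [Finset.mem_piAntidiag]
  refine ⟨?_, fun _ _ => Finset.mem_univ _⟩
  have h := Multiset.sum_count_eq_card (s := Finset.univ) (m := (↑(List.ofFn μ) : Multiset (Fin d)))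
    (fun _ _ => Finset.mem_univ _)
  simp only [Multiset.coe_count, Multiset.coe_card, List.length_ofFn] at h
  exact h

/-- In a sum over words a multi-index is counted once for each of its orderings. This multiplicity
lies between 1 and `k!`, so sums over words and over multi-indices are comparable with constants
free of the dimension. -/
lemma wsum_sq_iter (k : ℕ) (φ : SB d) (x : E d) :
    wsum k (fun w => iter SB.D w φ x ^ 2) =
      ∑ α ∈ Finset.piAntidiag (Finset.univ : Finset (Fin d)) k,
        ((Finset.univ.filter fun μ : Fin k → Fin d => wordCount μ = α).card : ℝ) *
          mderiv α φ x ^ 2 := by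
  rw [wsum, ← Finset.sum_fiberwise_of_maps_to (fun μ _ => wordCount_mem μ)]
  refine Finset.sum_congr rfl fun α _ => ?_
  rw [← nsmul_eq_mul, ← Finset.sum_const]
  refine Finset.sum_congr rfl fun μ hμ => ?_
  rw [Finset.mem_filter] at hμ
  rw [mderiv_eq_of_count (w := List.ofFn μ) fun j => congrFun hμ.2 j]

lemma card_wordCount_pos {k : ℕ} {α : Fin d → ℕ} (hα : ∑ i, α i = k) :
    1 ≤ (Finset.univ.filter fun μ : Fin k → Fin d => wordCount μ = α).card := by
  obtain ⟨μ, hμ⟩ := exists_ofFn_eq (word α) ((length_word α).trans hα)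
  refine Finset.card_pos.2 ⟨μ, ?_⟩
  rw [Finset.mem_filter]
  refine ⟨Finset.mem_univ _, ?_⟩
  ext j
  rw [wordCount, hμ, count_word]

/-- Words with the same letter counts are permutations of one of them. -/
lemma card_wordCount_le (k : ℕ) (α : Fin d → ℕ) :
    (Finset.univ.filter fun μ : Fin k → Fin d => wordCount μ = α).card ≤ k.factorial := by
  rcases (Finset.univ.filter fun μ : Fin k → Fin d => wordCount μ = α).eq_empty_or_nonempty with
    h | ⟨μ₀, h₀⟩
  · rw [h]; simp
  · rw [Finset.mem_filter] at h₀
    calc _ ≤ (List.ofFn μ₀).permutations.toFinset.card := by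
          refine Finset.card_le_card_of_injOn List.ofFn (fun μ hμ => ?_)
            (List.ofFn_injective.injOn)
          have hμ' := (Finset.mem_filter.1 hμ).2
          rw [Finset.mem_coe, List.mem_toFinset, List.mem_permutations, List.perm_iff_count]
          intro j
          exact congrFun (hμ'.trans h₀.2.symm) j
      _ ≤ (List.ofFn μ₀).permutations.length := List.toFinset_card_le _
      _ = k.factorial := by rw [List.length_permutations, List.length_ofFn]

lemma sum_mderiv_sq_le (k : ℕ) (φ : SB d) (x : E d) :
    ∑ α ∈ Finset.piAntidiag (Finset.univ : Finset (Fin d)) k, mderiv α φ x ^ 2 ≤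
      wsum k (fun w => iter SB.D w φ x ^ 2) := by
  rw [wsum_sq_iter]
  refine Finset.sum_le_sum fun α hα => le_mul_of_one_le_left (sq_nonneg _) ?_
  exact_mod_cast card_wordCount_pos (Finset.mem_piAntidiag.1 hα).1

lemma wsum_sq_iter_le (k : ℕ) (φ : SB d) (x : E d) :
    wsum k (fun w => iter SB.D w φ x ^ 2) ≤ k.factorial *
      ∑ α ∈ Finset.piAntidiag (Finset.univ : Finset (Fin d)) k, mderiv α φ x ^ 2 := by
  rw [wsum_sq_iter, Finset.mul_sum]
  refine Finset.sum_le_sum fun α hα => mul_le_mul_of_nonneg_right ?_ (sq_nonneg _)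
  exact_mod_cast card_wordCount_le k α

lemma wsum_sq_iter_mollSB_le {ι : Type*} [Fintype ι] {ε : ℝ} {g : E d → ℝ} (hg : IsKernel ε g)
    {m : ℕ} {ψ : ι → E d → ℝ} (hψ : ∀ i, MemB m (ψ i)) {k : ℕ} (hk : k ≤ m) (C : ℝ)
    (hC : ∀ᵐ x, ∑ i, derivSq k (ψ i) x ≤ C) (x : E d) :
    ∑ i, wsum k (fun w => iter SB.D w (mollSB g (ψ i)) x ^ 2) ≤ k.factorial * C := by
  have hgen : ∀ (i : ι) (α : Fin d → ℕ), α ∈ Finset.piAntidiag Finset.univ k →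
      IsGenDeriv α (ψ i) (genDeriv α (ψ i)) := fun i α hα =>
    (hψ i).genDeriv ((Finset.mem_piAntidiag.1 hα).1.trans_le hk)
  calc ∑ i, wsum k (fun w => iter SB.D w (mollSB g (ψ i)) x ^ 2)
      ≤ ∑ i, (k.factorial : ℝ) * ∑ α ∈ Finset.piAntidiag (Finset.univ : Finset (Fin d)) k,
          mderiv α (mollSB g (ψ i)) x ^ 2 := Finset.sum_le_sum fun i _ => wsum_sq_iter_le k _ x
    _ = k.factorial * ∑ p ∈ Finset.univ ×ˢ Finset.piAntidiag (Finset.univ : Finset (Fin d)) k,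
          moll g (genDeriv p.2 (ψ p.1)) x ^ 2 := by
        rw [← Finset.mul_sum, Finset.sum_product]
        congr 1
        refine Finset.sum_congr rfl fun i _ => Finset.sum_congr rfl fun α hα => ?_
        rw [mollSB_coe hg.test (hψ i).bddBorel, mderiv_moll hg.test (hψ i).bddBorel (hgen i α hα)]
    _ ≤ k.factorial * C := by
        refine mul_le_mul_of_nonneg_left ?_ (Nat.cast_nonneg _)
        refine sum_sq_moll_le _ hg (fun p hp => (hgen p.1 p.2 (Finset.mem_product.1 hp).2).1) C ?_ x
        filter_upwards [hC] with z hz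
        rw [Finset.sum_product]
        exact hz

lemma derivSq_nonneg (k : ℕ) (ψ : E d → ℝ) (x : E d) : 0 ≤ derivSq k ψ x :=
  Finset.sum_nonneg fun _ _ => sq_nonneg _

/-! ### The mollified scheme -/

section Moll

variable (S : Data d) (g : E d → ℝ) (τ₀ h : ℝ)

/-- The scheme with mollified coefficients. -/
def mollScheme : SmoothScheme d where
  L := S.Λ₁
  τ := S.τ
  τ₀ := τ₀
  h := h
  q l := mollSB g (S.q l)
  p l := mollSB g (S.p l)
  c := mollSB g S.c

variable {S g τ₀ h}

lemma dbar_coe (a : S.Λ) (φ : SB d) :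
    S.dbar τ₀ h a φ = Bop S.Λ₁ S.τ τ₀ h a φ := by
  rcases a with l | i
  · ext x; rw [Bop_inl, SB.smul_apply, SB.fd_coe]; rfl
  · rfl

lemma T_coe (a : S.Λ) (φ : SB d) : S.T h a φ = SB.tr (shiftVec S.Λ₁ h a) φ := by
  rcases a with l | i
  · rfl
  · rw [shiftVec, SB.tr_zero]; rfl

lemma grad1_coe (φ : SB d) (x : E d) :
    S.grad1 τ₀ h φ x = ∑ a, Bop S.Λ₁ S.τ τ₀ h a φ x ^ 2 := by
  simp only [Data.grad1, dbar_coe]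

lemma grad2_coe (φ : SB d) (x : E d) :
    S.grad2 τ₀ h φ x = ∑ a, ∑ b, Bop S.Λ₁ S.τ τ₀ h a (Bop S.Λ₁ S.τ τ₀ h b φ) x ^ 2 := by
  simp only [Data.grad2, dbar_coe]

/-- The form `A_h` with coefficients and function taken at different points. -/
def formA (S : Data d) (τ₀ h : ℝ) (φ : SB d) (z x : E d) : ℝ :=
  ∑ l : S.Λ₁, ∑ a, (S.dbarCoef τ₀ h a (S.q l) z + h * S.dbarCoef τ₀ h a (S.p l) z) *
    (2 * (SB.tr (shiftVec S.Λ₁ h a) (h⁻¹ • SB.fd h (l : E d) φ) x * Bop S.Λ₁ S.τ τ₀ h a φ x))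

/-- The form built from `Q_{h,λ}`, `λ ∈ Λ²`, with coefficients and function taken at different
points. -/
def formA2 (S : Data d) (τ₀ h : ℝ) (φ : SB d) (z x : E d) : ℝ :=
  ∑ l : S.Λ₁, ∑ a, ∑ b, S.dbarCoef τ₀ h a (S.dbarCoef τ₀ h b (S.q l)) z *
    (SB.tr (shiftVec S.Λ₁ h a) (SB.tr (shiftVec S.Λ₁ h b) (h⁻¹ • SB.fd h (l : E d) φ)) x *
      Bop S.Λ₁ S.τ τ₀ h a (Bop S.Λ₁ S.τ τ₀ h b φ) x)

/-- The form `𝒬_h` with coefficients and function taken at different points. -/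
def formQ (S : Data d) (h : ℝ) (φ : SB d) (z x : E d) : ℝ :=
  ∑ l : S.Λ₁, (S.q l z + h * S.p l z) * SB.fd h (l : E d) φ x ^ 2

lemma A_eq_form (hh : h ≠ 0) (φ : SB d) (z : E d) : S.A τ₀ h φ z = formA S τ₀ h φ z z := by
  unfold Data.A Data.L0 formA
  rw [Finset.sum_comm, Finset.mul_sum]
  refine Finset.sum_congr rfl fun a _ => ?_
  rw [← Finset.sum_coe_sort S.Λ₁, ← Finset.sum_coe_sort S.Λ₁, Finset.mul_sum,
    ← Finset.sum_add_distrib, Finset.mul_sum, Finset.mul_sum]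
  refine Finset.sum_congr rfl fun l _ => ?_
  rw [dbar_coe, T_coe, ← SB.fd_coe, map_smul, SB.smul_apply, SB.fd_tr]
  field_simp

lemma A2_eq_form (φ : SB d) (z : E d) :
    ∑ a, ∑ b, S.dbar τ₀ h a (S.dbar τ₀ h b φ) z * S.Q2 τ₀ h a b (S.T h a (S.T h b φ)) z =
      formA2 S τ₀ h φ z z := by
  unfold Data.Q2 formA2
  have h1 : ∀ a b : S.Λ, S.dbar τ₀ h a (S.dbar τ₀ h b φ) z * (h⁻¹ * ∑ l ∈ S.Λ₁,
      S.dbarCoef τ₀ h a (S.dbarCoef τ₀ h b (S.q l)) z * fdiff h l (S.T h a (S.T h b φ)) z) =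
      ∑ l : S.Λ₁, S.dbarCoef τ₀ h a (S.dbarCoef τ₀ h b (S.q l)) z *
        (SB.tr (shiftVec S.Λ₁ h a) (SB.tr (shiftVec S.Λ₁ h b) (h⁻¹ • SB.fd h (l : E d) φ)) z *
          Bop S.Λ₁ S.τ τ₀ h a (Bop S.Λ₁ S.τ τ₀ h b φ) z) := by
    intro a b
    rw [← Finset.sum_coe_sort S.Λ₁, Finset.mul_sum, Finset.mul_sum]
    refine Finset.sum_congr rfl fun l _ => ?_
    rw [dbar_coe, dbar_coe, T_coe, T_coe, ← SB.fd_coe, map_smul, map_smul, SB.smul_apply,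
      SB.fd_tr, SB.fd_tr]
    ring
  simp only [h1]
  rw [Finset.sum_comm]
  refine (Finset.sum_congr rfl fun b _ => Finset.sum_comm).trans ?_
  rw [Finset.sum_comm]
  exact Finset.sum_congr rfl fun l _ => Finset.sum_comm

lemma cQ_eq_form (φ : SB d) (z : E d) : S.cQ h φ z = formQ S h φ z z := by
  unfold Data.cQ formQ Data.χ
  rw [← Finset.sum_coe_sort S.Λ₁]
  refine Finset.sum_congr rfl fun l _ => ?_
  rw [SB.fd_coe]

/-- Translating the test function moves only the second variable. With its analogues below, this
supplies the hypothesis of `MollRel.le_zero`. -/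
lemma formA_tr (φ : SB d) (y z x : E d) :
    formA S τ₀ h (SB.tr y φ) z x = formA S τ₀ h φ z (x + y) := by
  simp only [formA, SB.fd_tr, isLeibniz_Bop.tr, ← map_smul, SB.tr_comm _ y, SB.tr_apply]

lemma formA2_tr (φ : SB d) (y z x : E d) :
    formA2 S τ₀ h (SB.tr y φ) z x = formA2 S τ₀ h φ z (x + y) := by
  simp only [formA2, SB.fd_tr, isLeibniz_Bop.tr, ← map_smul, SB.tr_comm _ y, SB.tr_apply]

lemma formQ_tr (φ : SB d) (y z x : E d) :
    formQ S h (SB.tr y φ) z x = formQ S h φ z (x + y) := by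
  simp only [formQ, SB.fd_tr, SB.tr_apply]

section Rel

variable {ε : ℝ} {m : ℕ}

lemma mollScheme_χ_coe (hg : IsTest g) {l : S.Λ₁} (hq : BddBorel (S.q l)) (hp : BddBorel (S.p l)) :
    ((mollScheme S g τ₀ h).χ l : E d → ℝ) = moll g (S.χ h l) := by
  ext x
  change mollSB g (S.q l) x + h * mollSB g (S.p l) x = _
  rw [mollSB_coe hg hq, mollSB_coe hg hp, ← moll_const_mul, ← moll_add hg hq (hp.const_mul _)]
  rfl

lemma mollRel_formQ (hg : IsTest g) (hq : ∀ l ∈ S.Λ₁, BddBorel (S.q l))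
    (hp : ∀ l ∈ S.Λ₁, BddBorel (S.p l)) (φ : SB d) :
    MollRel g (formQ S h φ) ((mollScheme S g τ₀ h).cQ φ) := by
  have e : ((mollScheme S g τ₀ h).cQ φ : E d → ℝ) =
      fun x => ∑ l : S.Λ₁, moll g (S.χ h l) x * SB.fd h (l : E d) φ x ^ 2 := by
    ext x
    change (∑ l : S.Λ₁, (mollScheme S g τ₀ h).χ l * SB.fd h (l : E d) φ ^ 2 : SB d) x = _
    rw [SB.sum_apply]
    refine Finset.sum_congr rfl fun l _ => ?_
    rw [SB.mul_apply, SB.pow_apply, mollScheme_χ_coe hg (hq l l.2) (hp l l.2)]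
  rw [e]
  exact MollRel.sum hg fun l _ =>
    (MollRel.coef ((hq l l.2).add ((hp l l.2).const_mul h))).mul_fun ((SB.continuous _).pow 2)

lemma mollRel_formA (hg : IsTest g) (hq : ∀ l ∈ S.Λ₁, HasGrad (S.q l))
    (hp : ∀ l ∈ S.Λ₁, HasGrad (S.p l)) (φ : SB d) :
    MollRel g (formA S τ₀ h φ) ((mollScheme S g τ₀ h).A φ) := by
  have e : ((mollScheme S g τ₀ h).A φ : E d → ℝ) =
      fun x => ∑ l : S.Λ₁, ∑ a, moll g (fun z => S.dbarCoef τ₀ h a (S.q l) z +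
        h * S.dbarCoef τ₀ h a (S.p l) z) x *
        (2 * (SB.tr (shiftVec S.Λ₁ h a) (h⁻¹ • SB.fd h (l : E d) φ) x *
          Bop S.Λ₁ S.τ τ₀ h a φ x)) := by
    ext x
    change ((2 : ℝ) • ∑ l : S.Λ₁, ∑ a, Bop S.Λ₁ S.τ τ₀ h a (mollSB g (S.q l) +
      h • mollSB g (S.p l)) * SB.tr (shiftVec S.Λ₁ h a) (h⁻¹ • SB.fd h (l : E d) φ) *
      Bop S.Λ₁ S.τ τ₀ h a φ : SB d) x = _
    rw [SB.smul_apply, SB.sum_apply, Finset.mul_sum]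
    refine Finset.sum_congr rfl fun l _ => ?_
    rw [SB.sum_apply, Finset.mul_sum]
    refine Finset.sum_congr rfl fun a _ => ?_
    rw [SB.mul_apply, SB.mul_apply, map_add, map_smul, SB.add_apply, SB.smul_apply,
      Bop_mollSB S τ₀ h hg (hq l l.2), Bop_mollSB S τ₀ h hg (hp l l.2),
      moll_add hg (bddBorel_dbarCoef S τ₀ h (hq l l.2) a)
        ((bddBorel_dbarCoef S τ₀ h (hp l l.2) a).const_mul h), moll_const_mul]
    ring
  rw [e]
  refine MollRel.sum hg fun l _ => MollRel.sum hg fun a _ => (MollRel.coef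
    ((bddBorel_dbarCoef S τ₀ h (hq l l.2) a).add
      ((bddBorel_dbarCoef S τ₀ h (hp l l.2) a).const_mul h))).mul_fun ?_
  exact continuous_const.mul ((SB.continuous _).mul (SB.continuous _))

lemma mollRel_formA2 (hg : IsTest g) (hm : 2 ≤ m) (hq : ∀ l ∈ S.Λ₁, MemB m (S.q l)) (φ : SB d) :
    MollRel g (formA2 S τ₀ h φ) ((mollScheme S g τ₀ h).A2 φ) := by
  have e : ((mollScheme S g τ₀ h).A2 φ : E d → ℝ) =
      fun x => ∑ l : S.Λ₁, ∑ a, ∑ b, moll g (S.dbarCoef τ₀ h a (S.dbarCoef τ₀ h b (S.q l))) x *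
        (SB.tr (shiftVec S.Λ₁ h a) (SB.tr (shiftVec S.Λ₁ h b) (h⁻¹ • SB.fd h (l : E d) φ)) x *
          Bop S.Λ₁ S.τ τ₀ h a (Bop S.Λ₁ S.τ τ₀ h b φ) x) := by
    ext x
    change (∑ l : S.Λ₁, ∑ a, ∑ b, Bop S.Λ₁ S.τ τ₀ h a (Bop S.Λ₁ S.τ τ₀ h b (mollSB g (S.q l))) *
      SB.tr (shiftVec S.Λ₁ h a) (SB.tr (shiftVec S.Λ₁ h b) (h⁻¹ • SB.fd h (l : E d) φ)) *
      Bop S.Λ₁ S.τ τ₀ h a (Bop S.Λ₁ S.τ τ₀ h b φ) : SB d) x = _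
    rw [SB.sum_apply]
    refine Finset.sum_congr rfl fun l _ => ?_
    rw [SB.sum_apply]
    refine Finset.sum_congr rfl fun a _ => ?_
    rw [SB.sum_apply]
    refine Finset.sum_congr rfl fun b _ => ?_
    rw [SB.mul_apply, SB.mul_apply, Bop_mollSB_eq S τ₀ h hg ((hq l l.2).hasGrad (by omega)),
      Bop_mollSB S τ₀ h hg (hasGrad_dbarCoef S τ₀ h (hq l l.2) hm b), mul_assoc]
  rw [e]
  refine MollRel.sum hg fun l _ => MollRel.sum hg fun a _ => MollRel.sum hg fun b _ =>
    (MollRel.coef (bddBorel_dbarCoef S τ₀ h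
      (hasGrad_dbarCoef S τ₀ h (hq l l.2) hm b) a)).mul_fun ?_
  exact (SB.continuous _).mul (SB.continuous _)

end Rel

end Moll

/-! ### Operators of class `𝔎` -/

namespace IsClassK

variable {𝒦 : (E d → ℝ) → E d → ℝ}

/-- Positivity and `𝒦 1 ≤ 1` give `𝒦 F ≤ W 𝒦 1 ≤ W`; only this property of the class `𝔎` survives in
the estimates. -/
lemma apply_le (h𝒦 : IsClassK 𝒦) {F : E d → ℝ} (hF : BddBorel F) {W : ℝ} (hW : 0 ≤ W)
    (h : ∀ x, F x ≤ W) (x : E d) :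
    𝒦 F x ≤ W := by
  have h1 : BddBorel (fun _ : E d => (1 : ℝ)) := BddBorel.const 1
  have hW1 : BddBorel (W • fun _ : E d => (1 : ℝ)) := h1.const_mul W
  have hF1 : BddBorel ((-1 : ℝ) • F) := hF.const_mul (-1)
  have h2 := h𝒦.nonneg _ (hW1.add hF1) (fun z => by
    have := h z
    simp only [Pi.smul_apply, smul_eq_mul]; linarith) x
  have h3 := h𝒦.add _ _ hW1 hF1
  change 0 ≤ 𝒦 ((W • fun _ : E d => (1 : ℝ)) + (-1 : ℝ) • F) x at h2
  rw [h3, h𝒦.smul _ _ h1, h𝒦.smul _ _ hF] at h2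
  simp only [Pi.add_apply, Pi.smul_apply, smul_eq_mul] at h2
  nlinarith [h𝒦.one_le x]

lemma sum (h𝒦 : IsClassK 𝒦) {β : Type*} (s : Finset β) {F : β → E d → ℝ}
    (hF : ∀ i ∈ s, BddBorel (F i)) (x : E d) :
    𝒦 (fun z => ∑ i ∈ s, F i z) x = ∑ i ∈ s, 𝒦 (F i) x := by
  classical
  induction s using Finset.induction_on with
  | empty =>
    have h1 := congrFun (h𝒦.smul 0 _ (BddBorel.const 0)) x
    rw [zero_smul, zero_smul] at h1
    simp only [Finset.sum_empty]
    exact h1.trans (by simp)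
  | insert a s ha ih =>
    have hs := fun i hi => hF i (Finset.mem_insert_of_mem hi)
    have h1 := h𝒦.add (F a) (fun z => ∑ i ∈ s, F i z) (hF a (Finset.mem_insert_self a s))
      (BddBorel.sum hs)
    simp only [Finset.sum_insert ha]
    rw [← ih hs]
    exact congrFun h1 x

/-- Linearity is used before the supremum is taken, so the bound is for the sum of the family as a
whole. -/
lemma sum_le (h𝒦 : IsClassK 𝒦) {β : Type*} [Fintype β] {F : β → E d → ℝ}
    (hF : ∀ i, BddBorel (F i)) (h0 : ∀ i x, 0 ≤ F i x) {W : ℝ} (h : ∀ x, ∑ i, F i x ≤ W) (x : E d) :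
    ∑ i, 𝒦 (F i) x ≤ W := by
  rw [← h𝒦.sum _ fun i _ => hF i]
  exact h𝒦.apply_le (BddBorel.sum fun i _ => hF i)
    ((Finset.sum_nonneg fun i _ => h0 i 0).trans (h 0)) h x

end IsClassK

/-! ### Admissibility of the mollified scheme -/

section Admissible

variable {S : Data d} {m : ℕ} {h₀ τ₀ δ K c₀ h ε : ℝ} {M : Fin (m + 1) → ℝ} {f g : E d → ℝ}

lemma bddBorel_grad1 (φ : SB d) : BddBorel (S.grad1 τ₀ h φ) :=
  (congrArg BddBorel (funext fun x => (grad1_coe φ x).symm)).mp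
    (BddBorel.sum fun a _ => SB.bddBorel (Bop S.Λ₁ S.τ τ₀ h a φ ^ 2))

lemma bddBorel_grad2 (φ : SB d) : BddBorel (S.grad2 τ₀ h φ) :=
  (congrArg BddBorel (funext fun x => (grad2_coe φ x).symm)).mp
    (BddBorel.sum fun a _ => BddBorel.sum fun b _ =>
      SB.bddBorel (Bop S.Λ₁ S.τ τ₀ h a (Bop S.Λ₁ S.τ τ₀ h b φ) ^ 2))

/-- Once the value of `𝒦` is replaced by the constant `W`, which is legitimate because `(1 - δ) c ≥
0`, every term is linear in the coefficients, and the inequality can be averaged. -/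
lemma mollScheme_structural1 (hg : IsKernel ε g) (hS : S.Admissible m h₀ τ₀ δ K c₀ M f)
    (hm : 2 ≤ m) (hδ1 : δ ≤ 1) (hc₀ : 0 < c₀) (hh : 0 < h) (hh₀ : h ≤ h₀) (φ : SB d) (W : ℝ)
    (hW : ∀ z, ∑ a, (mollScheme S g τ₀ h).B a φ z ^ 2 ≤ W) (x : E d) :
    m * (mollScheme S g τ₀ h).A φ x ≤
      (1 - δ) * ∑ a, (mollScheme S g τ₀ h).cQ ((mollScheme S g τ₀ h).B a φ) x +
      K * (mollScheme S g τ₀ h).cQ φ x + 2 * (1 - δ) * (mollScheme S g τ₀ h).c x * W := by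
  obtain ⟨𝒦, h𝒦, hst⟩ := hS.structural1 h hh hh₀
  have hqm := hS.regular.q_mem
  have hpm := hS.regular.p_mem
  have hQ := fun φ => mollRel_formQ (h := h) (τ₀ := τ₀) hg.test (fun l hl => (hqm l hl).bddBorel)
    (fun l hl => (hpm l hl).bddBorel) φ
  have hrel := ((mollRel_formA (h := h) (τ₀ := τ₀) hg.test
      (fun l hl => (hqm l hl).hasGrad (by omega))
      (fun l hl => (hpm l hl).hasGrad (by omega)) φ).const_mul (m : ℝ)).sub hg.test
    (((MollRel.sum (s := Finset.univ) hg.test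
      fun a _ => hQ (Bop S.Λ₁ S.τ τ₀ h a φ)).const_mul (1 - δ)).add hg.test
      ((hQ φ).const_mul K) |>.add hg.test
      (((MollRel.coef hS.regular.c_mem.bddBorel).const_mul (2 * (1 - δ))).mul_fun
        (continuous_const (y := W))))
  have := hrel.le_zero hg (fun y => ?_) x
  · rw [← mollSB_coe hg.test hS.regular.c_mem.bddBorel] at this
    exact sub_nonpos.1 this
  -- The test function is translated by an arbitrary `y`; the hypothesis on `W` is a supremum over
  -- all points and so is unaffected.
  · filter_upwards [hst _ (SB.tr y φ).2] with z hz
    rw [A_eq_form hh.ne', formA_tr, cQ_eq_form, formQ_tr] at hz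
    simp only [dbar_coe, cQ_eq_form, isLeibniz_Bop.tr, formQ_tr] at hz
    have hk : 𝒦 (S.grad1 τ₀ h (SB.tr y φ)) z ≤ W := by
      refine h𝒦.apply_le (bddBorel_grad1 _)
        ((Finset.sum_nonneg fun a _ => sq_nonneg _).trans (hW 0)) (fun t => ?_) z
      rw [grad1_coe]
      simp only [isLeibniz_Bop.tr, SB.tr_apply]
      exact hW (t + y)
    have hc : 0 ≤ 2 * (1 - δ) * S.c z :=
      mul_nonneg (by linarith) (hc₀.le.trans (hS.c_lower z))
    have := mul_le_mul_of_nonneg_left hk hc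
    linarith

lemma mollScheme_structural2 (hg : IsKernel ε g) (hS : S.Admissible m h₀ τ₀ δ K c₀ M f)
    (hm : 2 ≤ m) (hδ1 : δ ≤ 1) (hK : 0 ≤ K) (hc₀ : 0 < c₀) (hh : 0 < h) (hh₀ : h ≤ h₀)
    (n : ℕ) (hn : 1 ≤ n) (hnm : n ≤ m) {β : Type} [Fintype β] (φ : β → SB d) (W W' : ℝ)
    (hW : ∀ z, ∑ ν, ∑ a, ∑ b, (mollScheme S g τ₀ h).B a ((mollScheme S g τ₀ h).B b (φ ν)) z ^ 2
      ≤ W)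
    (hW' : ∀ z, ∑ ν, ∑ a, (mollScheme S g τ₀ h).B a (φ ν) z ^ 2 ≤ W') (x : E d) :
    ∑ ν, (n * ∑ a, (mollScheme S g τ₀ h).A ((mollScheme S g τ₀ h).B a (φ ν)) x +
        n * ((n : ℝ) - 1) * (mollScheme S g τ₀ h).A2 (φ ν) x) ≤
      (1 - δ) * ∑ ν, ∑ a, ∑ b, (mollScheme S g τ₀ h).cQ
        ((mollScheme S g τ₀ h).B a ((mollScheme S g τ₀ h).B b (φ ν))) x +
      K * ∑ ν, ∑ a, (mollScheme S g τ₀ h).cQ ((mollScheme S g τ₀ h).B a (φ ν)) x +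
      2 * (1 - δ) * (mollScheme S g τ₀ h).c x * W + K * W' := by
  obtain ⟨𝒦, h𝒦, hst⟩ := hS.structural2 h hh hh₀ n hn hnm
  have hqm := hS.regular.q_mem
  have hpm := hS.regular.p_mem
  have hQ := fun φ => mollRel_formQ (h := h) (τ₀ := τ₀) hg.test (fun l hl => (hqm l hl).bddBorel)
    (fun l hl => (hpm l hl).bddBorel) φ
  have hA := fun φ => mollRel_formA (h := h) (τ₀ := τ₀) hg.test
      (fun l hl => (hqm l hl).hasGrad (by omega))
      (fun l hl => (hpm l hl).hasGrad (by omega)) φ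
  have hA2 := fun φ => mollRel_formA2 (h := h) (τ₀ := τ₀) hg.test hm hqm φ
  have hrel := (MollRel.sum (s := Finset.univ) hg.test fun ν _ =>
      (((MollRel.sum (s := Finset.univ) hg.test
        fun a _ => hA (Bop S.Λ₁ S.τ τ₀ h a (φ ν))).const_mul (n : ℝ)).add hg.test
      ((hA2 (φ ν)).const_mul (n * ((n : ℝ) - 1))))).sub hg.test
    ((((MollRel.sum (s := Finset.univ) hg.test fun ν _ =>
      MollRel.sum (s := Finset.univ) hg.test fun a _ =>
      MollRel.sum (s := Finset.univ) hg.test fun b _ =>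
        hQ (Bop S.Λ₁ S.τ τ₀ h a (Bop S.Λ₁ S.τ τ₀ h b (φ ν)))).const_mul (1 - δ)).add hg.test
      ((MollRel.sum (s := Finset.univ) hg.test fun ν _ =>
        MollRel.sum (s := Finset.univ) hg.test fun a _ =>
        hQ (Bop S.Λ₁ S.τ τ₀ h a (φ ν))).const_mul K)).add hg.test
      (((MollRel.coef hS.regular.c_mem.bddBorel).const_mul (2 * (1 - δ))).mul_fun
        (continuous_const (y := W))) |>.add hg.test
      (MollRel.coef (BddBorel.const (K * W'))))
  have := hrel.le_zero hg (fun y => ?_) x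
  · rw [← mollSB_coe hg.test hS.regular.c_mem.bddBorel] at this
    simp only [moll_const hg] at this
    exact sub_nonpos.1 this
  · filter_upwards [ae_all_iff.2 fun ν => hst _ (SB.tr y (φ ν)).2] with z hz
    simp only [A2_eq_form, formA2_tr] at hz
    simp only [dbar_coe, A_eq_form hh.ne', cQ_eq_form, isLeibniz_Bop.tr, formA_tr, formQ_tr] at hz
    have hz' := Finset.sum_le_sum fun ν (_ : ν ∈ Finset.univ) => hz ν
    simp only [Finset.sum_add_distrib, ← Finset.mul_sum] at hz'
    have hk : ∑ ν, 𝒦 (S.grad2 τ₀ h (SB.tr y (φ ν))) z ≤ W := by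
      refine h𝒦.sum_le (fun ν => bddBorel_grad2 _) (fun ν t => Finset.sum_nonneg fun a _ =>
        Finset.sum_nonneg fun b _ => sq_nonneg _) (fun t => ?_) z
      simp only [grad2_coe]
      simp only [isLeibniz_Bop.tr, SB.tr_apply]
      exact hW (t + y)
    have hk' : ∑ ν, 𝒦 (S.grad1 τ₀ h (SB.tr y (φ ν))) z ≤ W' := by
      refine h𝒦.sum_le (fun ν => bddBorel_grad1 _) (fun ν t => Finset.sum_nonneg fun a _ =>
        sq_nonneg _) (fun t => ?_) z
      simp only [grad1_coe]
      simp only [isLeibniz_Bop.tr, SB.tr_apply]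
      exact hW' (t + y)
    have hc : 0 ≤ 2 * (1 - δ) * S.c z :=
      mul_nonneg (by linarith) (hc₀.le.trans (hS.c_lower z))
    have h1 := mul_le_mul_of_nonneg_left hk hc
    have h2 := mul_le_mul_of_nonneg_left hk' hK
    simp only [Finset.sum_add_distrib, ← Finset.mul_sum]
    linarith

lemma mollScheme_bound (hg : IsKernel ε g) (hR : S.Regular m M f) {ι : Type*} [Fintype ι]
    {ψ : ι → E d → ℝ} (hψ : ∀ i, MemB m (ψ i)) (hle : ∀ k x, ∑ i, derivSq k (ψ i) x ≤
      ∑ l ∈ S.Λ₁, (derivSq k (S.q l) x + derivSq k (S.p l) x) + derivSq k S.c x)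
    (k : ℕ) (hk : k ≤ m) (x : E d) :
    ∑ i, wsum k (fun w => iter SB.D w (mollSB g (ψ i)) x ^ 2) ≤
      ∑ k : Fin (m + 1), ((k : ℕ).factorial : ℝ) * M k ^ 2 := by
  refine (wsum_sq_iter_mollSB_le hg hψ hk (M ⟨k, by omega⟩ ^ 2) ?_ x).trans ?_
  · filter_upwards [hR.bound ⟨k, by omega⟩] with z hz
    exact (hle k z).trans hz
  · exact Finset.single_le_sum (f := fun k : Fin (m + 1) => ((k : ℕ).factorial : ℝ) * M k ^ 2)
      (fun i _ => by positivity) (Finset.mem_univ (⟨k, by omega⟩ : Fin (m + 1)))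

/-- The hypotheses are linear or convex in the coefficients, hence stable under averaging with a
nonnegative kernel of integral 1. Only the derivative bounds acquire factorials, from passing to
sums over words. -/
theorem mollScheme_admissible (hg : IsKernel ε g) (hS : S.Admissible m h₀ τ₀ δ K c₀ M f)
    (hm : 2 ≤ m) (hδ1 : δ ≤ 1) (hK : 0 ≤ K) (hτ₀ : 0 < τ₀) (hc₀ : 0 < c₀) (hh : 0 < h)
    (hh₀ : h ≤ h₀) :
    (mollScheme S g τ₀ h).Admissible m δ K c₀ (S.size ^ 2) (S.wsize ^ 2)
      (∑ k : Fin (m + 1), ((k : ℕ).factorial : ℝ) * M k ^ 2) where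
  h_pos := hh
  τ₀_pos := hτ₀
  χ_nonneg l x := by
    have hq := (hS.regular.q_mem l l.2).bddBorel
    have hp := (hS.regular.p_mem l l.2).bddBorel
    rw [mollScheme_χ_coe hg.test hq hp, ← moll_const hg 0 x]
    exact moll_mono hg (BddBorel.const 0) (hq.add (hp.const_mul h))
      (.of_forall fun z => hS.χ_nonneg h hh hh₀ l l.2 z) x
  balanced i := by
    ext x
    change (∑ l : S.Λ₁, (l : E d) i • mollSB g (S.q l) : SB d) x = 0
    have hq := fun l : S.Λ₁ => (hS.regular.q_mem l l.2).bddBorel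
    rw [SB.sum_apply]
    calc ∑ l : S.Λ₁, ((l : E d) i • mollSB g (S.q l)) x
        = ∑ l : S.Λ₁, moll g (fun z => (l : E d) i * S.q l z) x :=
          Finset.sum_congr rfl fun l _ => by
            rw [SB.smul_apply, mollSB_coe hg.test (hq l), moll_const_mul]
      _ = moll g (fun z => ∑ l : S.Λ₁, (l : E d) i * S.q l z) x :=
          (moll_sum _ hg.test (fun l _ => (hq l).const_mul _) x).symm
      _ = moll g (fun _ => 0) x := by
          congr 1
          ext z
          have := congrArg (fun v : E d => v i) (hS.balanced z)
          rw [← Finset.sum_coe_sort S.Λ₁] at this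
          simpa [mul_comm] using this
      _ = 0 := moll_const hg 0 x
  c_lower x := by
    change c₀ ≤ mollSB g S.c x
    rw [mollSB_coe hg.test hS.regular.c_mem.bddBorel, ← moll_const hg c₀ x]
    exact moll_mono hg (BddBorel.const _) hS.regular.c_mem.bddBorel
      (.of_forall fun z => hS.c_lower z) x
  size := (Real.sq_sqrt (Finset.sum_nonneg fun _ _ => sq_nonneg _)).symm
  wsize := (Real.sq_sqrt (Finset.sum_nonneg fun _ _ => sq_nonneg _)).symm
  q_bound := mollScheme_bound (ψ := fun l : S.Λ₁ => S.q l) hg hS.regular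
    (fun l => hS.regular.q_mem l l.2) fun k x => by
      rw [Finset.sum_coe_sort S.Λ₁ (fun l => derivSq k (S.q l) x), Finset.sum_add_distrib]
      have := Finset.sum_nonneg fun l (_ : l ∈ S.Λ₁) => derivSq_nonneg k (S.p l) x
      linarith [derivSq_nonneg k S.c x]
  p_bound := mollScheme_bound (ψ := fun l : S.Λ₁ => S.p l) hg hS.regular
    (fun l => hS.regular.p_mem l l.2) fun k x => by
      rw [Finset.sum_coe_sort S.Λ₁ (fun l => derivSq k (S.p l) x), Finset.sum_add_distrib]
      have := Finset.sum_nonneg fun l (_ : l ∈ S.Λ₁) => derivSq_nonneg k (S.q l) x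
      linarith [derivSq_nonneg k S.c x]
  c_bound k hk x := by
    have := mollScheme_bound (ψ := fun _ : Unit => S.c) hg hS.regular
      (fun _ => hS.regular.c_mem) (fun k x => by
        rw [Fintype.sum_unique]
        have := Finset.sum_nonneg fun l (_ : l ∈ S.Λ₁) =>
          add_nonneg (derivSq_nonneg k (S.q l) x) (derivSq_nonneg k (S.p l) x)
        linarith) k hk x
    rwa [Fintype.sum_unique] at this
  structural1 := mollScheme_structural1 hg hS hm hδ1 hc₀ hh hh₀
  structural2 := mollScheme_structural2 hg hS hm hδ1 hK hc₀ hh hh₀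

end Admissible

/-! ### Approximation by mollification -/

lemma SB.abs_sub_le (φ : SB d) (C : Fin d → ℝ) (hC : ∀ i z, |SB.D i φ z| ≤ C i) (x z : E d) :
    |φ x - φ z| ≤ (∑ i, C i) * ‖x - z‖ := by
  obtain ⟨t, -, ht⟩ := SB.exists_fd_eq one_pos (x - z) φ z
  rw [SB.fd_apply, inv_one, one_mul, one_smul, add_sub_cancel] at ht
  rw [ht, SB.dd_apply, Finset.sum_mul]
  refine (Finset.abs_sum_le_sum_abs _ _).trans (Finset.sum_le_sum fun i _ => ?_)
  rw [abs_mul, mul_comm]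
  exact mul_le_mul (hC i _) (PiLp.norm_apply_le (x - z) i) (abs_nonneg _)
    ((abs_nonneg _).trans (hC i 0))

section Kernel

variable {ε : ℝ} {g : E d → ℝ}

lemma abs_moll_le_of_isKernel (hg : IsKernel ε g) {ψ : E d → ℝ} {C : ℝ} (hC : ∀ᵐ x, |ψ x| ≤ C)
    (x : E d) : |moll g ψ x| ≤ C := by
  have := abs_moll_le hg.test C hC x
  simpa only [abs_of_nonneg (hg.nonneg _), hg.integral, mul_one] using this

/-- The commutator of mollification and multiplication by a function that is almost constant near
the given point. -/
lemma abs_moll_mul_sub_le (hg : IsKernel ε g) {k a : E d → ℝ} (hk : BddBorel k) (ha : BddBorel a)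
    {A η κ : ℝ} (hA : ∀ z, |a z| ≤ A) {x : E d} (hη : ∀ z, ‖x - z‖ < ε → |k z - κ| ≤ η) :
    |moll g (fun z => k z * a z) x - κ * moll g a x| ≤ η * A := by
  rw [← moll_const_mul, ← moll_sub hg.test (hk.mul ha) (ha.const_mul κ)]
  have h1 : ∫ t, η * A * g (x - t) = η * A := by
    rw [integral_const_mul, integral_reflect, hg.integral, mul_one]
  rw [← h1, ← Real.norm_eq_abs, moll]
  refine norm_integral_le_of_norm_le ((hg.test.reflect x).integrable.const_mul _)
    (.of_forall fun t => ?_)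
  rcases lt_or_ge ‖x - t‖ ε with h | h
  · rw [← sub_mul, norm_mul, norm_mul, Real.norm_eq_abs, Real.norm_eq_abs, Real.norm_eq_abs,
      abs_of_nonneg (hg.nonneg _)]
    exact mul_le_mul_of_nonneg_right (mul_le_mul (hη t h) (hA t) (abs_nonneg _)
      ((abs_nonneg _).trans (hη t h))) (hg.nonneg _)
  · simp [hg.support _ h]

lemma abs_moll_sub_le (hg : IsKernel ε g) {k : E d → ℝ} (hk : BddBorel k) {η κ : ℝ} {x : E d}
    (hη : ∀ z, ‖x - z‖ < ε → |k z - κ| ≤ η) : |moll g k x - κ| ≤ η := by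
  have := abs_moll_mul_sub_le hg hk (BddBorel.const 1) (A := 1) (fun _ => by simp) hη
  simpa [moll_const hg] using this

/-- The derivative is transferred to the kernel, so that derivatives of a mollified function of any
order are controlled by its supremum alone. -/
lemma exists_test_dd (hg : IsTest g) (l : E d) : ∃ g' : E d → ℝ, IsTest g' ∧
    ∀ ψ, BddBorel ψ → SB.dd l (mollSB g ψ) = mollSB g' ψ := by
  have h1 : IsTest fun x => fderiv ℝ g x l :=
    ⟨(hg.1.fderiv_right (m := ∞) (by simp)).clm_apply contDiff_const, hg.2.fderiv_apply ℝ _⟩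
  refine ⟨_, h1, fun ψ hψ => ?_⟩
  ext x
  rw [SB.dd_apply, mollSB_coe h1 hψ, moll]
  have e : ∀ t, ψ t * fderiv ℝ g (x - t) l = ∑ i, l i * (ψ t * pderiv i g (x - t)) := by
    intro t
    conv_lhs => rw [← (EuclideanSpace.basisFun (Fin d) ℝ).sum_repr l, map_sum, Finset.mul_sum]
    refine Finset.sum_congr rfl fun i _ => ?_
    simp [pderiv]; ring
  simp only [e]
  rw [integral_finsetSum _ fun i _ => (integrable_moll hψ (hg.pderiv i) x).const_mul _]
  refine Finset.sum_congr rfl fun i _ => ?_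
  rw [integral_const_mul, SB.D_coe, mollSB_coe hg hψ, pderiv_moll hg hψ.locallyIntegrable, moll]

end Kernel

/-- A sequence of bump functions shrinking to the origin. -/
def bump (d n : ℕ) : ContDiffBump (0 : E d) where
  rIn := 1 / (2 * ((n : ℝ) + 1))
  rOut := 1 / ((n : ℝ) + 1)
  rIn_pos := by positivity
  rIn_lt_rOut := by
    rw [← one_div_mul_one_div]
    have : (0 : ℝ) < 1 / ((n : ℝ) + 1) := by positivity
    linarith

/-- The standard mollification kernels. -/
def kern (d n : ℕ) : E d → ℝ := (bump d n).normed volume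

lemma isKernel_kern (n : ℕ) : IsKernel (1 / ((n : ℝ) + 1)) (kern d n) where
  test := ⟨(bump d n).contDiff_normed, (bump d n).hasCompactSupport_normed⟩
  nonneg := (bump d n).nonneg_normed
  integral := (bump d n).integral_normed
  support x hx := by
    have : x ∉ Function.support ((bump d n).normed volume) := by
      rw [(bump d n).support_normed_eq, Metric.mem_ball, dist_zero_right]
      exact not_lt.2 hx
    exact Function.notMem_support.1 this

lemma moll_kern (n : ℕ) (ψ : E d → ℝ) : moll (kern d n) ψ =
    convolution ((bump d n).normed volume) ψ (ContinuousLinearMap.lsmul ℝ ℝ) volume := by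
  ext x
  rw [convolution_eq_swap]
  simp only [moll, kern, ContinuousLinearMap.lsmul_apply, smul_eq_mul, mul_comm]

lemma ae_tendsto_moll {ψ : E d → ℝ} (hψ : LocallyIntegrable ψ) :
    ∀ᵐ x, Filter.Tendsto (fun n => moll (kern d n) ψ x) Filter.atTop (nhds (ψ x)) := by
  simp only [moll_kern]
  -- The outer radius of each bump is twice the inner one; this fixed ratio is what Lebesgue
  -- differentiation needs.
  refine ContDiffBump.ae_convolution_tendsto_right_of_locallyIntegrable (K := 2)
    tendsto_one_div_add_atTop_nhds_zero_nat (.of_forall fun n => ?_) hψ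
  change 1 / ((n : ℝ) + 1) ≤ 2 * (1 / (2 * ((n : ℝ) + 1)))
  rw [← one_div_mul_one_div]
  linarith

lemma tendsto_moll {ψ : E d → ℝ} (hψ : Continuous ψ) (x : E d) :
    Filter.Tendsto (fun n => moll (kern d n) ψ x) Filter.atTop (nhds (ψ x)) := by
  simp only [moll_kern]
  exact ContDiffBump.convolution_tendsto_right_of_continuous
    tendsto_one_div_add_atTop_nhds_zero_nat hψ x

/-- The mollifications are Lipschitz uniformly in the scale and converge at every point because `ψ`
is continuous. -/
lemma MemB.exists_lipschitz {m : ℕ} {ψ : E d → ℝ} (hψ : MemB m ψ) (hm : 1 ≤ m) :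
    ∃ C : ℝ, 0 ≤ C ∧ ∀ x z, |ψ x - ψ z| ≤ C * ‖x - z‖ := by
  have hw := fun i => isGenDeriv_genDeriv ((hψ.hasGrad hm).2 i)
  choose C hC using fun i => (hw i).1.2
  refine ⟨∑ i, C i, Finset.sum_nonneg fun i _ => (abs_nonneg _).trans (hC i 0), fun x z => ?_⟩
  refine le_of_tendsto ((tendsto_moll hψ.1 x).sub (tendsto_moll hψ.1 z)).abs
    (.of_forall fun n => ?_)
  have hg := isKernel_kern (d := d) n
  have := SB.abs_sub_le (mollSB (kern d n) ψ) C (fun i y => ?_) x z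
  · rwa [mollSB_coe hg.test hψ.bddBorel] at this
  · rw [D_mollSB hg.test hψ.bddBorel (hw i)]
    exact abs_moll_le_of_isKernel hg (.of_forall (hC i)) y

/-! ### Classical derivatives are generalized derivatives -/

lemma SB.integral_mul_pderiv (φ : SB d) {χ : E d → ℝ} (hχ : IsTest χ) (i : Fin d) :
    ∫ x, φ x * pderiv i χ x = -∫ x, SB.D i φ x * χ x :=
  integral_mul_fderiv_eq_neg_fderiv_mul_of_integrable
    ((SB.bddBorel (SB.D i φ)).mul_integrable hχ.integrable)
    ((SB.bddBorel φ).mul_integrable (hχ.pderiv i).integrable)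
    ((SB.bddBorel φ).mul_integrable hχ.integrable)
    (fun x _ => SB.differentiable φ x) (fun x _ => hχ.1.differentiable (by simp) x)

lemma SB.integral_mul_fiter (φ : SB d) {χ : E d → ℝ} (hχ : IsTest χ) (w : List (Fin d)) :
    ∫ x, φ x * fiter w χ x = (-1 : ℝ) ^ w.length * ∫ x, iter SB.D w φ x * χ x := by
  induction w generalizing χ φ with
  | nil => simp [fiter, iter_nil]
  | cons i w ih =>
    rw [fiter, ih φ (hχ.pderiv i), SB.integral_mul_pderiv _ hχ, iter_cons,
      iter_commute (A := SB.D i) (fun j φ => SB.D_comm i j φ), List.length_cons, pow_succ]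
    ring

lemma SB.isGenDeriv (φ : SB d) (α : Fin d → ℕ) : IsGenDeriv α φ (mderiv α φ) := by
  refine ⟨?_, fun χ h1 h2 => ?_⟩
  · rw [mderiv_coe]; exact SB.bddBorel _
  · rw [mderiv_eq_fiter, SB.integral_mul_fiter φ ⟨h1, h2⟩, length_word, mderiv_coe]

section Kernel

variable {g : E d → ℝ}

lemma dd_mollSB (hg : IsTest g) {ψ : E d → ℝ} (hψ : HasGrad ψ) (l x : E d) :
    SB.dd l (mollSB g ψ) x = moll g (fun z => ∑ i, l i * genDeriv (unitIndex i) ψ z) x := by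
  rw [SB.dd_apply, moll_sum _ hg fun i _ => (isGenDeriv_genDeriv (hψ.2 i)).1.const_mul _]
  refine Finset.sum_congr rfl fun i _ => ?_
  rw [D_mollSB hg hψ.1 (isGenDeriv_genDeriv (hψ.2 i)), moll_const_mul]

lemma dd_mollSB_coe (hg : IsTest g) (φ : SB d) (l : E d) :
    SB.dd l (mollSB g φ) = mollSB g (SB.dd l φ) := by
  ext x
  have e : (SB.dd l φ : E d → ℝ) = fun z => ∑ i, l i * SB.D i φ z := funext (SB.dd_apply l φ)
  rw [mollSB_coe hg (SB.bddBorel _), e, SB.dd_apply,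
    moll_sum _ hg fun i _ => (SB.bddBorel _).const_mul _]
  refine Finset.sum_congr rfl fun i _ => ?_
  rw [moll_const_mul, D_mollSB hg (SB.bddBorel φ) (SB.isGenDeriv φ (unitIndex i)),
    mderiv_unitIndex]

lemma fd_mollSB_coe (hg : IsTest g) (φ : SB d) (h : ℝ) (l : E d) :
    SB.fd h l (mollSB g φ) = mollSB g (SB.fd h l φ) := by
  ext x
  rw [SB.fd_coe, mollSB_coe hg (SB.bddBorel _), mollSB_coe hg (SB.bddBorel _), SB.fd_coe,
    moll_fdiff hg (SB.bddBorel _)]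

lemma sd_mollSB_coe (hg : IsTest g) (φ : SB d) (h : ℝ) (l : E d) :
    SB.sd h l (mollSB g φ) = mollSB g (SB.sd h l φ) := by
  rw [SB.sd_eq, dd_mollSB_coe hg, fd_mollSB_coe hg]
  ext x
  have e : (SB.sd h l φ : E d → ℝ) = fun z => h⁻¹ * (SB.fd h l φ z - SB.dd l φ z) := rfl
  rw [mollSB_coe hg (SB.bddBorel _), e, moll_const_mul, moll_sub hg (SB.bddBorel _)
    (SB.bddBorel _), SB.smul_apply, SB.sub_apply, mollSB_coe hg (SB.bddBorel _),
    mollSB_coe hg (SB.bddBorel _)]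

end Kernel

/-! ### Discrete and classical operators -/

lemma SB.abs_sd_le {h : ℝ} (hh : 0 < h) {l : E d} {φ : SB d} {T : ℝ}
    (hT : ∀ z, |SB.dd l (SB.dd l φ) z| ≤ T) (x : E d) : |SB.sd h l φ x| ≤ T := by
  have h0 := (abs_nonneg _).trans (hT 0)
  refine abs_le'.2 ⟨SB.sd_le hh l φ T h0 (fun z => (le_abs_self _).trans (hT z)) x, ?_⟩
  have := SB.sd_le hh l (-φ) T h0 (fun z => by
    rw [map_neg, map_neg]; exact (neg_le_abs _).trans (hT z)) x
  rwa [map_neg] at this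

lemma SB.abs_fd_sub_dd_le {h : ℝ} (hh : 0 < h) {l : E d} {φ : SB d} {T : ℝ}
    (hT : ∀ z, |SB.dd l (SB.dd l φ) z| ≤ T) (x : E d) :
    |SB.fd h l φ x - SB.dd l φ x| ≤ T * h := by
  have e : SB.fd h l φ x - SB.dd l φ x = SB.sd h l φ x * h := by
    rw [SB.sd_eq, SB.smul_apply, SB.sub_apply]; field_simp
  rw [e, abs_mul, abs_of_pos hh]
  exact mul_le_mul_of_nonneg_right (SB.abs_sd_le hh hT x) hh.le

lemma SB.abs_sd_sub_le {h : ℝ} (hh : 0 < h) {l : E d} {φ : SB d} {T : ℝ}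
    (hT : ∀ z, |SB.dd l (SB.dd l (SB.dd l φ)) z| ≤ T) (x : E d) :
    |SB.sd h l φ x - 1 / 2 * SB.dd l (SB.dd l φ) x| ≤ T * h := by
  have hT0 := (abs_nonneg _).trans (hT 0)
  set b := SB.dd l (SB.dd l φ) x with hb
  -- Taylor expansion by mean values: after subtraction of the quadratic term the increment over
  -- `[0, h]` is expressed through `∂_l φ - b t`, and two further mean values reduce this to the
  -- third derivative.
  have hd : ∀ t, HasDerivAt (fun t : ℝ => φ (x + t • l) - 1 / 2 * b * t ^ 2)
      (SB.dd l φ (x + t • l) - b * t) t := fun t => by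
    refine ((SB.hasDerivAt_line φ x l t).fun_sub
      ((hasDerivAt_pow 2 t).const_mul (1 / 2 * b))).congr_deriv ?_
    push_cast; ring
  obtain ⟨t, ht, h1⟩ := exists_hasDerivAt_eq_slope _ _ hh
    (fun t _ => (hd t).continuousAt.continuousWithinAt) (fun t _ => hd t)
  obtain ⟨s, hs, h2⟩ := SB.exists_fd_eq ht.1 l (SB.dd l φ) x
  obtain ⟨r, -, h3⟩ := SB.exists_fd_eq hs.1 l (SB.dd l (SB.dd l φ)) x
  have ht0 := ht.1.ne'
  have hs0 := hs.1.ne'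
  rw [SB.fd_apply, inv_mul_eq_iff_eq_mul₀ ht0] at h2
  rw [SB.fd_apply, inv_mul_eq_iff_eq_mul₀ hs0] at h3
  have e : SB.sd h l φ x - 1 / 2 * b =
      h⁻¹ * (t * (s * SB.dd l (SB.dd l (SB.dd l φ)) (x + r • l))) := by
    rw [← h3, ← hb, mul_sub, ← h2, SB.sd_eq, SB.smul_apply, SB.sub_apply, SB.fd_apply]
    rw [eq_div_iff (by linarith)] at h1
    simp only [zero_smul, add_zero, sub_zero] at h1
    field_simp
    linear_combination (-2 : ℝ) * h1
  rw [e, abs_mul, abs_mul, abs_mul, abs_of_pos (inv_pos.2 hh), abs_of_pos ht.1, abs_of_pos hs.1,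
    inv_mul_le_iff₀ hh]
  calc t * (s * |SB.dd l (SB.dd l (SB.dd l φ)) (x + r • l)|) ≤ h * (h * T) :=
        mul_le_mul ht.2.le (mul_le_mul (hs.2.trans ht.2).le (hT _) (abs_nonneg _) hh.le)
          (mul_nonneg hs.1.le (abs_nonneg _)) hh.le
    _ = h * (T * h) := by ring

section Ops

variable (S : Data d)

/-- The index set of the terms of the operator `𝓛`. -/
abbrev Data.J := (S.Λ₁ ⊕ S.Λ₁) ⊕ Unit

/-- The coefficients of the operator `𝓛`. -/
def Data.coef : S.J → E d → ℝ
  | Sum.inl (Sum.inl l) => S.q l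
  | Sum.inl (Sum.inr l) => S.p l
  | Sum.inr _ => fun x => -S.c x

/-- The classical derivatives in the operator `𝓛`. -/
def Data.cop : S.J → SB d →ₗ[ℝ] SB d
  | Sum.inl (Sum.inl l) => (1 / 2 : ℝ) • (SB.dd (l : E d)).comp (SB.dd (l : E d))
  | Sum.inl (Sum.inr l) => SB.dd l
  | Sum.inr _ => LinearMap.id

/-- The difference quotients in the operator `L_h`. -/
def Data.dop (h : ℝ) : S.J → SB d →ₗ[ℝ] SB d
  | Sum.inl (Sum.inl l) => SB.sd h l
  | Sum.inl (Sum.inr l) => SB.fd h l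
  | Sum.inr _ => LinearMap.id

/-- The generalized derivatives in the operator `𝓛`. -/
def Data.gop (w : E d → ℝ) : S.J → E d → ℝ
  | Sum.inl (Sum.inl l) => fun x =>
      ∑ i, ∑ j, (1 / 2 * ((l : E d) i * (l : E d) j)) * genDeriv (unitIndex i + unitIndex j) w x
  | Sum.inl (Sum.inr l) => fun x => ∑ i, (l : E d) i * genDeriv (unitIndex i) w x
  | Sum.inr _ => w

variable {S}

lemma op_eq_sum_gop (w : E d → ℝ) (x : E d) : S.op w x = ∑ j, S.coef j x * S.gop w j x := by
  rw [Fintype.sum_sum_type, Fintype.sum_sum_type, Fintype.sum_unique (ι := Unit), Data.op,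
    ← Finset.sum_coe_sort S.Λ₁, ← Finset.sum_coe_sort S.Λ₁, Finset.mul_sum, sub_eq_add_neg]
  congr 1
  · congr 1
    · refine Finset.sum_congr rfl fun l _ => ?_
      simp only [Data.coef, Data.gop, Finset.mul_sum]
      refine Finset.sum_congr rfl fun i _ => Finset.sum_congr rfl fun j _ => ?_
      ring
    · refine Finset.sum_congr rfl fun l _ => ?_
      simp only [Data.coef, Data.gop, Finset.mul_sum]
      refine Finset.sum_congr rfl fun i _ => ?_
      ring
  · simp only [Data.coef, Data.gop]; ring

lemma abs_sub_sum_le {ι : Type*} [Fintype ι] {a b : ι → ℝ} {ρ : ℝ} (h : ∀ j, |a j - b j| ≤ ρ) :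
    |∑ j, a j - ∑ j, b j| ≤ Fintype.card ι * ρ := by
  rw [← Finset.sum_sub_distrib]
  refine (Finset.abs_sum_le_sum_abs _ _).trans ((Finset.sum_le_sum fun j _ => h j).trans ?_)
  simp

lemma dop_mollSB {g : E d → ℝ} (hg : IsTest g) (h : ℝ) (j : S.J) (φ : SB d) :
    S.dop h j (mollSB g φ) = mollSB g (S.dop h j φ) := by
  rcases j with (l | l) | _
  · exact sd_mollSB_coe hg φ h l
  · exact fd_mollSB_coe hg φ h l
  · rfl

lemma abs_dop_sub_cop_le {h : ℝ} (hh : 0 < h) {φ : SB d} {T : ℝ} (hT0 : 0 ≤ T)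
    (hT2 : ∀ l ∈ S.Λ₁, ∀ z, |SB.dd l (SB.dd l φ) z| ≤ T)
    (hT3 : ∀ l ∈ S.Λ₁, ∀ z, |SB.dd l (SB.dd l (SB.dd l φ)) z| ≤ T) (j : S.J) (x : E d) :
    |S.dop h j φ x - S.cop j φ x| ≤ T * h := by
  rcases j with (l | l) | _
  · exact SB.abs_sd_sub_le hh (hT3 l l.2) x
  · exact SB.abs_fd_sub_dd_le hh (hT2 l l.2) x
  · simpa [Data.dop, Data.cop] using mul_nonneg hT0 hh.le

lemma bddBorel_gop {w : E d → ℝ} (hw : MemB 2 w) (j : S.J) : BddBorel (S.gop w j) := by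
  rcases j with (l | l) | _
  · exact BddBorel.sum fun i _ => BddBorel.sum fun j _ => (hw.genDeriv (by
      simp only [Pi.add_apply, Finset.sum_add_distrib, sum_unitIndex]; omega)).1.const_mul _
  · exact BddBorel.sum fun i _ => (hw.genDeriv (by
      rw [sum_unitIndex]; omega)).1.const_mul _
  · exact hw.bddBorel

lemma cop_mollSB {g : E d → ℝ} (hg : IsTest g) {w : E d → ℝ} (hw : MemB 2 w) (j : S.J) (x : E d) :
    S.cop j (mollSB g w) x = moll g (S.gop w j) x := by
  rcases j with (l | l) | _
  · have h2 : ∀ i k : Fin d, ∑ a, (unitIndex i + unitIndex k) a ≤ 2 := fun i k => by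
      simp only [Pi.add_apply, Finset.sum_add_distrib, sum_unitIndex]; omega
    change 1 / 2 * SB.dd l (SB.dd l (mollSB g w)) x = _
    rw [Data.gop, moll_sum _ hg fun i _ => BddBorel.sum fun k _ => (hw.genDeriv
      (h2 i k)).1.const_mul _, SB.dd_apply, Finset.mul_sum]
    refine Finset.sum_congr rfl fun i _ => ?_
    rw [moll_sum _ hg fun k _ => (hw.genDeriv (h2 i k)).1.const_mul _, ← SB.dd_D, SB.dd_apply,
      Finset.mul_sum, Finset.mul_sum]
    refine Finset.sum_congr rfl fun k _ => ?_
    rw [moll_const_mul, ← mderiv_moll hg hw.bddBorel (hw.genDeriv (h2 i k)),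
      ← mollSB_coe hg hw.bddBorel, mderiv_eq_of_count (w := [i, k])]
    · simp only [iter_cons, iter_nil]; ring
    · intro a
      simp only [Pi.add_apply, unitIndex, Pi.single_apply, List.count_cons, List.count_nil,
        beq_iff_eq, eq_comm (a := a)]
      ring
  · exact dd_mollSB hg (hw.hasGrad (by omega)) l x
  · exact congrFun (mollSB_coe hg hw.bddBorel) x

end Ops

/-! ### Consistency of the schemes with the differential operator -/

lemma SB.exists_uniform_bound {ι : Type*} [Fintype ι] (F : ι → SB d) :
    ∃ C : ℝ, 0 ≤ C ∧ ∀ i x, |F i x| ≤ C := by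
  choose C hC using fun i => SB.exists_bound (F i)
  have h0 : ∀ i, 0 ≤ C i := fun i => (abs_nonneg _).trans (hC i 0)
  exact ⟨∑ i, C i, Finset.sum_nonneg fun i _ => h0 i, fun i x =>
    (hC i x).trans (Finset.single_le_sum (fun j _ => h0 j) (Finset.mem_univ i))⟩

/-- The constant depends on the kernel and on the vectors only, being built from the `L¹` norms of
iterated derivatives of the kernel; uniformity in `ψ` is the point. -/
lemma exists_dd_mollSB_bound {g : E d → ℝ} (hg : IsTest g) (L : Finset (E d)) :
    ∃ C : ℝ, 0 ≤ C ∧ ∀ (ψ : E d → ℝ) (V : ℝ), BddBorel ψ → (∀ x, |ψ x| ≤ V) → ∀ l ∈ L, ∀ x,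
      |SB.dd l (mollSB g ψ) x| ≤ C * V ∧ |SB.dd l (SB.dd l (mollSB g ψ)) x| ≤ C * V ∧
      |SB.dd l (SB.dd l (SB.dd l (mollSB g ψ))) x| ≤ C * V := by
  choose! T hT hT' using fun (g : E d → ℝ) (hg : IsTest g) => exists_test_dd hg
  let I : E d → ℕ → ℝ := fun l n => ∫ x, |(fun g => T g l)^[n] g x|
  have hI : ∀ l n, 0 ≤ I l n := fun l n => integral_nonneg fun x => abs_nonneg _
  have hS : ∀ l, 0 ≤ ∑ n ∈ Finset.range 4, I l n := fun l => Finset.sum_nonneg fun n _ => hI l n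
  refine ⟨∑ l ∈ L, ∑ n ∈ Finset.range 4, I l n, Finset.sum_nonneg fun l _ => hS l,
    fun ψ V hψ hV l hl x => ?_⟩
  have hV0 := (abs_nonneg _).trans (hV 0)
  have key : ∀ n < 4, IsTest ((fun g => T g l)^[n] g) →
      |mollSB ((fun g => T g l)^[n] g) ψ x| ≤ (∑ l ∈ L, ∑ n ∈ Finset.range 4, I l n) * V := by
    intro n hn ht
    rw [mollSB_coe ht hψ, mul_comm]
    refine (abs_moll_le ht V (.of_forall hV) x).trans (mul_le_mul_of_nonneg_left ?_ hV0)
    exact (Finset.single_le_sum (fun n _ => hI l n) (Finset.mem_range.2 hn)).trans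
      (Finset.single_le_sum (f := fun l => ∑ n ∈ Finset.range 4, I l n) (fun l _ => hS l) hl)
  have t1 := hT g hg l
  have t2 := hT _ t1 l
  have t3 := hT _ t2 l
  rw [hT' g hg l ψ hψ, hT' _ t1 l ψ hψ, hT' _ t2 l ψ hψ]
  exact ⟨key 1 (by norm_num) t1, key 2 (by norm_num) t2, key 3 (by norm_num) t3⟩

lemma abs_mul_sub_mul_le {a b a' b' η A X ρ : ℝ} (h1 : |a - a'| ≤ η) (h2 : |b| ≤ A)
    (h3 : |a'| ≤ X) (h4 : |b - b'| ≤ ρ) : |a * b - a' * b'| ≤ η * A + X * ρ := by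
  have e : a * b - a' * b' = (a - a') * b + a' * (b - b') := by ring
  rw [e]
  refine (abs_add_le _ _).trans ?_
  rw [abs_mul, abs_mul]
  exact add_le_add (mul_le_mul h1 h2 (abs_nonneg _) ((abs_nonneg _).trans h1))
    (mul_le_mul h3 h4 (abs_nonneg _) ((abs_nonneg _).trans h3))

section Consistency

variable {S : Data d} {m : ℕ} {h₀ τ₀ δ K c₀ : ℝ} {M : Fin (m + 1) → ℝ} {f : E d → ℝ}

lemma Data.Regular.coef_regular (hR : S.Regular m M f) (j : S.J) :
    BddBorel (S.coef j) ∧ (1 ≤ m → ∃ C : ℝ, 0 ≤ C ∧ ∀ x z, |S.coef j x - S.coef j z| ≤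
      C * ‖x - z‖) := by
  rcases j with (l | l) | _
  · exact ⟨(hR.q_mem l l.2).bddBorel, (hR.q_mem l l.2).exists_lipschitz⟩
  · exact ⟨(hR.p_mem l l.2).bddBorel, (hR.p_mem l l.2).exists_lipschitz⟩
  · refine ⟨(congrArg BddBorel (funext fun x => neg_one_mul (S.c x))).mp
      (hR.c_mem.bddBorel.const_mul (-1)), fun hm => ?_⟩
    obtain ⟨C, h0, hC⟩ := hR.c_mem.exists_lipschitz hm
    refine ⟨C, h0, fun x z => ?_⟩
    simpa only [Data.coef, ← neg_sub', abs_neg] using hC x z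

lemma Data.Regular.exists_coef_bound (hR : S.Regular m M f) (hm : 1 ≤ m) :
    ∃ Γ X : ℝ, 0 ≤ Γ ∧ 0 ≤ X ∧ (∀ j x, |S.coef j x| ≤ X) ∧
      (∀ j x z, |S.coef j x - S.coef j z| ≤ Γ * ‖x - z‖) ∧ ∀ x z, |f x - f z| ≤ Γ * ‖x - z‖ := by
  choose X hX using fun j => (hR.coef_regular j).1.2
  choose Γ hΓ0 hΓ using fun j => (hR.coef_regular j).2 hm
  obtain ⟨C, hC0, hC⟩ := hR.f_mem.exists_lipschitz hm
  have hX0 : ∀ j, 0 ≤ X j := fun j => (abs_nonneg _).trans (hX j 0)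
  have hs : 0 ≤ ∑ j, Γ j := Finset.sum_nonneg fun j _ => hΓ0 j
  refine ⟨∑ j, Γ j + C, ∑ j, X j, by positivity, Finset.sum_nonneg fun j _ => hX0 j,
    fun j x => (hX j x).trans (Finset.single_le_sum (fun j _ => hX0 j) (Finset.mem_univ j)),
    fun j x z => (hΓ j x z).trans (mul_le_mul_of_nonneg_right ?_ (norm_nonneg _)),
    fun x z => (hC x z).trans (mul_le_mul_of_nonneg_right (by linarith) (norm_nonneg _))⟩
  exact (Finset.single_le_sum (fun j _ => hΓ0 j) (Finset.mem_univ j)).trans (by linarith)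

/-- The operator `𝓛` on smooth functions. -/
def Data.clOp (S : Data d) (φ : SB d) (x : E d) : ℝ := ∑ j, S.coef j x * S.cop j φ x

/-- The scheme with mesh size `h₀ / (k + 1)` and coefficients mollified at scale `1 / (k + 1)`. -/
abbrev approxScheme (S : Data d) (τ₀ h₀ : ℝ) (k : ℕ) : SmoothScheme d :=
  mollScheme S (kern d k) τ₀ (h₀ / ((k : ℝ) + 1))

lemma approxScheme_admissible (hS : S.Admissible m h₀ τ₀ δ K c₀ M f)
    (hm : 2 ≤ m) (hδ1 : δ ≤ 1) (hK : 0 ≤ K) (hτ₀ : 0 < τ₀) (hc₀ : 0 < c₀) (hh₀ : 0 < h₀) (k : ℕ) :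
    (approxScheme S τ₀ h₀ k).Admissible m δ K c₀ (S.size ^ 2) (S.wsize ^ 2)
      (∑ k : Fin (m + 1), ((k : ℕ).factorial : ℝ) * M k ^ 2) :=
  mollScheme_admissible (isKernel_kern k) hS hm hδ1 hK hτ₀ hc₀ (by positivity)
    (div_le_self hh₀.le (by linarith [Nat.cast_nonneg (α := ℝ) k]))

/-- By the balance condition `h⁻¹ Σ q_l ∂_l φ = 0` may be subtracted, which replaces the singular
first-order quotients by `sd`, the approximation of `½ ∂_l²`. -/
lemma mollScheme_op_eq {g : E d → ℝ} (hg : IsTest g) (hR : S.Regular m M f) {h : ℝ} (hh : h ≠ 0)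
    (hb : ∀ i, ∑ l : S.Λ₁, (l : E d) i • mollSB g (S.q l) = 0) (φ : SB d) (x : E d) :
    (mollScheme S g τ₀ h).op φ x = ∑ j, moll g (S.coef j) x * S.dop h j φ x := by
  have hq := fun l : S.Λ₁ => (hR.q_mem l l.2).bddBorel
  have hp := fun l : S.Λ₁ => (hR.p_mem l l.2).bddBorel
  change (∑ l : S.Λ₁, (mollSB g (S.q l) + h • mollSB g (S.p l)) * (h⁻¹ • SB.fd h (l : E d) φ) -
    mollSB g S.c * φ : SB d) x = _
  rw [Fintype.sum_sum_type, Fintype.sum_sum_type, Fintype.sum_unique (ι := Unit), SB.sub_apply,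
    SB.sum_apply, sub_eq_add_neg]
  congr 1
  · have hz : ∑ l : S.Λ₁, mollSB g (S.q l) x * SB.dd (l : E d) φ x = 0 := by
      simp only [SB.dd_apply, Finset.mul_sum]
      rw [Finset.sum_comm]
      refine Finset.sum_eq_zero fun i _ => ?_
      have h1 := congrArg (fun ψ : SB d => ψ x) (hb i)
      simp only [SB.sum_apply, SB.smul_apply, SB.zero_apply] at h1
      calc ∑ l : S.Λ₁, mollSB g (S.q l) x * ((l : E d) i * SB.D i φ x)
          = (∑ l : S.Λ₁, (l : E d) i * mollSB g (S.q l) x) * SB.D i φ x := by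
            rw [Finset.sum_mul]; exact Finset.sum_congr rfl fun l _ => by ring
        _ = 0 := by rw [h1, zero_mul]
    rw [← Finset.sum_add_distrib, ← sub_eq_zero, ← mul_zero h⁻¹, ← hz, Finset.mul_sum,
      ← Finset.sum_sub_distrib]
    refine Finset.sum_congr rfl fun l _ => ?_
    simp only [Data.coef, Data.dop, ← mollSB_coe hg (hq l), ← mollSB_coe hg (hp l), SB.sd_eq,
      SB.mul_apply, SB.add_apply, SB.smul_apply, SB.sub_apply]
    field_simp
    ring
  · have h1 : moll g (S.coef (Sum.inr default)) x = -mollSB g S.c x := by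
      rw [mollSB_coe hg hR.c_mem.bddBorel, ← neg_one_mul, ← moll_const_mul]
      congr 1
      ext z
      simp [Data.coef]
    rw [h1, SB.mul_apply, neg_mul]; rfl

lemma approxScheme_op_eq (hS : S.Admissible m h₀ τ₀ δ K c₀ M f)
    (hm : 2 ≤ m) (hδ1 : δ ≤ 1) (hK : 0 ≤ K) (hτ₀ : 0 < τ₀) (hc₀ : 0 < c₀) (hh₀ : 0 < h₀) (k : ℕ)
    (φ : SB d) (x : E d) : (approxScheme S τ₀ h₀ k).op φ x =
      ∑ j, moll (kern d k) (S.coef j) x * S.dop (h₀ / ((k : ℝ) + 1)) j φ x :=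
  mollScheme_op_eq (isKernel_kern k).test hS.regular (by positivity)
    (approxScheme_admissible hS hm hδ1 hK hτ₀ hc₀ hh₀ k).balanced φ x

lemma abs_moll_kern_sub_le {k : E d → ℝ} (hk : BddBorel k) {Γ : ℝ} (hΓ0 : 0 ≤ Γ)
    (hΓ : ∀ x z, |k x - k z| ≤ Γ * ‖x - z‖) (n : ℕ) (x : E d) :
    |moll (kern d n) k x - k x| ≤ Γ * (1 / ((n : ℝ) + 1)) :=
  abs_moll_sub_le (isKernel_kern n) hk fun z hz => (abs_sub_comm _ _).trans_le
    ((hΓ x z).trans (mul_le_mul_of_nonneg_left hz.le hΓ0))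

/-- The maximum principle for `𝓛` on smooth functions. -/
lemma le_of_clOp_ge (hS : S.Admissible m h₀ τ₀ δ K c₀ M f)
    (hm : 2 ≤ m) (hδ1 : δ ≤ 1) (hK : 0 ≤ K) (hτ₀ : 0 < τ₀) (hc₀ : 0 < c₀) (hh₀ : 0 < h₀)
    (φ : SB d) {κ : ℝ} (hκ : 0 ≤ κ) (h : ∀ x, -κ ≤ S.clOp φ x) (x : E d) : φ x ≤ κ / c₀ := by
  obtain ⟨Γ, X, hΓ0, hX0, hX, hΓ, -⟩ := hS.regular.exists_coef_bound (by omega)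
  obtain ⟨T, hT0, hT⟩ := SB.exists_uniform_bound (Sum.elim
    (fun l : S.Λ₁ => SB.dd (l : E d) (SB.dd (l : E d) φ))
    (fun l : S.Λ₁ => SB.dd (l : E d) (SB.dd (l : E d) (SB.dd (l : E d) φ))))
  obtain ⟨A, hA0, hA⟩ := SB.exists_uniform_bound fun j => S.cop j φ
  set R := (Fintype.card S.J : ℝ) * (Γ * (A + T * h₀) + X * (T * h₀)) with hR
  have hR0 : 0 ≤ R := by positivity
  -- For a fixed smooth `φ` both the mollification of the coefficients and the discretization change
  -- the operator by `O(1 / (n + 1))`, so the discrete maximum principle applies with a slightly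
  -- larger defect.
  have key : ∀ n : ℕ, φ x ≤ (κ + R * (1 / ((n : ℝ) + 1))) / c₀ := by
    intro n
    have hadm := approxScheme_admissible hS hm hδ1 hK hτ₀ hc₀ hh₀ n
    refine SmoothScheme.le_of_op_ge hadm.χ_nonneg hc₀ hadm.c_lower φ _ (by positivity)
      (fun y => ?_) x
    have hh : 0 < h₀ / ((n : ℝ) + 1) := by positivity
    have hhle : h₀ / ((n : ℝ) + 1) ≤ h₀ :=
      div_le_self hh₀.le (by linarith [Nat.cast_nonneg (α := ℝ) n])
    rw [approxScheme_op_eq hS hm hδ1 hK hτ₀ hc₀ hh₀]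
    have hdc := fun j => abs_dop_sub_cop_le (S := S) (φ := φ) hh hT0
      (fun l hl z => hT (Sum.inl ⟨l, hl⟩) z) (fun l hl z => hT (Sum.inr ⟨l, hl⟩) z) j y
    have h1 : |∑ j, moll (kern d n) (S.coef j) y * S.dop (h₀ / ((n : ℝ) + 1)) j φ y -
        S.clOp φ y| ≤ R * (1 / ((n : ℝ) + 1)) := by
      refine (abs_sub_sum_le fun j => abs_mul_sub_mul_le (A := A + T * h₀)
        (abs_moll_kern_sub_le (hS.regular.coef_regular j).1 hΓ0 (hΓ j) n y) ?_ (hX j y)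
        (hdc j)).trans (le_of_eq ?_)
      · have h2 := abs_sub_abs_le_abs_sub (S.dop (h₀ / ((n : ℝ) + 1)) j φ y) (S.cop j φ y)
        have h3 := mul_le_mul_of_nonneg_left hhle hT0
        linarith [hdc j, hA j y]
      · rw [hR]; ring
    linarith [h y, (abs_le.1 h1).1]
  have hlim : Filter.Tendsto (fun n : ℕ => (κ + R * (1 / ((n : ℝ) + 1))) / c₀) Filter.atTop
      (nhds ((κ + R * 0) / c₀)) :=
    ((tendsto_one_div_add_atTop_nhds_zero_nat.const_mul R).const_add κ).div_const c₀
  rw [mul_zero, add_zero] at hlim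
  exact ge_of_tendsto' hlim key

lemma clOp_sub (φ ψ : SB d) (x : E d) : S.clOp (φ - ψ) x = S.clOp φ x - S.clOp ψ x := by
  simp only [Data.clOp, map_sub, SB.sub_apply, mul_sub, Finset.sum_sub_distrib]

lemma abs_sub_le_of_clOp (hS : S.Admissible m h₀ τ₀ δ K c₀ M f)
    (hm : 2 ≤ m) (hδ1 : δ ≤ 1) (hK : 0 ≤ K) (hτ₀ : 0 < τ₀) (hc₀ : 0 < c₀) (hh₀ : 0 < h₀)
    {φ ψ : SB d} {κ κ' : ℝ} (h : ∀ x, |S.clOp φ x + f x| ≤ κ)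
    (h' : ∀ x, |S.clOp ψ x + f x| ≤ κ') (x : E d) : |φ x - ψ x| ≤ (κ + κ') / c₀ := by
  have h1 := (abs_nonneg _).trans (h 0)
  have h2 := (abs_nonneg _).trans (h' 0)
  refine abs_le'.2 ⟨?_, ?_⟩
  · refine le_of_clOp_ge hS hm hδ1 hK hτ₀ hc₀ hh₀ (φ - ψ) (add_nonneg h1 h2) (fun y => ?_) x
    rw [clOp_sub]
    linarith [(abs_le.1 (h y)).1, (abs_le.1 (h' y)).2]
  · rw [neg_sub]
    refine le_of_clOp_ge hS hm hδ1 hK hτ₀ hc₀ hh₀ (ψ - φ) (add_nonneg h1 h2) (fun y => ?_) x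
    rw [clOp_sub]
    linarith [(abs_le.1 (h y)).2, (abs_le.1 (h' y)).1]

/-- Mollifications of a function in `𝔅²` almost commute with `𝓛`. -/
lemma exists_moll_op_bound (hR : S.Regular m M f) (hm : 1 ≤ m) {w : E d → ℝ} (hw : MemB 2 w) :
    ∃ C : ℝ, 0 ≤ C ∧ ∀ (n : ℕ) (x : E d),
      |moll (kern d n) (fun z => S.op w z + f z) x - (S.clOp (mollSB (kern d n) w) x + f x)| ≤
        C * (1 / ((n : ℝ) + 1)) ∧ |moll (kern d n) w x - w x| ≤ C * (1 / ((n : ℝ) + 1)) := by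
  obtain ⟨Γ, X, hΓ0, -, -, hΓ, hf⟩ := hR.exists_coef_bound hm
  obtain ⟨Cw, hCw0, hCw⟩ := hw.exists_lipschitz (by omega)
  choose A hA using fun j => (bddBorel_gop (S := S) hw j).2
  have hA0 : ∀ j, 0 ≤ A j := fun j => (abs_nonneg _).trans (hA j 0)
  have hAs : ∀ j x, |S.gop w j x| ≤ ∑ j, A j := fun j x =>
    (hA j x).trans (Finset.single_le_sum (fun j _ => hA0 j) (Finset.mem_univ j))
  have hA0 : 0 ≤ ∑ j, A j := Finset.sum_nonneg fun j _ => hA0 j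
  refine ⟨Fintype.card S.J * (Γ * ∑ j, A j) + Γ + Cw, by positivity, fun n x => ⟨?_, ?_⟩⟩
  · have hg := isKernel_kern (d := d) n
    have hprod := fun j => (hR.coef_regular j).1.mul (bddBorel_gop (S := S) hw j)
    have e : moll (kern d n) (fun z => S.op w z + f z) x =
        ∑ j, moll (kern d n) (fun z => S.coef j z * S.gop w j z) x + moll (kern d n) f x := by
      simp only [op_eq_sum_gop]
      rw [moll_add hg.test (BddBorel.sum fun j _ => hprod j) hR.f_mem.bddBorel,
        moll_sum _ hg.test fun j _ => hprod j]
    have h1 : |∑ j, moll (kern d n) (fun z => S.coef j z * S.gop w j z) x -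
        S.clOp (mollSB (kern d n) w) x| ≤
        Fintype.card S.J * (Γ * (1 / ((n : ℝ) + 1)) * ∑ j, A j) := by
      refine abs_sub_sum_le fun j => ?_
      rw [cop_mollSB hg.test hw]
      exact abs_moll_mul_sub_le hg (hR.coef_regular j).1 (bddBorel_gop hw j) (hAs j) fun z hz =>
        (abs_sub_comm _ _).trans_le ((hΓ j x z).trans (mul_le_mul_of_nonneg_left hz.le hΓ0))
    have h2 := abs_moll_kern_sub_le hR.f_mem.bddBorel hΓ0 hf n x
    have h3 : 0 ≤ Cw * (1 / ((n : ℝ) + 1)) := by positivity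
    rw [e, add_sub_add_comm]
    refine (abs_add_le _ _).trans ((add_le_add h1 h2).trans ?_)
    linarith
  · refine (abs_moll_kern_sub_le hw.bddBorel hCw0 hCw n x).trans ?_
    refine mul_le_mul_of_nonneg_right ?_ (by positivity)
    have : 0 ≤ (Fintype.card S.J : ℝ) * (Γ * ∑ j, A j) := by positivity
    linarith

end Consistency

/-! ### Convergence of the schemes -/

section Convergence

variable {S : Data d} {m : ℕ} {h₀ τ₀ δ K c₀ : ℝ} {M : Fin (m + 1) → ℝ} {f : E d → ℝ}

lemma abs_le_one_add_of_sq_le {a b : ℝ} (h : a ^ 2 ≤ b) : |a| ≤ 1 + b := by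
  nlinarith [sq_abs a, sq_nonneg (|a| - 1)]

lemma abs_dop_le {h : ℝ} (hh : 0 < h) {v : SB d} {F : ℝ}
    (hv : ∀ j ≤ 2, ∀ x, wsum j (fun w => iter SB.D w v x ^ 2) ≤ F) (j : S.J) (x : E d) :
    |S.dop h j v x| ≤ 1 + F * (1 + ∑ l ∈ S.Λ₁, (‖l‖ ^ 2 + ‖l‖ ^ 4)) := by
  have h0 : ∀ x, v x ^ 2 ≤ F := fun x => by simpa [wsum_zero] using hv 0 (by norm_num) x
  have h1 : ∀ x, ∑ i, SB.D i v x ^ 2 ≤ F := fun x => by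
    simpa [wsum_zero, wsum_succ] using hv 1 (by norm_num) x
  have h2 : ∀ x, ∑ i, ∑ j, SB.D j (SB.D i v) x ^ 2 ≤ F := fun x => by
    simpa [wsum_zero, wsum_succ] using hv 2 le_rfl x
  have hF : 0 ≤ F := (sq_nonneg _).trans (h0 0)
  have hnn : ∀ l : E d, 0 ≤ ‖l‖ ^ 2 + ‖l‖ ^ 4 := fun l => by positivity
  have hs : ∀ l ∈ S.Λ₁, ‖l‖ ^ 2 + ‖l‖ ^ 4 ≤ ∑ l ∈ S.Λ₁, (‖l‖ ^ 2 + ‖l‖ ^ 4) := fun l hl =>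
    Finset.single_le_sum (f := fun l => ‖l‖ ^ 2 + ‖l‖ ^ 4) (fun l _ => hnn l) hl
  have hs0 : 0 ≤ ∑ l ∈ S.Λ₁, (‖l‖ ^ 2 + ‖l‖ ^ 4) := Finset.sum_nonneg fun l _ => hnn l
  refine abs_le_one_add_of_sq_le ?_
  rcases j with (l | l) | _
  · have := SB.sum_sq_sd_le (β := Unit) hh (l : E d) (fun _ => v) F (fun z => by
      simpa using h2 z) x
    simp only [Finset.univ_unique, Finset.sum_singleton] at this
    refine this.trans ?_
    rw [mul_comm]
    exact mul_le_mul_of_nonneg_left (by linarith [hs l l.2, sq_nonneg ‖(l : E d)‖]) hF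
  · have := SB.sum_sq_fd_le (β := Unit) hh (l : E d) (fun _ => v) F (fun z => by
      simpa using h1 z) x
    simp only [Finset.univ_unique, Finset.sum_singleton] at this
    refine this.trans ?_
    rw [mul_comm]
    exact mul_le_mul_of_nonneg_left (by
      linarith [hs l l.2, pow_nonneg (norm_nonneg (l : E d)) 4]) hF
  · exact (h0 x).trans (le_mul_of_one_le_right hF (by linarith))

/-- Only two derivatives of `v` are bounded uniformly in `k`, one too few for the consistency of the
scheme with `𝓛`. Hence `v` is mollified at scale `1 / (n + 1)`: the commutator with the Lipschitz
coefficients costs `C / (n + 1)` with `C` independent of `n` and `k`, while the discretization error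
of the smooth function costs `C' / (k + 1)`, where `C'` may blow up with `n`. -/
lemma exists_approx_bound (hS : S.Admissible m h₀ τ₀ δ K c₀ M f)
    (hm : 2 ≤ m) (hδ1 : δ ≤ 1) (hK : 0 ≤ K) (hτ₀ : 0 < τ₀) (hc₀ : 0 < c₀) (hh₀ : 0 < h₀)
    {F : ℝ} (hF : 0 ≤ F) : ∃ C : ℝ, 0 ≤ C ∧ ∀ n : ℕ, ∃ C' : ℝ, 0 ≤ C' ∧ ∀ (k : ℕ) (v : SB d),
      (approxScheme S τ₀ h₀ k).op v + mollSB (kern d k) f = 0 →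
      (∀ j ≤ 2, ∀ x, wsum j (fun w => iter SB.D w v x ^ 2) ≤ F) → ∀ x,
      |S.clOp (mollSB (kern d n) v) x + f x| ≤ C * (1 / ((n : ℝ) + 1)) + C' * (1 / ((k : ℝ) + 1)) ∧
      |mollSB (kern d n) v x - v x| ≤ C * (1 / ((n : ℝ) + 1)) := by
  obtain ⟨Γ, X, hΓ0, hX0, hX, hΓ, hf⟩ := hS.regular.exists_coef_bound (by omega)
  set A := 1 + F * (1 + ∑ l ∈ S.Λ₁, (‖l‖ ^ 2 + ‖l‖ ^ 4)) with hA
  have hA0 : 0 ≤ A := by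
    have : 0 ≤ ∑ l ∈ S.Λ₁, (‖l‖ ^ 2 + ‖l‖ ^ 4) := Finset.sum_nonneg fun l _ => by positivity
    positivity
  set J := (Fintype.card S.J : ℝ) with hJ
  refine ⟨J * (Γ * A) + Γ + d * (1 + F), by positivity, fun n => ?_⟩
  have hg := isKernel_kern (d := d) n
  obtain ⟨T, hT0, hT⟩ := exists_dd_mollSB_bound hg.test S.Λ₁
  refine ⟨J * (Γ * A + X * (T * (1 + F) * h₀)) + Γ, by positivity, fun k v hv hFv x => ⟨?_, ?_⟩⟩
  · have hgk := isKernel_kern (d := d) k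
    have hh : 0 < h₀ / ((k : ℝ) + 1) := by positivity
    have hcoef := fun j => (hS.regular.coef_regular j).1
    have hv0 : ∀ x, |v x| ≤ 1 + F := fun x => abs_le_one_add_of_sq_le (by
      simpa [wsum_zero] using hFv 0 (by norm_num) x)
    have hcm : ∀ j, BddBorel (moll (kern d k) (S.coef j)) := fun j =>
      mollSB_coe hgk.test (hcoef j) ▸ SB.bddBorel _
    have hfm : BddBorel (moll (kern d k) f) :=
      mollSB_coe hgk.test hS.regular.f_mem.bddBorel ▸ SB.bddBorel _
    have hprod := fun j => (hcm j).mul (SB.bddBorel (S.dop (h₀ / ((k : ℝ) + 1)) j v))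
    have e0 : ∀ z, ∑ j, moll (kern d k) (S.coef j) z * S.dop (h₀ / ((k : ℝ) + 1)) j v z +
        moll (kern d k) f z = 0 := fun z => by
      rw [← approxScheme_op_eq hS hm hδ1 hK hτ₀ hc₀ hh₀, ← mollSB_coe hgk.test
        hS.regular.f_mem.bddBorel]
      exact congrArg (fun ψ : SB d => ψ z) hv
    have e1 : ∑ j, moll (kern d n) (fun z => moll (kern d k) (S.coef j) z *
        S.dop (h₀ / ((k : ℝ) + 1)) j v z) x + moll (kern d n) (moll (kern d k) f) x = 0 := by
      rw [← moll_sum _ hg.test fun j _ => hprod j,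
        ← moll_add hg.test (BddBorel.sum fun j _ => hprod j) hfm]
      simp only [e0]
      exact moll_const hg 0 x
    have hmod : ∀ {κ : E d → ℝ}, BddBorel κ → (∀ x z, |κ x - κ z| ≤ Γ * ‖x - z‖) → ∀ z,
        ‖x - z‖ < 1 / ((n : ℝ) + 1) → |moll (kern d k) κ z - κ x| ≤
          Γ * (1 / ((k : ℝ) + 1)) + Γ * (1 / ((n : ℝ) + 1)) := by
      intro κ hκ hκΓ z hz
      refine (abs_sub_le _ (κ z) _).trans (add_le_add (abs_moll_kern_sub_le hκ hΓ0 hκΓ k z) ?_)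
      rw [abs_sub_comm]
      exact (hκΓ x z).trans (mul_le_mul_of_nonneg_left hz.le hΓ0)
    have h1 : |∑ j, moll (kern d n) (fun z => moll (kern d k) (S.coef j) z *
        S.dop (h₀ / ((k : ℝ) + 1)) j v z) x - S.clOp (mollSB (kern d n) v) x| ≤
        J * ((Γ * (1 / ((k : ℝ) + 1)) + Γ * (1 / ((n : ℝ) + 1))) * A +
          X * (T * (1 + F) * (h₀ / ((k : ℝ) + 1)))) := by
      refine abs_sub_sum_le fun j => ?_
      -- The intermediate quantity has the unmollified coefficient frozen at `x`. The first
      -- difference is a commutator and needs only bounds on the difference quotients of `v`; the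
      -- second is the consistency error of the mollified `v`.
      refine (abs_sub_le _ (S.coef j x * moll (kern d n) (S.dop (h₀ / ((k : ℝ) + 1)) j v) x)
        _).trans (add_le_add ?_ ?_)
      · exact abs_moll_mul_sub_le hg (hcm j) (SB.bddBorel _) (abs_dop_le hh hFv j)
          (hmod (hcoef j) (hΓ j))
      · rw [← mul_sub, abs_mul, ← mollSB_coe hg.test (SB.bddBorel _), ← dop_mollSB hg.test]
        refine mul_le_mul (hX j x) ?_ (abs_nonneg _) hX0
        exact abs_dop_sub_cop_le hh (by positivity)
          (fun l hl z => (hT v _ (SB.bddBorel v) hv0 l hl z).2.1)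
          (fun l hl z => (hT v _ (SB.bddBorel v) hv0 l hl z).2.2) j x
    have h2 := abs_moll_sub_le hg hfm (hmod hS.regular.f_mem.bddBorel hf)
    have e2 : S.clOp (mollSB (kern d n) v) x + f x =
        -((∑ j, moll (kern d n) (fun z => moll (kern d k) (S.coef j) z *
          S.dop (h₀ / ((k : ℝ) + 1)) j v z) x - S.clOp (mollSB (kern d n) v) x) +
        (moll (kern d n) (moll (kern d k) f) x - f x)) := by linarith
    have h3 : 0 ≤ (d : ℝ) * (1 + F) * (1 / ((n : ℝ) + 1)) := by positivity
    rw [e2, abs_neg]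
    refine (abs_add_le _ _).trans ((add_le_add h1 h2).trans ?_)
    rw [div_eq_mul_one_div h₀]
    linarith
  · rw [mollSB_coe hg.test (SB.bddBorel v)]
    have h1 : ∀ x z, |v x - v z| ≤ d * (1 + F) * ‖x - z‖ := fun x z => by
      have := SB.abs_sub_le v (fun _ => 1 + F) (fun i z => abs_le_one_add_of_sq_le ?_) x z
      · simpa only [Finset.sum_const, Finset.card_univ, Fintype.card_fin, nsmul_eq_mul] using this
      · have h2 : ∑ i, SB.D i v z ^ 2 ≤ F := by
          simpa [wsum_zero, wsum_succ] using hFv 1 (by norm_num) z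
        exact (Finset.single_le_sum (f := fun i => SB.D i v z ^ 2) (fun i _ => sq_nonneg _)
          (Finset.mem_univ i)).trans h2
    refine (abs_moll_kern_sub_le (SB.bddBorel v) (by positivity) h1 n x).trans ?_
    refine mul_le_mul_of_nonneg_right ?_ (by positivity)
    have : 0 ≤ J * (Γ * A) := by positivity
    linarith

/-- The solutions of the schemes converge uniformly, and the limit is a solution in the sense of
mollifications. -/
theorem exists_limit (hS : S.Admissible m h₀ τ₀ δ K c₀ M f)
    (hm : 2 ≤ m) (hδ1 : δ ≤ 1) (hK : 0 ≤ K) (hτ₀ : 0 < τ₀) (hc₀ : 0 < c₀) (hh₀ : 0 < h₀)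
    {F : ℝ} (hF : 0 ≤ F) {u : ℕ → SB d}
    (hu : ∀ k, (approxScheme S τ₀ h₀ k).op (u k) + mollSB (kern d k) f = 0)
    (huF : ∀ k, ∀ j ≤ 2, ∀ x, wsum j (fun w => iter SB.D w (u k) x ^ 2) ≤ F) :
    ∃ (v : E d → ℝ) (C : ℝ), BddBorel v ∧ Continuous v ∧
      TendstoUniformly (fun k => (u k : E d → ℝ)) v Filter.atTop ∧
      ∀ (n : ℕ) (x : E d), |S.clOp (mollSB (kern d n) v) x + f x| ≤ C * (1 / ((n : ℝ) + 1)) := by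
  obtain ⟨C, hC0, hC⟩ := exists_approx_bound hS hm hδ1 hK hτ₀ hc₀ hh₀ hF
  choose C' hC'0 hC' using hC
  have hlim : ∀ c : ℝ, Filter.Tendsto (fun k : ℕ => c * (1 / ((k : ℝ) + 1))) Filter.atTop
      (nhds 0) := fun c => by
    simpa using tendsto_one_div_add_atTop_nhds_zero_nat.const_mul c
  have hmono : ∀ {a b : ℕ}, a ≤ b → 1 / ((b : ℝ) + 1) ≤ 1 / ((a : ℝ) + 1) := fun h => by
    have : (_ : ℝ) ≤ _ := Nat.cast_le.2 h
    gcongr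
  have hcau : UniformCauchySeqOn (fun k => (u k : E d → ℝ)) Filter.atTop Set.univ := by
    rw [Metric.uniformCauchySeqOn_iff]
    intro e he
    -- First `n` is fixed, making small the errors that do not depend on `k`: `2 C / c₀` from
    -- comparing the mollified solutions and `2 C` from removing the two mollifications. Only then
    -- is `N` chosen, depending on `C' n`.
    have h1 := hlim (2 * C / c₀ + 2 * C)
    obtain ⟨n, hn⟩ := (h1.eventually (gt_mem_nhds (half_pos he))).exists
    obtain ⟨N, hN⟩ := (Filter.eventually_atTop.1 ((hlim (2 * C' n / c₀)).eventually
      (gt_mem_nhds (half_pos he))))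
    refine ⟨N, fun a ha b hb x _ => ?_⟩
    have h2 := abs_sub_le_of_clOp hS hm hδ1 hK hτ₀ hc₀ hh₀
      (fun y => (hC' n a (u a) (hu a) (huF a) y).1) (fun y => (hC' n b (u b) (hu b) (huF b) y).1) x
    have h3 := (hC' n a (u a) (hu a) (huF a) x).2
    have h4 := (hC' n b (u b) (hu b) (huF b) x).2
    have h5 := mul_le_mul_of_nonneg_left (hmono ha) (hC'0 n)
    have h6 := mul_le_mul_of_nonneg_left (hmono hb) (hC'0 n)
    have h7 := hN N le_rfl
    have h8 : |mollSB (kern d n) (u a) x - mollSB (kern d n) (u b) x| ≤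
        (2 * C / c₀) * (1 / ((n : ℝ) + 1)) + 2 * C' n / c₀ * (1 / ((N : ℝ) + 1)) := by
      refine h2.trans ?_
      rw [div_le_iff₀ hc₀]
      have e1 : (2 * C / c₀ * (1 / ((n : ℝ) + 1)) + 2 * C' n / c₀ * (1 / ((N : ℝ) + 1))) * c₀ =
          2 * C * (1 / ((n : ℝ) + 1)) + 2 * C' n * (1 / ((N : ℝ) + 1)) := by
        rw [add_mul, mul_right_comm, div_mul_cancel₀ _ hc₀.ne', mul_right_comm _ _ c₀,
          div_mul_cancel₀ _ hc₀.ne']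
      linarith
    rw [Real.dist_eq]
    rw [abs_le] at h3 h4 h8
    refine lt_of_le_of_lt (b := 2 * C / c₀ * (1 / ((n : ℝ) + 1)) +
      2 * C' n / c₀ * (1 / ((N : ℝ) + 1)) + 2 * (C * (1 / ((n : ℝ) + 1)))) ?_ (by linarith)
    rw [abs_le]
    constructor <;> linarith
  have hpt : ∀ x, ∃ y, Filter.Tendsto (fun k => u k x) Filter.atTop (nhds y) := fun x =>
    cauchySeq_tendsto_of_complete (hcau.cauchySeq (Set.mem_univ x))
  choose v hv using hpt
  have hunif : TendstoUniformly (fun k => (u k : E d → ℝ)) v Filter.atTop :=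
    tendstoUniformlyOn_univ.1 (hcau.tendstoUniformlyOn_of_tendsto fun x _ => hv x)
  have hcont : Continuous v :=
    hunif.continuous (Filter.Frequently.of_forall fun k => SB.continuous (u k))
  have hbd : ∀ x, |v x| ≤ 1 + F := fun x => by
    refine le_of_tendsto (hv x).abs (.of_forall fun k => abs_le_one_add_of_sq_le ?_)
    simpa [wsum_zero] using huF k 0 (by norm_num) x
  have hvB : BddBorel v := ⟨hcont.measurable, _, hbd⟩
  refine ⟨v, C, hvB, hcont, hunif, fun n x => ?_⟩
  have hg := isKernel_kern (d := d) n
  obtain ⟨T, hT0, hT⟩ := exists_dd_mollSB_bound hg.test S.Λ₁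
  -- With the derivatives moved onto the kernel, `𝓛` of a mollified function is continuous under
  -- uniform convergence; the added 1 accounts for the zero-order term.
  have hT' : ∀ (ψ : E d → ℝ) (V : ℝ), BddBorel ψ → (∀ x, |ψ x| ≤ V) → ∀ (j : S.J) (y : E d),
      |S.cop j (mollSB (kern d n) ψ) y| ≤ (T + 1) * V := by
    intro ψ V hψ hV j y
    have hV0 := (abs_nonneg _).trans (hV 0)
    rcases j with (l | l) | _
    · have := (hT ψ V hψ hV l l.2 y).2.1
      change |1 / 2 * SB.dd (l : E d) (SB.dd (l : E d) (mollSB (kern d n) ψ)) y| ≤ _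
      rw [abs_mul, abs_of_pos (by norm_num : (0 : ℝ) < 1 / 2)]
      nlinarith [abs_nonneg (SB.dd (l : E d) (SB.dd (l : E d) (mollSB (kern d n) ψ)) y)]
    · have := (hT ψ V hψ hV l l.2 y).1
      change |SB.dd (l : E d) (mollSB (kern d n) ψ) y| ≤ _
      linarith
    · have := abs_moll_le_of_isKernel hg (.of_forall hV) y
      change |mollSB (kern d n) ψ y| ≤ _
      rw [mollSB_coe hg.test hψ]
      nlinarith
  have hcop : ∀ j, Filter.Tendsto (fun k => S.cop j (mollSB (kern d n) (u k)) x) Filter.atTop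
      (nhds (S.cop j (mollSB (kern d n) v) x)) := by
    intro j
    rw [Metric.tendsto_atTop]
    intro e he
    obtain ⟨N, hN⟩ := Filter.eventually_atTop.1
      (Metric.tendstoUniformly_iff.1 hunif (e / (2 * (T + 1))) (by positivity))
    refine ⟨N, fun k hk => ?_⟩
    have hsub : mollSB (kern d n) (u k) - mollSB (kern d n) v =
        mollSB (kern d n) (fun z => u k z - v z) := by
      ext z
      rw [SB.sub_apply, mollSB_coe hg.test (SB.bddBorel _), mollSB_coe hg.test hvB,
        mollSB_coe hg.test ((SB.bddBorel _).sub hvB), moll_sub hg.test (SB.bddBorel _) hvB]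
    rw [Real.dist_eq, ← SB.sub_apply, ← map_sub, hsub]
    refine lt_of_le_of_lt (hT' _ (e / (2 * (T + 1))) ((SB.bddBorel _).sub hvB)
      (fun z => ?_) j x) ?_
    · have := hN k hk z
      rw [dist_comm, Real.dist_eq] at this
      exact this.le
    · have : (T + 1) * (e / (2 * (T + 1))) = e / 2 := by field_simp
      linarith
  have h1 : Filter.Tendsto (fun k => |S.clOp (mollSB (kern d n) (u k)) x + f x|) Filter.atTop
      (nhds |S.clOp (mollSB (kern d n) v) x + f x|) :=
    ((tendsto_finsetSum _ fun j _ => (hcop j).const_mul _).add_const _).abs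
  have h2 := (hlim (C' n)).const_add (C * (1 / ((n : ℝ) + 1)))
  rw [add_zero] at h2
  exact le_of_tendsto_of_tendsto' h1 h2 fun k => (hC' n k (u k) (hu k) (huF k) x).1

end Convergence

/-! ### Generalized derivatives of limits -/

lemma tendsto_integral_mul {u : ℕ → E d → ℝ} {v : E d → ℝ} {B : ℝ} (hm : ∀ k, Measurable (u k))
    (hB : ∀ k x, |u k x| ≤ B) (hv : ∀ x, Filter.Tendsto (fun k => u k x) Filter.atTop (nhds (v x)))
    {χ : E d → ℝ} (hχ : Integrable χ) :
    Filter.Tendsto (fun k => ∫ x, u k x * χ x) Filter.atTop (nhds (∫ x, v x * χ x)) := by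
  refine tendsto_integral_of_dominated_convergence (fun x => B * |χ x|)
    (fun k => (hm k).aestronglyMeasurable.mul hχ.aestronglyMeasurable) (hχ.abs.const_mul B)
    (fun k => .of_forall fun x => ?_) (.of_forall fun x => (hv x).mul_const _)
  rw [norm_mul, Real.norm_eq_abs, Real.norm_eq_abs]
  exact mul_le_mul_of_nonneg_right (hB k x) (abs_nonneg _)

/-- A positive square integrable weight. -/
def weight (x : E d) : ℝ := (1 + ‖x‖) ^ (-((d : ℝ) + 1))

lemma weight_pos (x : E d) : 0 < weight x := Real.rpow_pos_of_pos (by positivity) _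

lemma continuous_weight : Continuous (weight (d := d)) :=
  (continuous_const.add continuous_norm).rpow_const fun x => Or.inl
    (by linarith [norm_nonneg x] : (0 : ℝ) < 1 + ‖x‖).ne'

lemma memLp_weight : MemLp (weight (d := d)) 2 volume := by
  rw [memLp_two_iff_integrable_sq continuous_weight.aestronglyMeasurable]
  have h1 : Integrable (fun x : E d => (1 + ‖x‖) ^ (-(2 * ((d : ℝ) + 1)))) := by
    refine integrable_one_add_norm ?_
    rw [finrank_euclideanSpace, Fintype.card_fin]
    linarith [Nat.cast_nonneg (α := ℝ) d]
  refine h1.congr (.of_forall fun x => ?_)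
  change (1 + ‖x‖) ^ (-(2 * ((d : ℝ) + 1))) = ((1 + ‖x‖) ^ (-((d : ℝ) + 1))) ^ 2
  rw [← Real.rpow_natCast, ← Real.rpow_mul (by positivity)]
  congr 1
  push_cast
  ring

/-- Multiplication by a positive square integrable weight turns bounded functions into a bounded
sequence in `L²`. By Banach–Alaoglu it has a weak limit along an ultrafilter, and division by the
weight gives `w`. An ultrafilter limit is enough because the integrals concerned are assumed to
converge. -/
lemma exists_weak_limit {a : ℕ → E d → ℝ} {C : ℝ} (hm : ∀ k, Measurable (a k))
    (hC : ∀ k x, |a k x| ≤ C) : ∃ w : E d → ℝ, Measurable w ∧ LocallyIntegrable w ∧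
      ∀ φ : E d → ℝ, Continuous φ → HasCompactSupport φ → ∀ y : ℝ,
        Filter.Tendsto (fun k => ∫ x, a k x * φ x) Filter.atTop (nhds y) →
        ∫ x, w x * φ x = y := by
  have hG : ∀ k, MemLp (fun x => a k x * weight x) 2 volume := fun k =>
    memLp_weight.of_le_mul ((hm k).aestronglyMeasurable.mul
      continuous_weight.aestronglyMeasurable) (.of_forall fun x => by
      rw [norm_mul]
      exact mul_le_mul_of_nonneg_right (hC k x) (norm_nonneg _))
  set G : ℕ → Lp ℝ 2 (volume : Measure (E d)) := fun k => (hG k).toLp _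
  set W : Lp ℝ 2 (volume : Measure (E d)) := memLp_weight.toLp _
  have hGn : ∀ k, ‖G k‖ ≤ C * ‖W‖ := fun k => by
    refine Lp.norm_le_mul_norm_of_ae_le_mul ?_
    filter_upwards [(hG k).coeFn_toLp, memLp_weight.coeFn_toLp] with x h1 h2
    rw [h1, h2, norm_mul]
    exact mul_le_mul_of_nonneg_right (hC k x) (norm_nonneg _)
  let Φ : ℕ → WeakDual ℝ (Lp ℝ 2 (volume : Measure (E d))) := fun k =>
    StrongDual.toWeakDual (InnerProductSpace.toDual ℝ _ (G k))
  obtain ⟨ℓ, -, hℓ⟩ := (WeakDual.isCompact_closedBall (𝕜 := ℝ)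
    (E := Lp ℝ 2 (volume : Measure (E d))) 0 (C * ‖W‖)).ultrafilter_le_nhds
    ((Filter.hyperfilter ℕ).map Φ) (by
      rw [Ultrafilter.coe_map, Filter.le_principal_iff, Filter.mem_map]
      refine Filter.univ_mem' fun k => ?_
      change InnerProductSpace.toDual ℝ _ (G k) ∈ Metric.closedBall _ _
      rw [mem_closedBall_zero_iff, LinearIsometryEquiv.norm_map]
      exact hGn k)
  set γ := (InnerProductSpace.toDual ℝ _).symm (WeakDual.toStrongDual ℓ) with hγ
  have hlim : ∀ ξ : Lp ℝ 2 (volume : Measure (E d)),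
      Filter.Tendsto (fun k => inner ℝ (G k) ξ) (Filter.hyperfilter ℕ) (nhds (inner ℝ γ ξ)) := by
    intro ξ
    rw [hγ, InnerProductSpace.toDual_symm_apply]
    exact ((WeakDual.eval_continuous ξ).tendsto ℓ).comp hℓ
  refine ⟨fun x => γ x * (weight x)⁻¹, (Lp.stronglyMeasurable γ).measurable.mul
    continuous_weight.measurable.inv, ?_, fun φ hφ hφ' y hy => ?_⟩
  · exact ((Lp.memLp γ).locallyIntegrable (by norm_num)).mul_continuous
      (continuous_weight.inv₀ fun x => (weight_pos x).ne')
  · have hξ : MemLp (fun x => (weight x)⁻¹ * φ x) 2 volume :=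
      ((continuous_weight.inv₀ fun x => (weight_pos x).ne').mul hφ).memLp_of_hasCompactSupport
        hφ'.mul_left
    have e1 : inner ℝ γ (hξ.toLp _) = ∫ x, γ x * (weight x)⁻¹ * φ x := by
      rw [L2.inner_def]
      refine integral_congr_ae ?_
      filter_upwards [hξ.coeFn_toLp] with x hx
      rw [hx, RCLike.inner_apply, conj_trivial]; ring
    have e2 : ∀ k, inner ℝ (G k) (hξ.toLp _) = ∫ x, a k x * φ x := by
      intro k
      rw [L2.inner_def]
      refine integral_congr_ae ?_
      filter_upwards [hξ.coeFn_toLp, (hG k).coeFn_toLp] with x hx hx'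
      rw [hx, hx', RCLike.inner_apply, conj_trivial]
      have := (weight_pos x).ne'
      field_simp
    have h1 := hlim (hξ.toLp _)
    simp only [e1, e2] at h1
    exact tendsto_nhds_unique h1 (hy.mono_left Nat.hyperfilter_le_atTop)

section Limit

variable {u : ℕ → SB d} {v : E d → ℝ} {B : ℝ}

lemma tendsto_mderiv_moll (hvB : BddBorel v) (hB : ∀ k x, |u k x| ≤ B)
    (hv : ∀ x, Filter.Tendsto (fun k => u k x) Filter.atTop (nhds (v x)))
    {g : E d → ℝ} (hg : IsTest g) (α : Fin d → ℕ) (x : E d) :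
    Filter.Tendsto (fun k => moll g (mderiv α (u k)) x) Filter.atTop
      (nhds (mderiv α (moll g v) x)) := by
  have e : ∀ {ψ : E d → ℝ}, BddBorel ψ → mderiv α (moll g ψ) x =
      ∫ t, ψ t * fiter (word α) g (x - t) := fun hψ => by
    rw [mderiv_eq_fiter, fiter_moll hg hψ.locallyIntegrable, moll]
  rw [e hvB]
  simp only [← mderiv_moll hg (SB.bddBorel _) (SB.isGenDeriv (u _) α), e (SB.bddBorel _)]
  exact tendsto_integral_mul (fun k => (SB.continuous (u k)).measurable) hB hv
    ((hg.fiter _).reflect x).integrable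

/-- A weak limit `w` of the derivatives satisfies the integral identity but is so far only locally
integrable. Its mollifications are derivatives of those of `v`, hence limits of mollified `D^α u_k`,
hence bounded by `C`; Lebesgue differentiation transfers the bound to `w`. -/
lemma exists_isGenDeriv_limit (hvB : BddBorel v) (hB : ∀ k x, |u k x| ≤ B)
    (hv : ∀ x, Filter.Tendsto (fun k => u k x) Filter.atTop (nhds (v x)))
    {α : Fin d → ℕ} {C : ℝ} (hC : ∀ k x, |mderiv α (u k) x| ≤ C) : ∃ w, IsGenDeriv α v w := by
  have hmeas : ∀ k, Measurable (mderiv α (u k)) := fun k => (SB.isGenDeriv (u k) α).1.1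
  obtain ⟨w, hwm, hwl, hw⟩ := exists_weak_limit hmeas hC
  have hsq : ((-1 : ℝ) ^ (∑ i, α i)) * (-1 : ℝ) ^ (∑ i, α i) = 1 := by
    rw [← mul_pow]; norm_num
  have hweak : ∀ φ : E d → ℝ, ContDiff ℝ ∞ φ → HasCompactSupport φ →
      ∫ x, v x * mderiv α φ x = (-1 : ℝ) ^ (∑ i, α i) * ∫ x, w x * φ x := by
    intro φ h1 h2
    have ht : IsTest φ := ⟨h1, h2⟩
    have h3 := (tendsto_integral_mul (fun k => (SB.continuous (u k)).measurable) hB hv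
      (ht.mderiv α).integrable).const_mul ((-1 : ℝ) ^ (∑ i, α i))
    simp only [fun k => (SB.isGenDeriv (u k) α).integral_eq ht, ← mul_assoc, hsq, one_mul] at h3
    rw [hw φ h1.continuous h2 _ h3, ← mul_assoc, hsq, one_mul]
  have hbound : ∀ᵐ x, |w x| ≤ C := by
    filter_upwards [ae_tendsto_moll hwl] with x hx
    refine le_of_tendsto hx.abs (.of_forall fun n => ?_)
    have hg := isKernel_kern (d := d) n
    rw [← moll_weak hg.test hvB.locallyIntegrable hweak]
    refine le_of_tendsto (tendsto_mderiv_moll hvB hB hv hg.test α x).abs (.of_forall fun k => ?_)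
    exact abs_moll_le_of_isKernel hg (.of_forall (hC k)) x
  have hC0 : 0 ≤ C := (abs_nonneg _).trans (hC 0 0)
  -- The representative must be bounded everywhere, so `w` is truncated at level `C`, which changes
  -- it only on a null set.
  have hae : ∀ᵐ x, max (-C) (min (w x) C) = w x := by
    filter_upwards [hbound] with x hx
    rw [min_eq_left (abs_le.1 hx).2, max_eq_right (abs_le.1 hx).1]
  refine ⟨fun x => max (-C) (min (w x) C),
    ⟨measurable_const.max (hwm.min measurable_const), C, fun x => abs_le.2
      ⟨le_max_left _ _, max_le (by linarith) (min_le_right _ _)⟩⟩, fun φ h1 h2 => ?_⟩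
  rw [hweak φ h1 h2]
  congr 1
  refine integral_congr_ae ?_
  filter_upwards [hae] with x hx
  rw [hx]

/-- Two limits at the level of mollifications, first in `k` and then in the scale; working with the
whole sum of squares preserves the constant. -/
lemma ae_sum_sq_genDeriv_le (hvB : BddBorel v) (hB : ∀ k x, |u k x| ≤ B)
    (hv : ∀ x, Filter.Tendsto (fun k => u k x) Filter.atTop (nhds (v x)))
    {ι : Type} (s : Finset ι) (α : ι → Fin d → ℕ) (hα : ∀ i ∈ s, ∃ w, IsGenDeriv (α i) v w) {C : ℝ}
    (hC : ∀ k x, ∑ i ∈ s, mderiv (α i) (u k) x ^ 2 ≤ C) :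
    ∀ᵐ x, ∑ i ∈ s, genDeriv (α i) v x ^ 2 ≤ C := by
  have hgen := fun i hi => isGenDeriv_genDeriv (hα i hi)
  have h1 : ∀ᵐ x, ∀ i ∈ s, Filter.Tendsto (fun n => moll (kern d n) (genDeriv (α i) v) x)
      Filter.atTop (nhds (genDeriv (α i) v x)) :=
    (Filter.eventually_all_finset s).2 fun i hi => ae_tendsto_moll (hgen i hi).1.locallyIntegrable
  filter_upwards [h1] with x hx
  refine le_of_tendsto (tendsto_finsetSum s fun i hi => (hx i hi).pow 2) (.of_forall fun n => ?_)
  have hg := isKernel_kern (d := d) n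
  rw [Finset.sum_congr rfl fun i hi => by rw [← mderiv_moll hg.test hvB (hgen i hi)]]
  refine le_of_tendsto (tendsto_finsetSum s fun i _ =>
    (tendsto_mderiv_moll hvB hB hv hg.test (α i) x).pow 2) (.of_forall fun k => ?_)
  exact sum_sq_moll_le s hg (fun i _ => (SB.isGenDeriv (u k) (α i)).1) C (.of_forall (hC k)) x

end Limit

/-! ### The norm of `𝔅^m` -/

section Norm

variable {m : ℕ} {ψ : E d → ℝ}

lemma MemB.mono {n : ℕ} (h : MemB m ψ) (hn : n ≤ m) : MemB n ψ :=
  ⟨h.1, h.2.1, fun α hα => h.2.2 α (hα.trans hn)⟩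

lemma MemB.ae_sum_derivSq_le (hψ : MemB m ψ) : 0 ≤ normB m ψ ∧
    ∀ᵐ x, ∑ k ∈ Finset.range (m + 1), derivSq k ψ x ≤ normB m ψ ^ 2 := by
  have hb : BddBorel fun x => ∑ k ∈ Finset.range (m + 1), derivSq k ψ x :=
    BddBorel.sum fun k hk => BddBorel.sum fun α hα => by
      have hα' : ∑ i, α i ≤ m := by
        rw [(Finset.mem_piAntidiag.1 hα).1]
        exact Nat.lt_succ_iff.1 (Finset.mem_range.1 hk)
      have := (hψ.genDeriv hα').1
      exact (congrArg BddBorel (funext fun x => (sq (DegenScheme.genDeriv α ψ x)).symm)).mp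
        (this.mul this)
  obtain ⟨-, C, hC⟩ := hb
  have h1 : ∀ᵐ x, ∑ k ∈ Finset.range (m + 1), derivSq k ψ x ≤
      essSup (fun x => ∑ k ∈ Finset.range (m + 1), derivSq k ψ x) volume :=
    ae_le_essSup ⟨C, by
      rw [Filter.eventually_map]
      exact .of_forall fun x => (le_abs_self _).trans (hC x)⟩
  have h2 : 0 ≤ essSup (fun x => ∑ k ∈ Finset.range (m + 1), derivSq k ψ x) volume := by
    obtain ⟨x, hx⟩ := h1.exists
    exact (Finset.sum_nonneg fun k _ => derivSq_nonneg k ψ x).trans hx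
  refine ⟨Real.sqrt_nonneg _, ?_⟩
  rw [normB, Real.sq_sqrt h2]
  exact h1

lemma normB_le {C : ℝ} (h : ∀ᵐ x, ∑ k ∈ Finset.range (m + 1), derivSq k ψ x ≤ C) :
    normB m ψ ≤ Real.sqrt C := by
  refine Real.sqrt_le_sqrt (Filter.limsup_le_of_le ?_ h)
  refine Filter.IsCoboundedUnder.of_frequently_ge (a := 0) (Filter.Frequently.of_forall fun x => ?_)
  exact Finset.sum_nonneg fun k _ => derivSq_nonneg k ψ x

lemma wsum_mollSB_le_normB (hψ : MemB m ψ) {ε : ℝ} {g : E d → ℝ} (hg : IsKernel ε g) {j : ℕ}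
    (hj : j ≤ m) (x : E d) : wsum j (fun w => iter SB.D w (mollSB g ψ) x ^ 2) ≤
      m.factorial * normB m ψ ^ 2 := by
  have h1 := wsum_sq_iter_mollSB_le (ι := Unit) (ψ := fun _ => ψ) hg (fun _ => hψ) hj
    (normB m ψ ^ 2) (by
      filter_upwards [hψ.ae_sum_derivSq_le.2] with z hz
      rw [Fintype.sum_unique]
      exact (Finset.single_le_sum (f := fun k => derivSq k ψ z) (fun k _ => derivSq_nonneg k ψ z)
        (Finset.mem_range.2 (Nat.lt_succ_iff.2 hj))).trans hz) x
  rw [Fintype.sum_unique] at h1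
  refine h1.trans (mul_le_mul_of_nonneg_right ?_ (sq_nonneg _))
  exact_mod_cast Nat.factorial_le hj

lemma memB_of_limit {u : ℕ → SB d} {v : E d → ℝ} {F : ℝ} (hvB : BddBorel v) (hvc : Continuous v)
    (hv : ∀ x, Filter.Tendsto (fun k => u k x) Filter.atTop (nhds (v x)))
    (hF : ∀ k, ∀ j ≤ m, ∀ x, wsum j (fun w => iter SB.D w (u k) x ^ 2) ≤ F) :
    MemB m v ∧ ∀ᵐ x, ∑ k ∈ Finset.range (m + 1), derivSq k v x ≤ ((m : ℝ) + 1) * F := by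
  have hB : ∀ k x, |u k x| ≤ 1 + F := fun k x => abs_le_one_add_of_sq_le (by
    simpa [wsum_zero] using hF k 0 (Nat.zero_le _) x)
  have hmem : MemB m v := by
    refine ⟨hvc, hvB.2, fun α hα => ?_⟩
    refine exists_isGenDeriv_limit hvB hB hv (C := 1 + F) fun k x =>
      abs_le_one_add_of_sq_le ?_
    refine le_trans ?_ ((sum_mderiv_sq_le (∑ i, α i) (u k) x).trans (hF k _ hα x))
    exact Finset.single_le_sum (f := fun α => mderiv α (u k) x ^ 2) (fun _ _ => sq_nonneg _)
      (Finset.mem_piAntidiag.2 ⟨rfl, fun _ _ => Finset.mem_univ _⟩)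
  refine ⟨hmem, ?_⟩
  have h1 := ae_sum_sq_genDeriv_le hvB hB hv
    ((Finset.range (m + 1)).sigma fun k => Finset.piAntidiag (Finset.univ : Finset (Fin d)) k)
    (fun p => p.2) (fun p hp => hmem.2.2 p.2 (by
      rw [Finset.mem_sigma, Finset.mem_piAntidiag] at hp
      rw [hp.2.1]
      exact Nat.lt_succ_iff.1 (Finset.mem_range.1 hp.1))) (C := ((m : ℝ) + 1) * F) fun k x => by
      rw [Finset.sum_sigma]
      refine (Finset.sum_le_sum fun j hj => (sum_mderiv_sq_le j (u k) x).trans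
        (hF k j (Nat.lt_succ_iff.1 (Finset.mem_range.1 hj)) x)).trans (le_of_eq ?_)
      simp
  filter_upwards [h1] with x hx
  rw [Finset.sum_sigma] at hx
  exact hx

end Norm

/-! ### Existence and uniqueness -/

section Solution

variable {S : Data d} {m : ℕ} {h₀ τ₀ δ K c₀ : ℝ} {M : Fin (m + 1) → ℝ} {f : E d → ℝ}

lemma bddBorel_op_add (hR : S.Regular m M f) {w : E d → ℝ} (hw : MemB 2 w) :
    BddBorel fun z => S.op w z + f z := by
  simp only [op_eq_sum_gop]
  exact (BddBorel.sum fun j _ => (hR.coef_regular j).1.mul (bddBorel_gop hw j)).add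
    hR.f_mem.bddBorel

lemma tendsto_mul_one_div (c : ℝ) :
    Filter.Tendsto (fun k : ℕ => c * (1 / ((k : ℝ) + 1))) Filter.atTop (nhds 0) := by
  simpa using tendsto_one_div_add_atTop_nhds_zero_nat.const_mul c

/-- The mollifications of the bounded function `𝓛 v + f` differ from `𝓛` of the mollified `v` plus
`f` by `O(1 / (n + 1))`, so they tend to zero, while almost everywhere they tend to `𝓛 v + f`
itself. -/
lemma isSolution_of_clOp (hR : S.Regular m M f) (hm : 2 ≤ m) {v : E d → ℝ} (hv : MemB 2 v) {C : ℝ}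
    (hC : ∀ (n : ℕ) (x : E d), |S.clOp (mollSB (kern d n) v) x + f x| ≤ C * (1 / ((n : ℝ) + 1))) :
    S.IsSolution f v := by
  refine ⟨hv, ?_⟩
  obtain ⟨C', hC'0, hC'⟩ := exists_moll_op_bound hR (by omega) hv
  filter_upwards [ae_tendsto_moll (bddBorel_op_add hR hv).locallyIntegrable] with x hx
  refine tendsto_nhds_unique hx (squeeze_zero_norm (fun n => ?_) (tendsto_mul_one_div (C + C')))
  have h1 := (hC' n x).1
  have h2 := hC n x
  rw [Real.norm_eq_abs]
  have := abs_add_le (S.clOp (mollSB (kern d n) v) x + f x)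
    (moll (kern d n) (fun z => S.op v z + f z) x - (S.clOp (mollSB (kern d n) v) x + f x))
  rw [add_sub_cancel] at this
  linarith

lemma IsSolution.exists_clOp_bound (hR : S.Regular m M f) (hm : 2 ≤ m) {w : E d → ℝ}
    (hw : S.IsSolution f w) : ∃ C : ℝ, ∀ (n : ℕ) (x : E d),
      |S.clOp (mollSB (kern d n) w) x + f x| ≤ C * (1 / ((n : ℝ) + 1)) := by
  obtain ⟨C, -, hC⟩ := exists_moll_op_bound hR (by omega) hw.1
  refine ⟨C, fun n x => ?_⟩
  have h1 := (hC n x).1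
  rwa [moll_congr hw.2, moll_const (isKernel_kern n), zero_sub, abs_neg] at h1

/-- Mollified solutions satisfy the equation up to `O(1 / (n + 1))` and are smooth, so the maximum
principle for `𝓛` makes their difference `O(1 / (n + 1))`; continuity of the solutions turns the
limit into equality everywhere. -/
lemma IsSolution.eq (hS : S.Admissible m h₀ τ₀ δ K c₀ M f)
    (hm : 2 ≤ m) (hδ1 : δ ≤ 1) (hK : 0 ≤ K) (hτ₀ : 0 < τ₀) (hc₀ : 0 < c₀) (hh₀ : 0 < h₀)
    {v w : E d → ℝ} (hv : S.IsSolution f v) (hw : S.IsSolution f w) : w = v := by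
  obtain ⟨C, hC⟩ := IsSolution.exists_clOp_bound hS.regular hm hv
  obtain ⟨C', hC'⟩ := IsSolution.exists_clOp_bound hS.regular hm hw
  ext x
  have h1 := (tendsto_moll hw.1.1 x).sub (tendsto_moll hv.1.1 x)
  refine sub_eq_zero.1 (tendsto_nhds_unique h1
    (squeeze_zero_norm (fun n => ?_) (tendsto_mul_one_div ((C' + C) / c₀))))
  have h2 := abs_sub_le_of_clOp hS hm hδ1 hK hτ₀ hc₀ hh₀ (hC' n) (hC n) x
  have hg := isKernel_kern (d := d) n
  rw [mollSB_coe hg.test hw.1.bddBorel, mollSB_coe hg.test hv.1.bddBorel] at h2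
  rwa [Real.norm_eq_abs, div_mul_eq_mul_div, add_mul]

end Solution

end DegenScheme

end

/-! ### The main theorem. -/

theorem theorem1p22p11p08 (m : ℕ) (hm : 2 ≤ m)
    (δ K τ₀ c₀ : ℝ) (hδ : 0 < δ) (hδ1 : δ ≤ 1) (hK : 1 ≤ K) (hτ₀ : 0 < τ₀) (hc₀ : 0 < c₀)
    (M : Fin (m + 1) → ℝ) (r s : ℝ) :
    ∃ N : ℝ, ∀ (d : ℕ) (h₀ : ℝ) (S : DegenScheme.Data d) (f : DegenScheme.E d → ℝ),
      0 < h₀ → S.size = r → S.wsize = s →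
      S.Admissible m h₀ τ₀ δ K c₀ M f →
      ∃ v : DegenScheme.E d → ℝ,
        S.IsSolution f v ∧ (∀ w, S.IsSolution f w → w = v) ∧
        DegenScheme.MemB m v ∧
        DegenScheme.normB m v ≤ N * DegenScheme.normB m f := by
  open DegenScheme in
  obtain ⟨N, hN0, hN⟩ := SmoothScheme.exists_estimate m δ K c₀ τ₀ (r ^ 2) (s ^ 2)
    (∑ k : Fin (m + 1), ((k : ℕ).factorial : ℝ) * M k ^ 2) hδ hδ1 (by linarith) hc₀
  -- Here `m!` comes from bounding word sums of the mollified `f` by the norm of `f`, `N` from the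
  -- discrete estimate, and `m + 1` from adding the orders `0, …, m`; the root is taken because all
  -- of these concern squares.
  refine ⟨Real.sqrt ((m + 1) * (N * m.factorial)), fun d h₀ S f hh₀ hr hs hS => ?_⟩
  have hK0 : 0 ≤ K := by linarith
  have hadm := approxScheme_admissible hS hm hδ1 hK0 hτ₀ hc₀ hh₀
  choose u hu using fun k => SmoothScheme.exists_solution (hadm k).h_pos hc₀ (hadm k).χ_nonneg
    (hadm k).c_lower (mollSB (kern d k) f)
  have huF : ∀ k, ∀ j ≤ m, ∀ x, wsum j (fun w => iter SB.D w (u k) x ^ 2) ≤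
      N * (m.factorial * normB m f ^ 2) := fun k =>
    hN d (approxScheme S τ₀ h₀ k) _ (u k) _ rfl (hr ▸ hs ▸ hadm k) (hu k) fun j hj x =>
      wsum_mollSB_le_normB hS.regular.f_mem (isKernel_kern k) hj x
  obtain ⟨v, C, hvB, hvc, hunif, hvC⟩ := exists_limit hS hm hδ1 hK0 hτ₀ hc₀ hh₀
    (by positivity) hu fun k j hj => huF k j (hj.trans hm)
  obtain ⟨hmem, hle⟩ := memB_of_limit hvB hvc (fun x => hunif.tendsto_at x) huF
  have hsol := isSolution_of_clOp hS.regular hm (hmem.mono hm) hvC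
  refine ⟨v, hsol, fun w hw => IsSolution.eq hS hm hδ1 hK0 hτ₀ hc₀ hh₀ hsol hw, hmem,
    (normB_le hle).trans (le_of_eq ?_)⟩
  have e : ((m : ℝ) + 1) * (N * (m.factorial * normB m f ^ 2)) =
      (m + 1) * (N * m.factorial) * normB m f ^ 2 := by ring
  rw [e, Real.sqrt_mul (by positivity), Real.sqrt_sq hS.regular.f_mem.ae_sum_derivSq_le.1]
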